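/- **Setting.** Let $d\ge 1$, let $U\subset\mathbb R^d$ be open, and call a Lebesgue measurable function $\omega:U\to(0,\infty)$ a weight on $U$. It satisfies the compact boundedness condition if $0<\inf_K\omega\le\sup_K\omega<\infty$ for every non-empty compact $K\subset U$. A function on $U$ is locally Lipschitz if its restriction to each compact subset of $U$ is Lipschitz. Functions are identified when they agree almost everywhere. For $p\in[1,\infty)$, $W^{1,p}(U,\omega)$ is the space of $\phi:U\to\mathbb C$ that have a weak gradient $\nabla\phi$ (both locally integrable on $U$) and for which $$\|\phi\|_{W^{1,p}(U,\omega)}=\Big(\int_U|\phi|^p\omega\,dx+\sum_{i=1}^d\int_U|\partial_i\phi|^p\omega\,dx\Big)^{1/p}<\infty .$$ $Lip_c(U)$ is the space of Lipschitz functions $U\to\mathbb C$ whose support is a compact subset of $U$, and $W^{1,p}_0(U,\omega)$ is its closure in $W^{1,p}(U,\omega)$, with the same norm. For two normed spaces $A_0,A_1$ contained in a common vector space, $A_0+A_1$ has the norm $\inf\{\|a_0\|_{A_0}+\|a_1\|_{A_1}:a_0+a_1=a\}$; $\mathcal F(A_0,A_1)$ is the set of functions $f$ from $\{0\le\operatorname{Re}z\le1\}$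 to $A_0+A_1$ that are continuous and bounded, analytic in the interior, and such that $t\mapsto f(j+it)$ is a continuous bounded map from $\mathbb R$ into $A_j$ for $j=0,1$, with $\|f\|_{\mathcal F}=\max_{j}\sup_{t}\|f(j+it)\|_{A_j}$; and $[A_0,A_1]_\theta=\{f(\theta):f\in\mathcal F(A_0,A_1)\}$ with $\|a\|_{[A_0,A_1]_\theta}=\inf\{\|f\|_{\mathcal F}:f(\theta)=a\}$. **Theorem 1.1.** Let $p\in[1,\infty)$. There is a constant $C_p>0$, depending only on $p$, such that the following holds for every $d\ge1$, every open $U\subset\mathbb R^d$, all weights $\omega_0,\omega_1$ on $U$ that satisfy the compact boundedness condition and for which $r_\omega=\omega_0/\omega_1$ is locally Lipschitz on $U$, and every $\theta\in(0,1)$. Put $\omega_\theta=\omega_0^{1-\theta}\omega_1^{\theta}$. For a norm $|\cdot|$ on $\mathbb R^d$ put $$\|\phi\|_{\mathcal W^p(U,\theta,r_\omega)}=\Big(\|\phi\|^p_{W^{1,p}(U,\omega_\theta)}+\int_U|\phi|^p\,|\nabla\log r_\omega|^p\,\omega_\theta\,dx\Big)^{1/p},$$ let $\mathcal W^p(U,\theta,r_\omega)$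 be the space of $\phi\in W^{1,p}(U,\omega_\theta)$ for which this is finite, and let $\mathcal W^p_0(U,\theta,r_\omega)$ be the closure of $Lip_c(U)$ in it; these spaces do not depend on the choice of $|\cdot|$, which is the Euclidean norm unless another one is named. Then $$[W^{1,p}(U,\omega_0),W^{1,p}(U,\omega_1)]_\theta\subset W^{1,p}(U,\omega_\theta),\qquad \mathcal W^p_0(U,\theta,r_\omega)\subset[W^{1,p}_0(U,\omega_0),W^{1,p}_0(U,\omega_1)]_\theta ,$$ and for every $\phi\in\mathcal W^p_0(U,\theta,r_\omega)$ $$\|\phi\|_{W^{1,p}(U,\omega_\theta)}\le\|\phi\|_{[W^{1,p}(U,\omega_0),W^{1,p}(U,\omega_1)]_\theta}\le C_p\,d^{\max\{0,\,1/p-1/2\}}\,\|\phi\|_{\mathcal W^p(U,\theta,r_\omega)} .$$ In particular the last constant is $C_p$ if $p\ge2$. If $|\nabla\log r_\omega|$ is measured in the $\ell^p$ norm $\big(\sum_i|\partial_i\log r_\omega|^p\big)^{1/p}$, then the last inequality holds with the constant $C_p$, for every $p\in[1,\infty)$ and every $d$. -/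

import Mathlib

open MeasureTheory Set Filter Topology TopologicalSpace
open scoped ENNReal NNReal BoundedContinuousFunction

noncomputable section

/-! ### The complex interpolation method for a couple of normed spaces

The two spaces `X₀` and `X₁` of the couple are embedded in a common ambient complex vector space
`V` by (injective) linear maps `ι₀`, `ι₁`. -/

namespace ComplexInterpolation

section Couple

variable {V X₀ X₁ : Type*} [AddCommGroup V] [Module ℂ V]
  [NormedAddCommGroup X₀] [NormedSpace ℂ X₀] [NormedAddCommGroup X₁] [NormedSpace ℂ X₁]

/-- The map `(a₀, a₁) ↦ a₀ + a₁` from `X₀ × X₁`, with the norm `‖a₀‖ + ‖a₁‖`, to the ambient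
space. -/
def addMap (ι₀ : X₀ →ₗ[ℂ] V) (ι₁ : X₁ →ₗ[ℂ] V) : WithLp 1 (X₀ × X₁) →ₗ[ℂ] V :=
  (ι₀.coprod ι₁) ∘ₗ (WithLp.linearEquiv 1 ℂ (X₀ × X₁)).toLinearMap

/-- The space `X₀ + X₁`. Its quotient norm is `inf {‖a₀‖ + ‖a₁‖ : a = a₀ + a₁}`. -/
abbrev SumSpace (ι₀ : X₀ →ₗ[ℂ] V) (ι₁ : X₁ →ₗ[ℂ] V) : Type _ :=
  WithLp 1 (X₀ × X₁) ⧸ LinearMap.ker (addMap ι₀ ι₁)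

/-- The inclusion of `X₀ + X₁` in the ambient space. -/
def SumSpace.toAmbient (ι₀ : X₀ →ₗ[ℂ] V) (ι₁ : X₁ →ₗ[ℂ] V) : SumSpace ι₀ ι₁ →ₗ[ℂ] V :=
  (LinearMap.ker (addMap ι₀ ι₁)).liftQ (addMap ι₀ ι₁) le_rfl

/-- The inclusion of `X₀` in `X₀ + X₁`. -/
def SumSpace.inl (ι₀ : X₀ →ₗ[ℂ] V) (ι₁ : X₁ →ₗ[ℂ] V) (a : X₀) : SumSpace ι₀ ι₁ :=
  Submodule.Quotient.mk (WithLp.toLp 1 (a, 0))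

/-- The inclusion of `X₁` in `X₀ + X₁`. -/
def SumSpace.inr (ι₀ : X₀ →ₗ[ℂ] V) (ι₁ : X₁ →ₗ[ℂ] V) (a : X₁) : SumSpace ι₀ ι₁ :=
  Submodule.Quotient.mk (WithLp.toLp 1 (0, a))

/-- The space `𝓕(X₀, X₁)`: functions from the closed strip `0 ≤ re z ≤ 1` to `X₀ + X₁`, continuous
and bounded there, analytic on the open strip, whose restrictions to the two boundary lines are
continuous bounded maps into `X₀` and `X₁` respectively. The values of `toFun` outside the closed
strip play no role. -/
structure CalderonFun (ι₀ : X₀ →ₗ[ℂ] V) (ι₁ : X₁ →ₗ[ℂ] V) where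
  toFun : ℂ → SumSpace ι₀ ι₁
  continuousOn : ContinuousOn toFun {z : ℂ | 0 ≤ z.re ∧ z.re ≤ 1}
  bounded : ∃ M : ℝ, ∀ z : ℂ, 0 ≤ z.re → z.re ≤ 1 → ‖toFun z‖ ≤ M
  analytic : DifferentiableOn ℂ toFun {z : ℂ | 0 < z.re ∧ z.re < 1}
  left : ℝ →ᵇ X₀
  toFun_left : ∀ t : ℝ, toFun (t * Complex.I) = SumSpace.inl ι₀ ι₁ (left t)
  right : ℝ →ᵇ X₁
  toFun_right : ∀ t : ℝ, toFun (1 + t * Complex.I) = SumSpace.inr ι₀ ι₁ (right t)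

/-- The norm of `𝓕(X₀, X₁)`, the larger of the suprema of the norms on the boundary lines. -/
def CalderonFun.norm {ι₀ : X₀ →ₗ[ℂ] V} {ι₁ : X₁ →ₗ[ℂ] V} (f : CalderonFun ι₀ ι₁) : ℝ :=
  max ‖f.left‖ ‖f.right‖

/-- The interpolation space `[X₀, X₁]_θ`, as a subset of the ambient space. -/
def interpSpace (ι₀ : X₀ →ₗ[ℂ] V) (ι₁ : X₁ →ₗ[ℂ] V) (θ : ℝ) : Set V :=
  {a | ∃ f : CalderonFun ι₀ ι₁, SumSpace.toAmbient ι₀ ι₁ (f.toFun (θ : ℂ)) = a}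

/-- The norm of `[X₀, X₁]_θ`; it is `∞` exactly outside the space. -/
def interpNorm (ι₀ : X₀ →ₗ[ℂ] V) (ι₁ : X₁ →ₗ[ℂ] V) (θ : ℝ) (a : V) : ℝ≥0∞ :=
  ⨅ f : {f : CalderonFun ι₀ ι₁ // SumSpace.toAmbient ι₀ ι₁ (f.toFun (θ : ℂ)) = a},
    ENNReal.ofReal f.1.norm

end Couple

end ComplexInterpolation

/-! ### Weighted Sobolev spaces -/

namespace WeightedSobolev

variable {d : ℕ}

/-- A weight function on `U`: Lebesgue measurable and strictly positive on `U`. (Values outside `U`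
play no role.) -/
structure Weight (U : Opens (EuclideanSpace ℝ (Fin d))) where
  toFun : EuclideanSpace ℝ (Fin d) → ℝ
  aemeasurable : AEMeasurable toFun (volume.restrict U)
  pos : ∀ x ∈ U, 0 < toFun x

instance (U : Opens (EuclideanSpace ℝ (Fin d))) :
    CoeFun (Weight U) (fun _ => EuclideanSpace ℝ (Fin d) → ℝ) := ⟨Weight.toFun⟩

/-- The compact boundedness condition: bounded away from `0` and `∞` on each compact subset. -/
def Weight.CompactlyBounded {U : Opens (EuclideanSpace ℝ (Fin d))} (ω : Weight U) : Prop :=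
  ∀ K : Set (EuclideanSpace ℝ (Fin d)), IsCompact K → K ⊆ U →
    ∃ m M : ℝ, 0 < m ∧ ∀ x ∈ K, m ≤ ω x ∧ ω x ≤ M

/-- The weight `ω_θ = ω₀^(1-θ) ω₁^θ`. -/
def Weight.interp {U : Opens (EuclideanSpace ℝ (Fin d))} (ω₀ ω₁ : Weight U) (θ : ℝ) :
    Weight U where
  toFun x := ω₀ x ^ (1 - θ) * ω₁ x ^ θ
  aemeasurable := (ω₀.aemeasurable.pow_const _).mul (ω₁.aemeasurable.pow_const _)
  pos x hx := mul_pos (Real.rpow_pos_of_pos (ω₀.pos x hx) _) (Real.rpow_pos_of_pos (ω₁.pos x hx) _)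

/-- The quotient `r_ω = ω₀ / ω₁`. -/
def weightRatio {U : Opens (EuclideanSpace ℝ (Fin d))} (ω₀ ω₁ : Weight U) :
    EuclideanSpace ℝ (Fin d) → ℝ :=
  fun x => ω₀ x / ω₁ x

/-- `f` is locally Lipschitz on `U`: Lipschitz on each compact subset of `U`. -/
def LocLipschitz (U : Opens (EuclideanSpace ℝ (Fin d))) (f : EuclideanSpace ℝ (Fin d) → ℝ) :
    Prop :=
  ∀ K : Set (EuclideanSpace ℝ (Fin d)), IsCompact K → K ⊆ U → ∃ L : ℝ≥0, LipschitzOnWith L f K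

/-- The measure `ω(x) dx` on `U`. -/
def Weight.measure {U : Opens (EuclideanSpace ℝ (Fin d))} (ω : Weight U) :
    Measure (EuclideanSpace ℝ (Fin d)) :=
  (volume.restrict U).withDensity (fun x => ENNReal.ofReal (ω x))

/-- `G` is the weak gradient of `φ` on `U`. -/
structure HasWeakGradient (U : Opens (EuclideanSpace ℝ (Fin d)))
    (φ : EuclideanSpace ℝ (Fin d) → ℂ) (G : Fin d → EuclideanSpace ℝ (Fin d) → ℂ) : Prop where
  integrableOn : ∀ K : Set (EuclideanSpace ℝ (Fin d)), IsCompact K → K ⊆ U → IntegrableOn φ K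
  integrableOn_grad : ∀ i, ∀ K : Set (EuclideanSpace ℝ (Fin d)), IsCompact K → K ⊆ U →
    IntegrableOn (G i) K
  integral_eq : ∀ (i : Fin d) (ψ : EuclideanSpace ℝ (Fin d) → ℝ), ContDiff ℝ (⊤ : ℕ∞) ψ →
    HasCompactSupport ψ → tsupport ψ ⊆ U →
    ∫ x in U, fderiv ℝ ψ x (EuclideanSpace.single i 1) • φ x = - ∫ x in U, ψ x • G i x

theorem Weight.absolutelyContinuous {U : Opens (EuclideanSpace ℝ (Fin d))} (ω : Weight U) :
    volume.restrict (U : Set (EuclideanSpace ℝ (Fin d))) ≪ ω.measure := by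
  refine withDensity_absolutelyContinuous' ω.aemeasurable.ennreal_ofReal ?_
  filter_upwards [ae_restrict_mem U.isOpen.measurableSet] with x hx
  simpa using ω.pos x hx

theorem integrableOn_smul_of_support {U : Opens (EuclideanSpace ℝ (Fin d))}
    {φ : EuclideanSpace ℝ (Fin d) → ℂ}
    (hφ : ∀ K : Set (EuclideanSpace ℝ (Fin d)), IsCompact K → K ⊆ U → IntegrableOn φ K)
    {g : EuclideanSpace ℝ (Fin d) → ℝ} {K : Set (EuclideanSpace ℝ (Fin d))} (hg : Continuous g)
    (hK : IsCompact K) (hKU : K ⊆ U) (hgK : ∀ x ∉ K, g x = 0) :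
    IntegrableOn (fun x => g x • φ x) U := by
  have h1 : IntegrableOn (fun x => g x • φ x) K :=
    (hφ K hK hKU).continuousOn_smul hg.continuousOn hK
  refine (h1.integrable_of_forall_notMem_eq_zero ?_).integrableOn
  intro x hx
  simp [hgK x hx]

theorem HasWeakGradient.integrable_test {U : Opens (EuclideanSpace ℝ (Fin d))}
    {φ : EuclideanSpace ℝ (Fin d) → ℂ} {G : Fin d → EuclideanSpace ℝ (Fin d) → ℂ}
    (h : HasWeakGradient U φ G) (i : Fin d) {ψ : EuclideanSpace ℝ (Fin d) → ℝ}
    (hψ : ContDiff ℝ (⊤ : ℕ∞) ψ) (hc : HasCompactSupport ψ) (hs : tsupport ψ ⊆ U) :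
    IntegrableOn (fun x => fderiv ℝ ψ x (EuclideanSpace.single i 1) • φ x) U ∧
      IntegrableOn (fun x => ψ x • G i x) U := by
  refine ⟨integrableOn_smul_of_support h.integrableOn ?_ hc hs ?_,
    integrableOn_smul_of_support (h.integrableOn_grad i) hψ.continuous hc hs ?_⟩
  · exact (hψ.continuous_fderiv (by simp)).clm_apply continuous_const
  · intro x hx
    simp [fderiv_of_notMem_tsupport (𝕜 := ℝ) hx]
  · intro x hx
    exact image_eq_zero_of_notMem_tsupport hx

theorem HasWeakGradient.congr {U : Opens (EuclideanSpace ℝ (Fin d))}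
    {φ φ' : EuclideanSpace ℝ (Fin d) → ℂ} {G G' : Fin d → EuclideanSpace ℝ (Fin d) → ℂ}
    (h : HasWeakGradient U φ G)
    (hφ : φ =ᵐ[volume.restrict (U : Set (EuclideanSpace ℝ (Fin d)))] φ')
    (hG : ∀ i, G i =ᵐ[volume.restrict (U : Set (EuclideanSpace ℝ (Fin d)))] G' i) :
    HasWeakGradient U φ' G' where
  integrableOn K hK hKU := (h.integrableOn K hK hKU).congr (ae_restrict_of_ae_restrict_of_subset hKU hφ)
  integrableOn_grad i K hK hKU :=
    (h.integrableOn_grad i K hK hKU).congr (ae_restrict_of_ae_restrict_of_subset hKU (hG i))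
  integral_eq i ψ hψ hc hs := by
    have h1 : ∫ x in U, fderiv ℝ ψ x (EuclideanSpace.single i 1) • φ' x
        = ∫ x in U, fderiv ℝ ψ x (EuclideanSpace.single i 1) • φ x :=
      integral_congr_ae (by filter_upwards [hφ] with x hx; rw [hx])
    have h2 : ∫ x in U, ψ x • G' i x = ∫ x in U, ψ x • G i x :=
      integral_congr_ae (by filter_upwards [hG i] with x hx; rw [hx])
    rw [h1, h2, h.integral_eq i ψ hψ hc hs]

theorem HasWeakGradient.zero (U : Opens (EuclideanSpace ℝ (Fin d))) :
    HasWeakGradient U 0 (fun _ => 0) where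
  integrableOn _ _ _ := integrable_zero _ _ _
  integrableOn_grad _ _ _ _ := integrable_zero _ _ _
  integral_eq i ψ _ _ _ := by simp

theorem HasWeakGradient.add {U : Opens (EuclideanSpace ℝ (Fin d))}
    {φ φ' : EuclideanSpace ℝ (Fin d) → ℂ} {G G' : Fin d → EuclideanSpace ℝ (Fin d) → ℂ}
    (h : HasWeakGradient U φ G) (h' : HasWeakGradient U φ' G') :
    HasWeakGradient U (φ + φ') (fun i => G i + G' i) where
  integrableOn K hK hKU := (h.integrableOn K hK hKU).add (h'.integrableOn K hK hKU)
  integrableOn_grad i K hK hKU :=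
    (h.integrableOn_grad i K hK hKU).add (h'.integrableOn_grad i K hK hKU)
  integral_eq i ψ hψ hc hs := by
    obtain ⟨a, b⟩ := h.integrable_test i hψ hc hs
    obtain ⟨a', b'⟩ := h'.integrable_test i hψ hc hs
    simp only [Pi.add_apply, smul_add]
    rw [integral_add a a', integral_add b b', h.integral_eq i ψ hψ hc hs,
      h'.integral_eq i ψ hψ hc hs, neg_add]

theorem HasWeakGradient.smul {U : Opens (EuclideanSpace ℝ (Fin d))}
    {φ : EuclideanSpace ℝ (Fin d) → ℂ} {G : Fin d → EuclideanSpace ℝ (Fin d) → ℂ} (c : ℂ)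
    (h : HasWeakGradient U φ G) : HasWeakGradient U (c • φ) (fun i => c • G i) where
  integrableOn K hK hKU := (h.integrableOn K hK hKU).smul c
  integrableOn_grad i K hK hKU := (h.integrableOn_grad i K hK hKU).smul c
  integral_eq i ψ hψ hc hs := by
    simp only [Pi.smul_apply, smul_comm _ c]
    rw [integral_smul, integral_smul, h.integral_eq i ψ hψ hc hs, smul_neg]

/-- The weighted Sobolev space `W^{1,p}(U, ω)`. A function `φ` is represented by the vector
`(φ, ∇φ)` of elements of `L^p(U, ω)` (the entry `none` is `φ`, the entry `some i` is the weak
derivative `∂ᵢφ`), and the norm is the norm of `(φ, ∇φ)` in `L^p(U, ω, ℂ^{d+1})`, that is,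
`(∫ |φ|^p ω + ∑ᵢ ∫ |∂ᵢφ|^p ω)^(1/p)`. -/
def sobolev {U : Opens (EuclideanSpace ℝ (Fin d))} (ω : Weight U) (p : ℝ≥0∞) [Fact (1 ≤ p)] :
    Submodule ℂ (PiLp p (fun _ : Option (Fin d) => Lp ℂ p ω.measure)) where
  carrier := {w | HasWeakGradient U (w none) (fun i => w (some i))}
  zero_mem' := (HasWeakGradient.zero U).congr
    (ω.absolutelyContinuous.ae_le (Lp.coeFn_zero ℂ p ω.measure).symm)
    (fun _ => ω.absolutelyContinuous.ae_le (Lp.coeFn_zero ℂ p ω.measure).symm)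
  add_mem' {v w} hv hw := (HasWeakGradient.add hv hw).congr
    (ω.absolutelyContinuous.ae_le (Lp.coeFn_add (v none) (w none)).symm)
    (fun i => ω.absolutelyContinuous.ae_le (Lp.coeFn_add (v (some i)) (w (some i))).symm)
  smul_mem' c w hw := (HasWeakGradient.smul c hw).congr
    (ω.absolutelyContinuous.ae_le (Lp.coeFn_smul c (w none)).symm)
    (fun i => ω.absolutelyContinuous.ae_le (Lp.coeFn_smul c (w (some i))).symm)

/-- The ambient space of all the function spaces considered here: measurable functions `U → ℂ`
modulo equality almost everywhere with respect to Lebesgue measure. -/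
abbrev Ambient (U : Opens (EuclideanSpace ℝ (Fin d))) : Type :=
  EuclideanSpace ℝ (Fin d) →ₘ[volume.restrict (U : Set (EuclideanSpace ℝ (Fin d)))] ℂ

/-- An element of `W^{1,p}(U, ω)` as a function on `U`. -/
def sobolevIncl {U : Opens (EuclideanSpace ℝ (Fin d))} (ω : Weight U) (p : ℝ≥0∞)
    [Fact (1 ≤ p)] : sobolev ω p →ₗ[ℂ] Ambient U where
  toFun w := AEEqFun.mk (w.1 none)
    ((Lp.aestronglyMeasurable (w.1 none)).mono_ac ω.absolutelyContinuous)
  map_add' v w := by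
    rw [AEEqFun.mk_add_mk, AEEqFun.mk_eq_mk]
    exact ω.absolutelyContinuous.ae_le (Lp.coeFn_add (v.1 none) (w.1 none))
  map_smul' c w := by
    refine Eq.trans (AEEqFun.mk_eq_mk.2 ?_) (AEEqFun.smul_mk c (w.1 none)
      ((Lp.aestronglyMeasurable (w.1 none)).mono_ac ω.absolutelyContinuous))
    exact ω.absolutelyContinuous.ae_le (Lp.coeFn_smul c (w.1 none))

/-- `Lip_c(U)`: Lipschitz functions on `U` whose support is a compact subset of `U`, as a subspace
of the ambient space. -/
def lipC (U : Opens (EuclideanSpace ℝ (Fin d))) : Submodule ℂ (Ambient U) where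
  carrier := {a | ∃ g : EuclideanSpace ℝ (Fin d) → ℂ, (∃ L : ℝ≥0, LipschitzOnWith L g U) ∧
    HasCompactSupport g ∧ tsupport g ⊆ U ∧
    a =ᵐ[volume.restrict (U : Set (EuclideanSpace ℝ (Fin d)))] g}
  zero_mem' := ⟨fun _ => 0, ⟨0, (LipschitzWith.const 0).lipschitzOnWith⟩,
    HasCompactSupport.zero, by simp [tsupport], AEEqFun.coeFn_zero⟩
  add_mem' := by
    rintro a b ⟨g, ⟨L, hL⟩, hg, hgU, ha⟩ ⟨h, ⟨M, hM⟩, hh, hhU, hb⟩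
    refine ⟨fun x => g x + h x, ⟨L + M, hL.add hM⟩, hg.add hh,
      (tsupport_add g h).trans (union_subset hgU hhU), ?_⟩
    filter_upwards [AEEqFun.coeFn_add a b, ha, hb] with x h1 h2 h3
    rw [h1, Pi.add_apply, h2, h3]
  smul_mem' := by
    rintro c a ⟨g, ⟨L, hL⟩, hg, hgU, ha⟩
    refine ⟨fun x => c • g x, ⟨‖c‖₊ * L, ?_⟩, hg.smul_left (f := fun _ => c),
      (tsupport_smul_subset_right (fun _ => c) g).trans hgU, ?_⟩
    · exact (lipschitzWith_smul c).comp_lipschitzOnWith hL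
    · filter_upwards [AEEqFun.coeFn_smul c a, ha] with x h1 h2
      rw [h1, Pi.smul_apply, h2]

/-- The space `W₀^{1,p}(U, ω)`, the closure of `Lip_c(U)` in `W^{1,p}(U, ω)`, with the norm of
`W^{1,p}(U, ω)`. -/
def sobolev₀ {U : Opens (EuclideanSpace ℝ (Fin d))} (ω : Weight U) (p : ℝ≥0∞) [Fact (1 ≤ p)] :
    Submodule ℂ (PiLp p (fun _ : Option (Fin d) => Lp ℂ p ω.measure)) :=
  ((lipC U).comap (sobolevIncl ω p)).topologicalClosure.map (sobolev ω p).subtype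

/-- An element of `W₀^{1,p}(U, ω)` as a function on `U`. -/
def sobolev₀Incl {U : Opens (EuclideanSpace ℝ (Fin d))} (ω : Weight U) (p : ℝ≥0∞)
    [Fact (1 ≤ p)] : sobolev₀ ω p →ₗ[ℂ] Ambient U :=
  sobolevIncl ω p ∘ₗ Submodule.inclusion (Submodule.map_subtype_le (sobolev ω p) _)

/-- The gradient of `log r_ω`, which exists at almost every point of `U` if `r_ω` is locally
Lipschitz, regarded as a vector of `ℝ^d` with the `ℓ^q` norm. -/
def gradLogRatio {U : Opens (EuclideanSpace ℝ (Fin d))} (ω₀ ω₁ : Weight U) (q : ℝ≥0∞)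
    (x : EuclideanSpace ℝ (Fin d)) : PiLp q (fun _ : Fin d => ℝ) :=
  WithLp.toLp q (fun i =>
    fderiv ℝ (fun y => Real.log (weightRatio ω₀ ω₁ y)) x (EuclideanSpace.single i 1))

/-- The norm of `𝓦^p(U, θ, r_ω)` as an extended real number,
`(‖φ‖_{W^{1,p}(U, ω_θ)}^p + ∫_U |φ|^p |∇ log r_ω|^p ω_θ dx)^(1/p)`,
where `|∇ log r_ω|` is the `ℓ^q` norm of the gradient. The choice of `q` changes this norm only
to an equivalent one; the usual choice, the Euclidean length, is `q = 2`. -/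
def ratioNorm {U : Opens (EuclideanSpace ℝ (Fin d))} (ω₀ ω₁ : Weight U) (θ : ℝ) (p : ℝ≥0∞)
    [Fact (1 ≤ p)] (q : ℝ≥0∞) [Fact (1 ≤ q)] (w : sobolev (ω₀.interp ω₁ θ) p) : ℝ≥0∞ :=
  (‖w‖ₑ ^ p.toReal +
    ∫⁻ x in U, ‖sobolevIncl (ω₀.interp ω₁ θ) p w x‖ₑ ^ p.toReal *
      ‖gradLogRatio ω₀ ω₁ q x‖ₑ ^ p.toReal * ENNReal.ofReal (ω₀.interp ω₁ θ x)) ^ (1 / p.toReal)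

/-- The space `𝓦^p(U, θ, r_ω)`, as a subset of `W^{1,p}(U, ω_θ)`. -/
def ratioSpace {U : Opens (EuclideanSpace ℝ (Fin d))} (ω₀ ω₁ : Weight U) (θ : ℝ) (p : ℝ≥0∞)
    [Fact (1 ≤ p)] : Set (sobolev (ω₀.interp ω₁ θ) p) :=
  {w | ratioNorm ω₀ ω₁ θ p 2 w < ∞}

/-- The space `𝓦₀^p(U, θ, r_ω)`, the closure of `Lip_c(U)` in `𝓦^p(U, θ, r_ω)`. -/
def ratioSpace₀ {U : Opens (EuclideanSpace ℝ (Fin d))} (ω₀ ω₁ : Weight U) (θ : ℝ) (p : ℝ≥0∞)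
    [Fact (1 ≤ p)] : Set (sobolev (ω₀.interp ω₁ θ) p) :=
  {w | w ∈ ratioSpace ω₀ ω₁ θ p ∧ ∀ ε : ℝ≥0∞, 0 < ε →
    ∃ v ∈ ratioSpace ω₀ ω₁ θ p, sobolevIncl (ω₀.interp ω₁ θ) p v ∈ lipC U ∧
      ratioNorm ω₀ ω₁ θ p 2 (w - v) < ε}

end WeightedSobolev

end

noncomputable section

/-! ### Multiplication by `exp (ζ a)` on `L^p` -/

section ExpMul

variable {α : Type*} {m : MeasurableSpace α} {μ : Measure α}

/-! Both inclusions rest on one fact: multiplying by the power `r_ω ^ ((z - θ) / p)` turns the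
weight `ω_θ` into `ω₀` on the line `re z = 0` and into `ω₁` on the line `re z = 1`. Such multipliers
are written `exp (ζ a)` with `a` bounded; they are entire in `ζ` as operators on `L^p`, because `exp
(ζ a)` is entire with values in `L^∞`.

Embedding in `W^{1,p}(U, ω_θ)`. Let `w` be the tuple of `f(θ)` and its weak derivatives. Pair
`f(z)`, multiplied by an analytic power of `ω₁ / ω₀`, with the dual function of `w`, cut off to a
set `A` on which everything is bounded. The result is a bounded analytic scalar function `H` on the
strip. Its value at `θ` is `S = ∑ ∫_A |w_k|^p ω_θ`, while Young's inequality on the two boundary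
lines gives `|H| ≤ ‖f‖^p / p + (1 - 1/p) S`. The maximum principle and the finiteness of `S` yield
`S ≤ ‖f‖^p`; exhausting `U` by such sets finishes the estimate (`sum_lintegral_le_of_calderonFun`,
`exists_sobolev_of_calderonFun`).

Embedding of `𝓦₀^p`. For a Lipschitz `g` with compact support take `f(z) = exp (z² - θ²) r_ω ^ ζ g`
with `ζ = (z - θ) / p`. Since `∇(r_ω ^ ζ g) = r_ω ^ ζ (∇g + ζ g ∇log r_ω)`, the boundary norms are
at most `(1 + |ζ|)` times the norm of `𝓦^p` with the `ℓ^p` length of the gradient, and the Gaussian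
factor absorbs `1 + |ζ|` at the cost of the constant 9 (`norm_gauss_mul_le`,
`exists_calderonFun_of_mem_lipC`). A general element is the sum of a rapidly convergent telescoping
series of Lipschitz functions, and the corresponding series converges in `𝓕`
(`exists_calderonFun_of_mem_ratioSpace₀`). Comparing the `ℓ^p` and Euclidean lengths produces the
power of `d`.

Compact boundedness makes restriction to a compact set continuous on all spaces involved. This gives
completeness, and closedness of the kernel that defines `X₀ + X₁`, so that its quotient seminorm is
a norm. -/

theorem MeasureTheory.Lp.norm_le_of_ae_bound_top {E : Type*} [NormedAddCommGroup E]
    {f : Lp E ∞ μ} {C : ℝ} (hC : 0 ≤ C) (h : ∀ᵐ x ∂μ, ‖f x‖ ≤ C) : ‖f‖ ≤ C := by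
  rw [Lp.norm_def, eLpNorm_exponent_top]
  refine (ENNReal.toReal_mono ENNReal.ofReal_ne_top (eLpNormEssSup_le_of_ae_bound h)).trans ?_
  rw [ENNReal.toReal_ofReal hC]

variable {a : α → ℝ} {A : ℝ}

theorem norm_cexp_mul_ofReal_le (hA : ∀ x, |a x| ≤ A) (ζ : ℂ) (x : α) :
    ‖Complex.exp (ζ * a x)‖ ≤ Real.exp (|ζ.re| * A) := by
  rw [Complex.norm_exp]
  refine Real.exp_le_exp.2 ?_
  have : (ζ * (a x : ℂ)).re = ζ.re * a x := by simp
  rw [this]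
  refine (le_abs_self _).trans ?_
  rw [abs_mul]
  exact mul_le_mul_of_nonneg_left (hA x) (abs_nonneg _)

theorem memLp_top_cexp (ha : AEStronglyMeasurable a μ) (hA : ∀ x, |a x| ≤ A) (ζ : ℂ) :
    MemLp (fun x => Complex.exp (ζ * a x)) ∞ μ :=
  memLp_top_of_bound
    (Complex.continuous_exp.comp_aestronglyMeasurable
      ((Complex.continuous_ofReal.comp_aestronglyMeasurable ha).const_mul ζ))
    _ (Eventually.of_forall (norm_cexp_mul_ofReal_le hA ζ))

/-- The class of `exp (ζ a)` in `L^∞`, for a bounded function `a`. -/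
def expLp (ha : AEStronglyMeasurable a μ) (hA : ∀ x, |a x| ≤ A) (ζ : ℂ) : Lp ℂ ∞ μ :=
  (memLp_top_cexp ha hA ζ).toLp _

theorem norm_expLp_le (ha : AEStronglyMeasurable a μ) (hA : ∀ x, |a x| ≤ A) (ζ : ℂ) :
    ‖expLp ha hA ζ‖ ≤ Real.exp (|ζ.re| * A) := by
  refine Lp.norm_le_of_ae_bound_top (Real.exp_pos _).le ?_
  filter_upwards [(memLp_top_cexp ha hA ζ).coeFn_toLp] with x hx
  rw [expLp, hx]
  exact norm_cexp_mul_ofReal_le hA ζ x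

theorem memLp_top_mul_cexp (ha : AEStronglyMeasurable a μ) (hA : ∀ x, |a x| ≤ A) (ζ : ℂ) :
    MemLp (fun x => (a x : ℂ) * Complex.exp (ζ * a x)) ∞ μ := by
  refine memLp_top_of_bound ((Complex.continuous_ofReal.comp_aestronglyMeasurable ha).mul
    (memLp_top_cexp ha hA ζ).1) (A * Real.exp (|ζ.re| * A)) (Eventually.of_forall fun x => ?_)
  rw [norm_mul, Complex.norm_real]
  exact mul_le_mul (hA x) (norm_cexp_mul_ofReal_le hA ζ x) (norm_nonneg _)
    ((abs_nonneg _).trans (hA x))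

/-- Since `a` is bounded, the Taylor estimate `|e^w - 1 - w| ≤ |w|²` for `|w| ≤ 1` applies with `w =
(z - ζ) a(x)` uniformly in `x`, so the remainder is `O(|z - ζ|²)` in `L^∞`. -/
theorem differentiable_expLp (ha : AEStronglyMeasurable a μ) (hA : ∀ x, |a x| ≤ A) :
    Differentiable ℂ (expLp (μ := μ) ha hA) := by
  intro ζ
  refine HasDerivAt.differentiableAt (f' := (memLp_top_mul_cexp ha hA ζ).toLp _) ?_
  rw [hasDerivAt_iff_isLittleO]
  refine Asymptotics.IsBigO.trans_isLittleO (g := fun z : ℂ => (z - ζ) ^ 2) ?_ ?_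
  -- `A` may be negative if the underlying space is empty.
  · set B := max A 0
    have hB : ∀ x, |a x| ≤ B := fun x => (hA x).trans (le_max_left _ _)
    have hB0 : 0 ≤ B := le_max_right _ _
    refine Asymptotics.IsBigO.of_bound (Real.exp (|ζ.re| * A) * B ^ 2) ?_
    -- This radius forces `|(z - ζ) a(x)| ≤ 1`, the range of the Taylor estimate.
    have : ∀ᶠ z in 𝓝 ζ, ‖z - ζ‖ < 1 / (B + 1) := by
      have h := Metric.ball_mem_nhds ζ (by positivity : 0 < 1 / (B + 1))
      filter_upwards [h] with z hz
      simpa [dist_eq_norm] using hz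
    filter_upwards [this] with z hz
    refine Lp.norm_le_of_ae_bound_top (by positivity) ?_
    filter_upwards [(memLp_top_cexp ha hA ζ).coeFn_toLp, (memLp_top_cexp ha hA z).coeFn_toLp,
      (memLp_top_mul_cexp ha hA ζ).coeFn_toLp,
      Lp.coeFn_sub (expLp ha hA z - expLp ha hA ζ)
        ((z - ζ) • (memLp_top_mul_cexp ha hA ζ).toLp _),
      Lp.coeFn_sub (expLp (μ := μ) ha hA z) (expLp ha hA ζ),
      Lp.coeFn_smul (z - ζ) ((memLp_top_mul_cexp ha hA ζ).toLp _)] with x h1 h2 h3 h4 h5 h6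
    rw [h4, Pi.sub_apply, h5, h6, Pi.sub_apply, Pi.smul_apply, h3, expLp, expLp, h1, h2]
    have key : Complex.exp (z * a x) - Complex.exp (ζ * a x) -
        (z - ζ) • ((a x : ℂ) * Complex.exp (ζ * a x)) =
        Complex.exp (ζ * a x) * (Complex.exp ((z - ζ) * a x) - 1 - (z - ζ) * a x) := by
      have : Complex.exp (z * a x) = Complex.exp (ζ * a x) * Complex.exp ((z - ζ) * a x) := by
        rw [← Complex.exp_add]; ring_nf
      rw [this, smul_eq_mul]; ring
    have hn : ‖(z - ζ) * (a x : ℂ)‖ ≤ ‖z - ζ‖ * B := by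
      rw [norm_mul, Complex.norm_real]
      exact mul_le_mul_of_nonneg_left (hB x) (norm_nonneg _)
    have hle : ‖(z - ζ) * (a x : ℂ)‖ ≤ 1 := by
      refine hn.trans ?_
      calc ‖z - ζ‖ * B ≤ 1 / (B + 1) * (B + 1) := by gcongr; linarith
        _ = 1 := by field_simp
    rw [key, norm_mul, norm_pow, mul_assoc]
    refine mul_le_mul (norm_cexp_mul_ofReal_le hA ζ x) ?_ (norm_nonneg _) (Real.exp_pos _).le
    refine (Complex.norm_exp_sub_one_sub_id_le hle).trans ?_
    calc ‖(z - ζ) * (a x : ℂ)‖ ^ 2 ≤ (‖z - ζ‖ * B) ^ 2 := by gcongr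
      _ = B ^ 2 * ‖z - ζ‖ ^ 2 := by ring
  · exact Asymptotics.IsLittleO.of_norm_left
      ((Asymptotics.isLittleO_pow_sub_sub ζ one_lt_two).congr_left fun _ => (norm_pow _ _).symm)

variable {q : ℝ≥0∞} [Fact (1 ≤ q)]

/-- Multiplication by `exp (ζ a)` on `L^q`, for a bounded function `a`. -/
def expMul (q : ℝ≥0∞) [Fact (1 ≤ q)] (ha : AEStronglyMeasurable a μ) (hA : ∀ x, |a x| ≤ A)
    (ζ : ℂ) : Lp ℂ q μ →L[ℂ] Lp ℂ q μ :=
  (ContinuousLinearMap.mul ℂ ℂ).holderL μ ∞ q q (expLp ha hA ζ)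

theorem coeFn_expMul (ha : AEStronglyMeasurable a μ) (hA : ∀ x, |a x| ≤ A) (ζ : ℂ)
    (f : Lp ℂ q μ) : expMul q ha hA ζ f =ᵐ[μ] fun x => Complex.exp (ζ * a x) * f x := by
  filter_upwards [(ContinuousLinearMap.mul ℂ ℂ).coeFn_holder (r := q) (expLp ha hA ζ) f,
    (memLp_top_cexp ha hA ζ).coeFn_toLp] with x h1 h2
  rw [expMul, ContinuousLinearMap.holderL_apply_apply, h1, expLp, h2]
  rfl

theorem differentiable_expMul (ha : AEStronglyMeasurable a μ) (hA : ∀ x, |a x| ≤ A) :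
    Differentiable ℂ (expMul (μ := μ) q ha hA) := fun ζ =>
  ((ContinuousLinearMap.mul ℂ ℂ).holderL μ ∞ q q).differentiableAt.comp ζ
    (differentiable_expLp ha hA ζ)

theorem norm_expMul_apply_le (ha : AEStronglyMeasurable a μ) (hA : ∀ x, |a x| ≤ A) (ζ : ℂ)
    (f : Lp ℂ q μ) : ‖expMul q ha hA ζ f‖ ≤ Real.exp (|ζ.re| * A) * ‖f‖ := by
  refine ((ContinuousLinearMap.mul ℂ ℂ).norm_holder_apply_apply_le _ _).trans ?_
  have h1 : ‖ContinuousLinearMap.mul ℂ ℂ‖ ≤ 1 := ContinuousLinearMap.opNorm_mul_le ℂ ℂ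
  have h2 := norm_expLp_le (μ := μ) ha hA ζ
  gcongr
  calc ‖ContinuousLinearMap.mul ℂ ℂ‖ * ‖expLp ha hA ζ‖ ≤ 1 * Real.exp (|ζ.re| * A) := by gcongr
    _ = _ := one_mul _

end ExpMul

/-- A differentiable function with values in a closed subspace is differentiable as a function
into that subspace. -/
theorem differentiable_of_differentiable_coe {E : Type*} [NormedAddCommGroup E] [NormedSpace ℂ E]
    {S : Submodule ℂ E} (hS : IsClosed (S : Set E)) {f : ℂ → S}
    (hf : Differentiable ℂ fun z => (f z : E)) : Differentiable ℂ f := by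
  intro z
  -- Difference quotients stay in `S`, so the derivative lies in the closed span of the range.
  have hmem : deriv (fun z => (f z : E)) z ∈ S := by
    have h := range_deriv_subset_closure_span_image (fun z => (f z : E)) dense_univ
      (mem_range_self z)
    refine closure_minimal ?_ hS h
    refine Submodule.span_le.2 ?_
    rintro _ ⟨w, -, rfl⟩
    exact (f w).2
  have h : HasDerivAt (fun z => (f z : E)) _ z := DifferentiableAt.hasDerivAt (hf z)
  refine HasDerivAt.differentiableAt (f' := ⟨_, hmem⟩) ?_
  rw [hasDerivAt_iff_isLittleO] at h ⊢
  exact Asymptotics.IsLittleO.of_norm_left (h.norm_left.congr_left fun _ => rfl)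

/-! ### Calderón's method for general couples -/

namespace ComplexInterpolation

section Couple

variable {V X₀ X₁ : Type*} [AddCommGroup V] [Module ℂ V]
  [NormedAddCommGroup X₀] [NormedSpace ℂ X₀] [NormedAddCommGroup X₁] [NormedSpace ℂ X₁]

theorem addMap_apply (ι₀ : X₀ →ₗ[ℂ] V) (ι₁ : X₁ →ₗ[ℂ] V) (x : WithLp 1 (X₀ × X₁)) :
    addMap ι₀ ι₁ x = ι₀ x.fst + ι₁ x.snd := rfl

theorem toAmbient_mk (ι₀ : X₀ →ₗ[ℂ] V) (ι₁ : X₁ →ₗ[ℂ] V) (x : WithLp 1 (X₀ × X₁)) :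
    SumSpace.toAmbient ι₀ ι₁ (Submodule.Quotient.mk x) = ι₀ x.fst + ι₁ x.snd := rfl

/-- The inclusion of `X₀` in `X₀ + X₁` as a continuous linear map. -/
def inlL (ι₀ : X₀ →ₗ[ℂ] V) (ι₁ : X₁ →ₗ[ℂ] V) : X₀ →L[ℂ] SumSpace ι₀ ι₁ :=
  (LinearMap.ker (addMap ι₀ ι₁)).mkQL ∘L
    (WithLp.prodContinuousLinearEquiv 1 ℂ X₀ X₁).symm.toContinuousLinearMap ∘L
      ContinuousLinearMap.inl ℂ X₀ X₁

/-- The inclusion of `X₁` in `X₀ + X₁` as a continuous linear map. -/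
def inrL (ι₀ : X₀ →ₗ[ℂ] V) (ι₁ : X₁ →ₗ[ℂ] V) : X₁ →L[ℂ] SumSpace ι₀ ι₁ :=
  (LinearMap.ker (addMap ι₀ ι₁)).mkQL ∘L
    (WithLp.prodContinuousLinearEquiv 1 ℂ X₀ X₁).symm.toContinuousLinearMap ∘L
      ContinuousLinearMap.inr ℂ X₀ X₁

theorem inlL_apply (ι₀ : X₀ →ₗ[ℂ] V) (ι₁ : X₁ →ₗ[ℂ] V) (a : X₀) :
    inlL ι₀ ι₁ a = SumSpace.inl ι₀ ι₁ a := rfl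

theorem inrL_apply (ι₀ : X₀ →ₗ[ℂ] V) (ι₁ : X₁ →ₗ[ℂ] V) (a : X₁) :
    inrL ι₀ ι₁ a = SumSpace.inr ι₀ ι₁ a := rfl

theorem toAmbient_inl (ι₀ : X₀ →ₗ[ℂ] V) (ι₁ : X₁ →ₗ[ℂ] V) (a : X₀) :
    SumSpace.toAmbient ι₀ ι₁ (SumSpace.inl ι₀ ι₁ a) = ι₀ a := by
  rw [SumSpace.inl, toAmbient_mk]; simp

theorem inl_eq_inr {ι₀ : X₀ →ₗ[ℂ] V} {ι₁ : X₁ →ₗ[ℂ] V} {a : X₀} {b : X₁} (h : ι₀ a = ι₁ b) :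
    SumSpace.inl ι₀ ι₁ a = SumSpace.inr ι₀ ι₁ b := by
  refine (Submodule.Quotient.eq _).2 ?_
  rw [LinearMap.mem_ker, addMap_apply]
  simp [h]

theorem norm_inl_le (ι₀ : X₀ →ₗ[ℂ] V) (ι₁ : X₁ →ₗ[ℂ] V) (a : X₀) :
    ‖SumSpace.inl ι₀ ι₁ a‖ ≤ ‖a‖ := by
  refine (Submodule.Quotient.norm_mk_le _ _).trans_eq ?_
  simp

theorem norm_inr_le (ι₀ : X₀ →ₗ[ℂ] V) (ι₁ : X₁ →ₗ[ℂ] V) (a : X₁) :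
    ‖SumSpace.inr ι₀ ι₁ a‖ ≤ ‖a‖ := by
  refine (Submodule.Quotient.norm_mk_le _ _).trans_eq ?_
  simp

/-! ### Maps between couples -/

section Functoriality

variable {Y₀ Y₁ : Type*} [NormedAddCommGroup Y₀] [NormedSpace ℂ Y₀]
  [NormedAddCommGroup Y₁] [NormedSpace ℂ Y₁]
  {ι₀ : X₀ →ₗ[ℂ] V} {ι₁ : X₁ →ₗ[ℂ] V} {κ₀ : Y₀ →ₗ[ℂ] V} {κ₁ : Y₁ →ₗ[ℂ] V}

/-- The map on `X₀ + X₁` induced by continuous linear maps of the two spaces that are compatible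
with the inclusions in the ambient space. -/
def sumMap (i₀ : X₀ →L[ℂ] Y₀) (i₁ : X₁ →L[ℂ] Y₁) (h₀ : ∀ a, κ₀ (i₀ a) = ι₀ a)
    (h₁ : ∀ a, κ₁ (i₁ a) = ι₁ a) : SumSpace ι₀ ι₁ →L[ℂ] SumSpace κ₀ κ₁ :=
  (LinearMap.ker (addMap ι₀ ι₁)).liftQL
    ((inlL κ₀ κ₁ ∘L i₀).coprod (inrL κ₀ κ₁ ∘L i₁) ∘L
      (WithLp.prodContinuousLinearEquiv 1 ℂ X₀ X₁).toContinuousLinearMap) (by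
    intro x hx
    rw [LinearMap.mem_ker, addMap_apply, ← h₀, ← h₁] at hx
    change SumSpace.inl κ₀ κ₁ (i₀ x.fst) + SumSpace.inr κ₀ κ₁ (i₁ x.snd) = 0
    rw [inl_eq_inr (b := -i₁ x.snd) (by rw [map_neg]; exact eq_neg_of_add_eq_zero_left hx),
      ← inrL_apply, ← inrL_apply, map_neg, neg_add_cancel])

theorem sumMap_mk (i₀ : X₀ →L[ℂ] Y₀) (i₁ : X₁ →L[ℂ] Y₁) (h₀ : ∀ a, κ₀ (i₀ a) = ι₀ a)
    (h₁ : ∀ a, κ₁ (i₁ a) = ι₁ a) (x : WithLp 1 (X₀ × X₁)) :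
    sumMap i₀ i₁ h₀ h₁ (Submodule.Quotient.mk x) =
      inlL κ₀ κ₁ (i₀ x.fst) + inrL κ₀ κ₁ (i₁ x.snd) := rfl

theorem sumMap_inl (i₀ : X₀ →L[ℂ] Y₀) (i₁ : X₁ →L[ℂ] Y₁) (h₀ : ∀ a, κ₀ (i₀ a) = ι₀ a)
    (h₁ : ∀ a, κ₁ (i₁ a) = ι₁ a) (a : X₀) :
    sumMap i₀ i₁ h₀ h₁ (SumSpace.inl ι₀ ι₁ a) = SumSpace.inl κ₀ κ₁ (i₀ a) := by
  rw [SumSpace.inl, sumMap_mk]; simp [inlL_apply]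

theorem sumMap_inr (i₀ : X₀ →L[ℂ] Y₀) (i₁ : X₁ →L[ℂ] Y₁) (h₀ : ∀ a, κ₀ (i₀ a) = ι₀ a)
    (h₁ : ∀ a, κ₁ (i₁ a) = ι₁ a) (a : X₁) :
    sumMap i₀ i₁ h₀ h₁ (SumSpace.inr ι₀ ι₁ a) = SumSpace.inr κ₀ κ₁ (i₁ a) := by
  rw [SumSpace.inr, sumMap_mk]; simp [inrL_apply]

theorem toAmbient_sumMap (i₀ : X₀ →L[ℂ] Y₀) (i₁ : X₁ →L[ℂ] Y₁) (h₀ : ∀ a, κ₀ (i₀ a) = ι₀ a)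
    (h₁ : ∀ a, κ₁ (i₁ a) = ι₁ a) (s : SumSpace ι₀ ι₁) :
    SumSpace.toAmbient κ₀ κ₁ (sumMap i₀ i₁ h₀ h₁ s) = SumSpace.toAmbient ι₀ ι₁ s := by
  obtain ⟨x, rfl⟩ := Submodule.Quotient.mk_surjective _ s
  rw [sumMap_mk, toAmbient_mk, map_add, inlL_apply, inrL_apply, toAmbient_inl, SumSpace.inr,
    toAmbient_mk, h₀]
  simp [h₁]

/-- Composition of an element of `𝓕(X₀, X₁)` with maps of norm at most one. -/
def CalderonFun.map (hk : IsClosed (LinearMap.ker (addMap ι₀ ι₁) : Set (WithLp 1 (X₀ × X₁))))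
    (hk' : IsClosed (LinearMap.ker (addMap κ₀ κ₁) : Set (WithLp 1 (Y₀ × Y₁))))
    (i₀ : X₀ →L[ℂ] Y₀) (i₁ : X₁ →L[ℂ] Y₁) (h₀ : ∀ a, κ₀ (i₀ a) = ι₀ a)
    (h₁ : ∀ a, κ₁ (i₁ a) = ι₁ a) (n₀ : ∀ a, ‖i₀ a‖ ≤ ‖a‖) (n₁ : ∀ a, ‖i₁ a‖ ≤ ‖a‖)
    (f : CalderonFun ι₀ ι₁) : CalderonFun κ₀ κ₁ where
  toFun z := sumMap i₀ i₁ h₀ h₁ (f.toFun z)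
  continuousOn := (sumMap i₀ i₁ h₀ h₁).continuous.comp_continuousOn f.continuousOn
  bounded := by
    obtain ⟨M, hM⟩ := f.bounded
    -- The quotient norm is an infimum: a representative within `ε` of it is mapped componentwise by
    -- contractions.
    refine ⟨M, fun z hz hz' => le_of_forall_pos_le_add fun ε hε => ?_⟩
    obtain ⟨x, hx, hxn⟩ := Submodule.Quotient.norm_mk_lt (f.toFun z) hε
    rw [← hx, sumMap_mk, inlL_apply, inrL_apply]
    have hx' : ‖x‖ = ‖x.fst‖ + ‖x.snd‖ := by
      rw [WithLp.prod_norm_eq_of_L1]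
    calc _ ≤ ‖SumSpace.inl κ₀ κ₁ (i₀ x.fst)‖ + ‖SumSpace.inr κ₀ κ₁ (i₁ x.snd)‖ := norm_add_le _ _
      _ ≤ ‖x.fst‖ + ‖x.snd‖ := add_le_add ((norm_inl_le _ _ _).trans (n₀ _))
          ((norm_inr_le _ _ _).trans (n₁ _))
      _ ≤ M + ε := by rw [← hx']; linarith [hM z hz hz']
  analytic := by
    have : IsClosed (LinearMap.ker (addMap ι₀ ι₁) : Set (WithLp 1 (X₀ × X₁))) := hk
    have : IsClosed (LinearMap.ker (addMap κ₀ κ₁) : Set (WithLp 1 (Y₀ × Y₁))) := hk'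
    exact (sumMap i₀ i₁ h₀ h₁).differentiable.comp_differentiableOn f.analytic
  left := BoundedContinuousFunction.ofNormedAddCommGroup (fun t => i₀ (f.left t))
    (i₀.continuous.comp f.left.continuous) ‖f.left‖
    (fun t => (n₀ _).trans (f.left.norm_coe_le_norm t))
  toFun_left t := by rw [f.toFun_left, sumMap_inl]; rfl
  right := BoundedContinuousFunction.ofNormedAddCommGroup (fun t => i₁ (f.right t))
    (i₁.continuous.comp f.right.continuous) ‖f.right‖
    (fun t => (n₁ _).trans (f.right.norm_coe_le_norm t))
  toFun_right t := by rw [f.toFun_right, sumMap_inr]; rfl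

theorem CalderonFun.norm_map_le
    (hk : IsClosed (LinearMap.ker (addMap ι₀ ι₁) : Set (WithLp 1 (X₀ × X₁))))
    (hk' : IsClosed (LinearMap.ker (addMap κ₀ κ₁) : Set (WithLp 1 (Y₀ × Y₁))))
    (i₀ : X₀ →L[ℂ] Y₀) (i₁ : X₁ →L[ℂ] Y₁)
    (h₀ : ∀ a, κ₀ (i₀ a) = ι₀ a) (h₁ : ∀ a, κ₁ (i₁ a) = ι₁ a) (n₀ : ∀ a, ‖i₀ a‖ ≤ ‖a‖)
    (n₁ : ∀ a, ‖i₁ a‖ ≤ ‖a‖) (f : CalderonFun ι₀ ι₁) :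
    (f.map hk hk' i₀ i₁ h₀ h₁ n₀ n₁).norm ≤ f.norm :=
  max_le_max
    ((BoundedContinuousFunction.norm_le (norm_nonneg _)).2
      fun t => (n₀ _).trans (f.left.norm_coe_le_norm t))
    ((BoundedContinuousFunction.norm_le (norm_nonneg _)).2
      fun t => (n₁ _).trans (f.right.norm_coe_le_norm t))

/-- Used for the contraction of the couple `W₀^{1,p}` into the couple `W^{1,p}`: functions are
constructed in the smaller couple, while the norm is estimated in the larger one. -/
theorem interpNorm_le_of_calderonFun {θ : ℝ} {a : V}
    (hk : IsClosed (LinearMap.ker (addMap ι₀ ι₁) : Set (WithLp 1 (X₀ × X₁))))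
    (hk' : IsClosed (LinearMap.ker (addMap κ₀ κ₁) : Set (WithLp 1 (Y₀ × Y₁))))
    (i₀ : X₀ →L[ℂ] Y₀) (i₁ : X₁ →L[ℂ] Y₁)
    (h₀ : ∀ a, κ₀ (i₀ a) = ι₀ a) (h₁ : ∀ a, κ₁ (i₁ a) = ι₁ a) (n₀ : ∀ a, ‖i₀ a‖ ≤ ‖a‖)
    (n₁ : ∀ a, ‖i₁ a‖ ≤ ‖a‖) (f : CalderonFun ι₀ ι₁)
    (hf : SumSpace.toAmbient ι₀ ι₁ (f.toFun (θ : ℂ)) = a) :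
    interpNorm κ₀ κ₁ θ a ≤ ENNReal.ofReal f.norm :=
  (iInf_le (fun g : {g : CalderonFun κ₀ κ₁ // SumSpace.toAmbient κ₀ κ₁ (g.toFun (θ : ℂ)) = a} =>
    ENNReal.ofReal g.1.norm)
    ⟨f.map hk hk' i₀ i₁ h₀ h₁ n₀ n₁, (toAmbient_sumMap i₀ i₁ h₀ h₁ _).trans hf⟩).trans
    (ENNReal.ofReal_le_ofReal (f.norm_map_le hk hk' i₀ i₁ h₀ h₁ n₀ n₁))

end Functoriality

/-- The maximum principle on the strip for bounded functions. -/
theorem norm_le_of_bounded_strip {E : Type*} [NormedAddCommGroup E] [NormedSpace ℂ E] {f : ℂ → E}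
    (hc : ContinuousOn f {z : ℂ | 0 ≤ z.re ∧ z.re ≤ 1})
    (hd : DifferentiableOn ℂ f {z : ℂ | 0 < z.re ∧ z.re < 1})
    (hb : ∃ M : ℝ, ∀ z : ℂ, 0 ≤ z.re → z.re ≤ 1 → ‖f z‖ ≤ M) {C : ℝ}
    (h0 : ∀ t : ℝ, ‖f (t * Complex.I)‖ ≤ C) (h1 : ∀ t : ℝ, ‖f (1 + t * Complex.I)‖ ≤ C)
    {z : ℂ} (hz : 0 ≤ z.re) (hz' : z.re ≤ 1) : ‖f z‖ ≤ C := by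
  obtain ⟨M, hM⟩ := hb
  refine PhragmenLindelof.vertical_strip (a := 0) (b := 1) ⟨hd, ?_⟩ ?_ ?_ ?_ hz hz'
  · rw [Complex.closure_preimage_re, closure_Ioo zero_ne_one]
    exact hc
  -- Boundedness is the growth condition of Phragmén–Lindelöf with both constants zero.
  · refine ⟨0, by simp [Real.pi_pos], 0, ?_⟩
    refine Asymptotics.IsBigO.of_bound M ?_
    filter_upwards [mem_inf_of_right (mem_principal_self _)] with z hz
    simpa using hM z hz.1.le hz.2.le
  · intro z hz
    have : z = z.im * Complex.I := by apply Complex.ext <;> simp [hz]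
    rw [this]; exact h0 _
  · intro z hz
    have : z = 1 + z.im * Complex.I := by apply Complex.ext <;> simp [hz]
    rw [this]; exact h1 _

/-! ### Bounds and series in `𝓕(X₀, X₁)` -/

variable {ι₀ : X₀ →ₗ[ℂ] V} {ι₁ : X₁ →ₗ[ℂ] V}

/-- The definition of `𝓕` asks only for some bound on the strip; the maximum principle improves it
to the boundary norm. Closedness of the kernel makes the target a normed space. -/
theorem CalderonFun.norm_toFun_le
    (hk : IsClosed (LinearMap.ker (addMap ι₀ ι₁) : Set (WithLp 1 (X₀ × X₁))))
    (f : CalderonFun ι₀ ι₁) {z : ℂ} (hz : 0 ≤ z.re) (hz' : z.re ≤ 1) : ‖f.toFun z‖ ≤ f.norm := by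
  have : IsClosed (LinearMap.ker (addMap ι₀ ι₁) : Set (WithLp 1 (X₀ × X₁))) := hk
  refine norm_le_of_bounded_strip (E := SumSpace ι₀ ι₁) f.continuousOn f.analytic f.bounded
    (fun t => ?_) (fun t => ?_) hz hz'
  · rw [f.toFun_left]
    exact (norm_inl_le _ _ _).trans ((f.left.norm_coe_le_norm t).trans (le_max_left _ _))
  · rw [f.toFun_right]
    exact (norm_inr_le _ _ _).trans ((f.right.norm_coe_le_norm t).trans (le_max_right _ _))

theorem CalderonFun.differentiableOn_comp {E : Type*} [NormedAddCommGroup E] [NormedSpace ℂ E]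
    (hk : IsClosed (LinearMap.ker (addMap ι₀ ι₁) : Set (WithLp 1 (X₀ × X₁))))
    (f : CalderonFun ι₀ ι₁) (T : SumSpace ι₀ ι₁ →L[ℂ] E) :
    DifferentiableOn ℂ (fun z => T (f.toFun z)) {z : ℂ | 0 < z.re ∧ z.re < 1} := by
  have : IsClosed (LinearMap.ker (addMap ι₀ ι₁) : Set (WithLp 1 (X₀ × X₁))) := hk
  exact T.differentiable.comp_differentiableOn f.analytic

theorem CalderonFun.exists_bound_comp {E : Type*} [NormedAddCommGroup E] [NormedSpace ℂ E]
    (f : CalderonFun ι₀ ι₁) (T : SumSpace ι₀ ι₁ →L[ℂ] E) :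
    ∃ M : ℝ, ∀ z : ℂ, 0 ≤ z.re → z.re ≤ 1 → ‖T (f.toFun z)‖ ≤ M := by
  obtain ⟨M, hM⟩ := f.bounded
  exact ⟨‖T‖ * M, fun z hz hz' => (T.le_opNorm _).trans
    (mul_le_mul_of_nonneg_left (hM z hz hz') (norm_nonneg _))⟩

/-- By `norm_toFun_le` a norm-summable series converges uniformly on the closed strip, so continuity
and analyticity pass to the sum. The boundary values converge in the Banach spaces of bounded
continuous functions. -/
theorem CalderonFun.exists_tsum [CompleteSpace X₀] [CompleteSpace X₁]
    (hk : IsClosed (LinearMap.ker (addMap ι₀ ι₁) : Set (WithLp 1 (X₀ × X₁))))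
    (f : ℕ → CalderonFun ι₀ ι₁) (hf : Summable fun n => (f n).norm) :
    ∃ F : CalderonFun ι₀ ι₁, F.norm ≤ ∑' n, (f n).norm ∧
      ∀ z : ℂ, 0 ≤ z.re → z.re ≤ 1 → HasSum (fun n => (f n).toFun z) (F.toFun z) := by
  have : IsClosed (LinearMap.ker (addMap ι₀ ι₁) : Set (WithLp 1 (X₀ × X₁))) := hk
  have hs : ∀ z : ℂ, 0 ≤ z.re → z.re ≤ 1 → Summable fun n => (f n).toFun z := fun z hz hz' =>
    Summable.of_norm_bounded hf fun n => (f n).norm_toFun_le hk hz hz'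
  have hl : Summable fun n => ‖(f n).left‖ :=
    Summable.of_nonneg_of_le (fun _ => norm_nonneg _) (fun n => le_max_left _ _) hf
  have hr : Summable fun n => ‖(f n).right‖ :=
    Summable.of_nonneg_of_le (fun _ => norm_nonneg _) (fun n => le_max_right _ _) hf
  refine ⟨{
    toFun := fun z => ∑' n, (f n).toFun z
    continuousOn := continuousOn_tsum (fun n => (f n).continuousOn) hf
      (fun n z hz => (f n).norm_toFun_le hk hz.1 hz.2)
    bounded := ⟨∑' n, (f n).norm, fun z hz hz' => tsum_of_norm_bounded hf.hasSum
      fun n => (f n).norm_toFun_le hk hz hz'⟩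
    analytic := Complex.differentiableOn_tsum_of_summable_norm hf (fun n => (f n).analytic)
      ((isOpen_lt continuous_const Complex.continuous_re).inter
        (isOpen_lt Complex.continuous_re continuous_const))
      (fun n z hz => (f n).norm_toFun_le hk hz.1.le hz.2.le)
    left := ∑' n, (f n).left
    toFun_left := fun t => ?_
    right := ∑' n, (f n).right
    toFun_right := fun t => ?_ }, ?_, fun z hz hz' => (hs z hz hz').hasSum⟩
  · have h1 : HasSum (fun n => (f n).left t) ((∑' n, (f n).left) t) :=
      hl.of_norm.hasSum.mapL (BoundedContinuousFunction.evalCLM ℂ t)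
    have h2 := h1.mapL (inlL ι₀ ι₁)
    simp only [inlL_apply, ← (f _).toFun_left] at h2
    exact h2.tsum_eq
  · have h1 : HasSum (fun n => (f n).right t) ((∑' n, (f n).right) t) :=
      hr.of_norm.hasSum.mapL (BoundedContinuousFunction.evalCLM ℂ t)
    have h2 := h1.mapL (inrL ι₀ ι₁)
    simp only [inrL_apply, ← (f _).toFun_right] at h2
    exact h2.tsum_eq
  · exact max_le
      ((norm_tsum_le_tsum_norm hl).trans (hl.tsum_le_tsum (fun n => le_max_left _ _) hf))
      ((norm_tsum_le_tsum_norm hr).trans (hr.tsum_le_tsum (fun n => le_max_right _ _) hf))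

/-- Analyticity is needed for only one of the two representations of the same ambient elements,
since the inclusion of `X₀` carries it to the sum. The family in `X₁` enters through its values on
`re z = 1`. -/
theorem exists_calderonFun
    (hk : IsClosed (LinearMap.ker (addMap ι₀ ι₁) : Set (WithLp 1 (X₀ × X₁))))
    {F₀ : ℂ → X₀} {F₁ : ℂ → X₁} (hd : Differentiable ℂ F₀) (hc : Continuous F₁)
    (hF : ∀ z, ι₀ (F₀ z) = ι₁ (F₁ z))
    (hb : ∃ M : ℝ, ∀ z : ℂ, 0 ≤ z.re → z.re ≤ 1 → ‖F₀ z‖ ≤ M) {C : ℝ} (hC : 0 ≤ C)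
    (h0 : ∀ t : ℝ, ‖F₀ (t * Complex.I)‖ ≤ C) (h1 : ∀ t : ℝ, ‖F₁ (1 + t * Complex.I)‖ ≤ C) :
    ∃ f : CalderonFun ι₀ ι₁, (∀ z, f.toFun z = SumSpace.inl ι₀ ι₁ (F₀ z)) ∧ f.norm ≤ C := by
  have : IsClosed (LinearMap.ker (addMap ι₀ ι₁) : Set (WithLp 1 (X₀ × X₁))) := hk
  refine ⟨{
    toFun := fun z => inlL ι₀ ι₁ (F₀ z)
    continuousOn := ((inlL ι₀ ι₁).continuous.comp hd.continuous).continuousOn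
    bounded := hb.imp fun M hM z hz hz' => (norm_inl_le _ _ _).trans (hM z hz hz')
    analytic := ((inlL ι₀ ι₁).differentiable.comp hd).differentiableOn
    left := BoundedContinuousFunction.ofNormedAddCommGroup (fun t : ℝ => F₀ (t * Complex.I))
      (hd.continuous.comp (by fun_prop)) C h0
    toFun_left := fun t => rfl
    right := BoundedContinuousFunction.ofNormedAddCommGroup (fun t : ℝ => F₁ (1 + t * Complex.I))
      (hc.comp (by fun_prop)) C h1
    toFun_right := fun t => inl_eq_inr (hF _) }, fun z => rfl, ?_⟩
  exact max_le ((BoundedContinuousFunction.norm_le hC).2 h0)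
    ((BoundedContinuousFunction.norm_le hC).2 h1)

end Couple

end ComplexInterpolation

/-! ### Basic properties of weighted Sobolev spaces -/

namespace WeightedSobolev

/-- Euclidean space of dimension `d`. -/
abbrev Euc (d : ℕ) : Type := EuclideanSpace ℝ (Fin d)

variable {d : ℕ} {U : Opens (Euc d)}

theorem measure_absolutelyContinuous (ω : Weight U) :
    ω.measure ≪ volume.restrict (U : Set (Euc d)) :=
  withDensity_absolutelyContinuous _ _

theorem exists_compact_exhaustion (U : Opens (Euc d)) :
    ∃ K : ℕ → Set (Euc d), (∀ n, IsCompact (K n)) ∧ (∀ n, K n ⊆ U) ∧ Monotone K ∧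
      (⋃ n, K n) = U := by
  have : SigmaCompactSpace (U : Set (Euc d)) := by
    have : LocallyCompactSpace (U : Set (Euc d)) := U.isOpen.locallyCompactSpace
    exact sigmaCompactSpace_of_locallyCompact_secondCountable
  obtain ⟨K, hK, hKU⟩ := isSigmaCompact_iff_sigmaCompactSpace.2 this
  refine ⟨Set.accumulate K, isCompact_accumulate hK, fun n => ?_, Set.monotone_accumulate, ?_⟩
  · rw [← hKU, ← Set.iUnion_accumulate]
    exact subset_iUnion (Set.accumulate K) n
  · rw [Set.iUnion_accumulate, hKU]

theorem ae_restrict_of_forall_compact {P : Euc d → Prop}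
    (h : ∀ K : Set (Euc d), IsCompact K → K ⊆ U → ∀ᵐ x ∂volume.restrict K, P x) :
    ∀ᵐ x ∂volume.restrict (U : Set (Euc d)), P x := by
  obtain ⟨K, hK, hKU, -, hU⟩ := exists_compact_exhaustion U
  rw [← hU, ae_restrict_iUnion_iff]
  exact fun n => h _ (hK n) (hKU n)

/-- The fundamental lemma of the calculus of variations: the difference of the two gradients
annihilates all test functions. -/
theorem HasWeakGradient.ae_eq {φ φ' : Euc d → ℂ} {G G' : Fin d → Euc d → ℂ}
    (h : HasWeakGradient U φ G) (h' : HasWeakGradient U φ' G')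
    (hφ : φ =ᵐ[volume.restrict (U : Set (Euc d))] φ') (i : Fin d) :
    G i =ᵐ[volume.restrict (U : Set (Euc d))] G' i := by
  have h'' := h'.congr hφ.symm fun i => EventuallyEq.rfl
  have key := U.isOpen.ae_eq_zero_of_integral_contDiff_smul_eq_zero (f := fun x => G i x - G' i x)
    (μ := volume) ?_ ?_
  · refine (ae_restrict_iff' U.isOpen.measurableSet).2 ?_
    filter_upwards [key] with x hx hxU
    exact sub_eq_zero.1 (hx hxU)
  · rw [locallyIntegrableOn_iff U.isOpen.isLocallyClosed]
    exact fun K hK hK' => (h.integrableOn_grad i K hK' hK).sub (h'.integrableOn_grad i K hK' hK)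
  · intro g hg hc hs
    have h1 := (h.integrable_test i hg hc hs).2
    have h2 := (h''.integrable_test i hg hc hs).2
    have e : ∫ x, g x • (G i x - G' i x) = ∫ x in U, g x • (G i x - G' i x) := by
      refine (setIntegral_eq_integral_of_forall_compl_eq_zero fun x hx => ?_).symm
      rw [image_eq_zero_of_notMem_tsupport fun hx' => hx (hs hx'), zero_smul]
    rw [e]
    simp only [smul_sub]
    rw [integral_sub h1 h2, sub_eq_zero]
    exact neg_injective ((h.integral_eq i g hg hc hs).symm.trans (h''.integral_eq i g hg hc hs))

variable {p : ℝ≥0∞} [Fact (1 ≤ p)]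

/-- If `ω ≥ m > 0` on `K`, then `dx ≤ m⁻¹ ω dx` there. Local integrability and the continuity of
restrictions to compact sets come from this. -/
theorem Weight.CompactlyBounded.exists_le_smul {ω : Weight U} (hω : ω.CompactlyBounded)
    {K : Set (Euc d)} (hK : IsCompact K) (hKU : K ⊆ U) :
    ∃ c : ℝ≥0∞, c ≠ ∞ ∧ volume.restrict K ≤ c • ω.measure := by
  obtain ⟨m, M, hm, h⟩ := hω K hK hKU
  refine ⟨ENNReal.ofReal m⁻¹, ENNReal.ofReal_ne_top, Measure.le_iff.2 fun s hs => ?_⟩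
  rw [Measure.smul_apply, Weight.measure, withDensity_apply _ hs, Measure.restrict_restrict hs,
    smul_eq_mul, ← lintegral_const_mul' _ _ ENNReal.ofReal_ne_top, Measure.restrict_apply hs,
    ← setLIntegral_one]
  refine (setLIntegral_mono' (hs.inter hK.measurableSet) fun x hx => ?_).trans
    (lintegral_mono_set (inter_subset_inter_right s hKU))
  rw [← ENNReal.ofReal_mul (inv_pos.2 hm).le, ← ENNReal.ofReal_one]
  refine ENNReal.ofReal_le_ofReal ?_
  rw [inv_mul_eq_div, le_div_iff₀ hm, one_mul]
  exact (h x hx.2).1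

/-- Restriction of functions in `L^p(U, ω)` to a compact subset of `U`. -/
theorem Weight.CompactlyBounded.exists_restrict {ω : Weight U} (hω : ω.CompactlyBounded)
    {K : Set (Euc d)} (hK : IsCompact K) (hKU : K ⊆ U) :
    ∃ R : Lp ℂ p ω.measure →L[ℂ] Lp ℂ p (volume.restrict K),
      ∀ f, R f =ᵐ[volume.restrict K] f := by
  obtain ⟨c, hc, h⟩ := hω.exists_le_smul hK hKU
  have hac : volume.restrict K ≪ ω.measure := Measure.absolutelyContinuous_of_le_smul h
  refine ⟨{ toFun := Lp.LpToLpOfMeasureLeSMul hc h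
            map_add' := map_add _
            map_smul' := fun z f => ?_
            cont := (Lp.LpToLpOfMeasureLeSMul hc h).continuous },
    fun f => Lp.coeFn_LpToLpOfMeasureLeSMul hc h f⟩
  refine Lp.ext ?_
  filter_upwards [Lp.coeFn_LpToLpOfMeasureLeSMul hc h f,
    Lp.coeFn_LpToLpOfMeasureLeSMul hc h (z • f), hac.ae_le (Lp.coeFn_smul z f),
    Lp.coeFn_smul z (Lp.LpToLpOfMeasureLeSMul hc h f)] with x h1 h2 h3 h4
  rw [h2, h3, RingHom.id_apply, h4, Pi.smul_apply, Pi.smul_apply, h1]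

theorem Weight.CompactlyBounded.integrableOn {ω : Weight U} (hω : ω.CompactlyBounded)
    (f : Lp ℂ p ω.measure) (K : Set (Euc d)) (hK : IsCompact K) (hKU : K ⊆ U) :
    IntegrableOn f K := by
  obtain ⟨c, hc, h⟩ := hω.exists_le_smul hK hKU
  have : IsFiniteMeasure (volume.restrict K) := ⟨by simpa using hK.measure_lt_top⟩
  exact ((Lp.memLp f).of_measure_le_smul hc h).integrable Fact.out

/-- Integration against a bounded function is a continuous functional on `L^p` of a finite
measure. -/
theorem exists_pairing {α : Type*} {m : MeasurableSpace α} {μ : Measure α} [IsFiniteMeasure μ]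
    {b : α → ℂ} (hb : AEStronglyMeasurable b μ) {C : ℝ} (hC : ∀ᵐ x ∂μ, ‖b x‖ ≤ C) :
    ∃ L : Lp ℂ p μ →L[ℂ] ℂ, ∀ f, L f = ∫ x, b x * f x ∂μ := by
  have hq : p.HolderConjugate p.conjExponent := inferInstance
  have hq' : p.conjExponent.HolderConjugate p := hq.symm
  have h1 : Fact (1 ≤ p.conjExponent) := ⟨hq'.one_le⟩
  have hm : MemLp b p.conjExponent μ := MemLp.of_bound hb C hC
  refine ⟨(ContinuousLinearMap.mul ℂ ℂ).lpPairing μ p.conjExponent p (hm.toLp b), fun f => ?_⟩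
  rw [ContinuousLinearMap.lpPairing_eq_integral]
  refine integral_congr_ae ?_
  filter_upwards [hm.coeFn_toLp] with x hx
  rw [hx]; rfl

/-- Integration over `U` against a continuous function with compact support in `U` is a continuous
functional on `L^p(U, ω)`. -/
theorem Weight.CompactlyBounded.continuous_integral_smul {ω : Weight U}
    (hω : ω.CompactlyBounded) {K : Set (Euc d)} (hK : IsCompact K) (hKU : K ⊆ U)
    {b : Euc d → ℝ} (hb : Continuous b) (hbK : ∀ x ∉ K, b x = 0) :
    Continuous fun f : Lp ℂ p ω.measure => ∫ x in U, b x • f x := by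
  have : IsFiniteMeasure (volume.restrict K) := ⟨by simpa using hK.measure_lt_top⟩
  obtain ⟨R, hR⟩ := hω.exists_restrict (p := p) hK hKU
  obtain ⟨C, hC⟩ := hK.exists_bound_of_continuousOn hb.continuousOn
  obtain ⟨L, hL⟩ := exists_pairing (p := p) (μ := volume.restrict K) (b := fun x => (b x : ℂ))
    (C := C) (Complex.continuous_ofReal.comp hb).aestronglyMeasurable (by
      filter_upwards [ae_restrict_mem hK.measurableSet] with x hx
      simpa using hC x hx)
  have : (fun f : Lp ℂ p ω.measure => ∫ x in U, b x • f x) = fun f => L (R f) := by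
    funext f
    rw [hL]
    have e : ∫ x in U, b x • f x = ∫ x in K, b x • f x :=
      setIntegral_eq_of_subset_of_forall_sdiff_eq_zero U.isOpen.measurableSet hKU
        fun x hx => by rw [hbK x hx.2, zero_smul]
    rw [e]
    refine integral_congr_ae ?_
    filter_upwards [hR f] with x hx
    rw [hx, Complex.real_smul]
  rw [this]
  exact L.continuous.comp R.continuous

/-- Local integrability is automatic, so membership reduces to the integration by parts identities,
and both sides of each are continuous in `L^p(U, ω)`. -/
theorem isClosed_sobolev {ω : Weight U} (hω : ω.CompactlyBounded) :
    IsClosed (sobolev ω p : Set (PiLp p fun _ : Option (Fin d) => Lp ℂ p ω.measure)) := by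
  have : (sobolev ω p : Set (PiLp p fun _ : Option (Fin d) => Lp ℂ p ω.measure)) =
      ⋂ (i : Fin d) (ψ : Euc d → ℝ) (_ : ContDiff ℝ (⊤ : ℕ∞) ψ) (_ : HasCompactSupport ψ)
        (_ : tsupport ψ ⊆ U), {w | ∫ x in U, fderiv ℝ ψ x (EuclideanSpace.single i 1) • w none x =
          - ∫ x in U, ψ x • w (some i) x} := by
    ext w
    simp only [mem_iInter, mem_ofPred_eq]
    exact ⟨fun h => h.integral_eq, fun h => ⟨hω.integrableOn _, fun i => hω.integrableOn _, h⟩⟩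
  rw [this]
  refine isClosed_iInter fun i => isClosed_iInter fun ψ => isClosed_iInter fun hψ =>
    isClosed_iInter fun hc => isClosed_iInter fun hs => isClosed_eq ?_ ?_
  · refine (hω.continuous_integral_smul (p := p) hc hs
      ((hψ.continuous_fderiv (by simp)).clm_apply continuous_const) ?_).comp
      (PiLp.continuous_apply p _ none)
    intro x hx
    simp [fderiv_of_notMem_tsupport (𝕜 := ℝ) hx]
  · exact ((hω.continuous_integral_smul (p := p) hc hs hψ.continuous
      fun x hx => image_eq_zero_of_notMem_tsupport hx).comp
      (PiLp.continuous_apply p _ (some i))).neg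

theorem isClosed_sobolev₀ {ω : Weight U} (hω : ω.CompactlyBounded) :
    IsClosed (sobolev₀ ω p : Set (PiLp p fun _ : Option (Fin d) => Lp ℂ p ω.measure)) := by
  rw [sobolev₀, Submodule.map_coe]
  exact (isClosed_sobolev hω).isClosedEmbedding_subtypeVal.isClosedMap _
    (Submodule.isClosed_topologicalClosure _)

theorem completeSpace_sobolev₀ {ω : Weight U} (hω : ω.CompactlyBounded) :
    CompleteSpace (sobolev₀ ω p) :=
  (isClosed_sobolev₀ hω).completeSpace_coe

theorem sobolevIncl_coeFn (ω : Weight U) (w : sobolev ω p) :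
    sobolevIncl ω p w =ᵐ[volume.restrict (U : Set (Euc d))] w.1 none :=
  AEEqFun.coeFn_mk _ _

theorem sobolev_hasWeakGradient {ω : Weight U} (w : sobolev ω p) :
    HasWeakGradient U (w.1 none) fun i => w.1 (some i) := w.2

theorem exists_sobolev {ω : Weight U} {φ : Euc d → ℂ} {G : Fin d → Euc d → ℂ}
    (h : HasWeakGradient U φ G) (hφ : MemLp φ p ω.measure) (hG : ∀ i, MemLp (G i) p ω.measure) :
    ∃ w : sobolev ω p, w.1 none =ᵐ[ω.measure] φ ∧ ∀ i, w.1 (some i) =ᵐ[ω.measure] G i := by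
  let w : PiLp p fun _ : Option (Fin d) => Lp ℂ p ω.measure :=
    WithLp.toLp p fun k => k.elim (hφ.toLp φ) fun i => (hG i).toLp (G i)
  have h0 : w none =ᵐ[ω.measure] φ := hφ.coeFn_toLp
  have hi : ∀ i, w (some i) =ᵐ[ω.measure] G i := fun i => (hG i).coeFn_toLp
  exact ⟨⟨w, h.congr (ω.absolutelyContinuous.ae_le h0.symm)
    fun i => ω.absolutelyContinuous.ae_le (hi i).symm⟩, h0, hi⟩

/-- The weak gradient does not see the weight, so the function determines all components even across
different weights. -/
theorem sobolev_component_ae_eq {ω ω' : Weight U} {w : sobolev ω p} {w' : sobolev ω' p}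
    (h : sobolevIncl ω p w = sobolevIncl ω' p w') (k : Option (Fin d)) :
    w.1 k =ᵐ[volume.restrict (U : Set (Euc d))] w'.1 k := by
  have h0 : w.1 none =ᵐ[volume.restrict (U : Set (Euc d))] w'.1 none :=
    (sobolevIncl_coeFn ω w).symm.trans (h ▸ sobolevIncl_coeFn ω' w')
  cases k with
  | none => exact h0
  | some i => exact (sobolev_hasWeakGradient w).ae_eq (sobolev_hasWeakGradient w') h0 i

theorem sobolevIncl_injective (ω : Weight U) : Function.Injective (sobolevIncl ω p) := by
  intro v w h
  refine Subtype.ext (PiLp.ext fun k => Lp.ext ?_)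
  exact (measure_absolutelyContinuous ω).ae_le (sobolev_component_ae_eq h k)

theorem lintegral_weight_measure (ω : Weight U) {f : Euc d → ℝ≥0∞}
    (hf : AEMeasurable f (volume.restrict (U : Set (Euc d)))) :
    ∫⁻ x, f x ∂ω.measure = ∫⁻ x in U, f x * ENNReal.ofReal (ω x) := by
  rw [Weight.measure, lintegral_withDensity_eq_lintegral_mul₀ ω.aemeasurable.ennreal_ofReal hf]
  simp only [Pi.mul_apply, mul_comm]

theorem toReal_pos_of_fact (hp : p ≠ ∞) : 0 < p.toReal :=
  ENNReal.toReal_pos (zero_lt_one.trans_le (Fact.out : 1 ≤ p)).ne' hp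

theorem eLpNorm_rpow_weight (hp : p ≠ ∞) (ω : Weight U) {f : Euc d → ℂ}
    (hf : AEStronglyMeasurable f (volume.restrict (U : Set (Euc d)))) :
    eLpNorm f p ω.measure ^ p.toReal =
      ∫⁻ x in U, ‖f x‖ₑ ^ p.toReal * ENNReal.ofReal (ω x) := by
  have h0 := toReal_pos_of_fact hp
  rw [eLpNorm_eq_lintegral_rpow_enorm_toReal (zero_lt_one.trans_le (Fact.out : 1 ≤ p)).ne' hp,
    ← ENNReal.rpow_mul, one_div_mul_cancel h0.ne', ENNReal.rpow_one,
    lintegral_weight_measure ω (hf.enorm.pow_const _)]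

theorem enorm_rpow_piLp {ι : Type*} [Fintype ι] {F : ι → Type*} [∀ k, NormedAddCommGroup (F k)]
    (hp : p ≠ ∞) (w : PiLp p F) : ‖w‖ₑ ^ p.toReal = ∑ k, ‖w k‖ₑ ^ p.toReal := by
  have h0 := toReal_pos_of_fact hp
  have h1 : ‖w‖₊ ^ p.toReal = ∑ k, ‖w k‖₊ ^ p.toReal := by
    rw [PiLp.nnnorm_eq_sum hp, ← NNReal.rpow_mul, one_div_mul_cancel h0.ne', NNReal.rpow_one]
  simp only [enorm_eq_nnnorm, ← ENNReal.coe_rpow_of_nonneg _ h0.le]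
  exact_mod_cast h1

theorem enorm_rpow_eq (hp : p ≠ ∞) {ω : Weight U}
    (w : PiLp p fun _ : Option (Fin d) => Lp ℂ p ω.measure) :
    ‖w‖ₑ ^ p.toReal =
      ∑ k, ∫⁻ x in U, ‖w k x‖ₑ ^ p.toReal * ENNReal.ofReal (ω x) := by
  rw [enorm_rpow_piLp hp]
  refine Finset.sum_congr rfl fun k _ => ?_
  rw [Lp.enorm_def, eLpNorm_rpow_weight hp ω
    ((Lp.aestronglyMeasurable (w k)).mono_ac ω.absolutelyContinuous)]

/-! ### The sum of two weighted Sobolev spaces -/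

section Couple

open ComplexInterpolation

variable {ω₀ ω₁ : Weight U}

theorem Weight.CompactlyBounded.exists_restrict_sobolev {ω : Weight U} (hω : ω.CompactlyBounded)
    {K : Set (Euc d)} (hK : IsCompact K) (hKU : K ⊆ U) (k : Option (Fin d)) :
    ∃ R : sobolev ω p →L[ℂ] Lp ℂ p (volume.restrict K),
      ∀ w, R w =ᵐ[volume.restrict K] w.1 k := by
  obtain ⟨R, hR⟩ := hω.exists_restrict (p := p) hK hKU
  exact ⟨R ∘L PiLp.proj p _ k ∘L (sobolev ω p).subtypeL, fun w => hR (w.1 k)⟩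

theorem exists_restrict_prod (h₀ : ω₀.CompactlyBounded) (h₁ : ω₁.CompactlyBounded)
    {K : Set (Euc d)} (hK : IsCompact K) (hKU : K ⊆ U) (k : Option (Fin d)) :
    ∃ Q : WithLp 1 (sobolev ω₀ p × sobolev ω₁ p) →L[ℂ] Lp ℂ p (volume.restrict K),
      ∀ x, Q x =ᵐ[volume.restrict K] fun y => x.fst.1 k y + x.snd.1 k y := by
  obtain ⟨R₀, hR₀⟩ := h₀.exists_restrict_sobolev (p := p) hK hKU k
  obtain ⟨R₁, hR₁⟩ := h₁.exists_restrict_sobolev (p := p) hK hKU k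
  refine ⟨R₀.coprod R₁ ∘L (WithLp.prodContinuousLinearEquiv 1 ℂ _ _).toContinuousLinearMap,
    fun x => ?_⟩
  refine (Lp.coeFn_add (R₀ x.fst) (R₁ x.snd)).trans ?_
  filter_upwards [hR₀ x.fst, hR₁ x.snd] with y e2 e3
  rw [Pi.add_apply, e2, e3]

theorem ae_component_of_mem_ker {x : WithLp 1 (sobolev ω₀ p × sobolev ω₁ p)}
    (hx : x ∈ LinearMap.ker (addMap (sobolevIncl ω₀ p) (sobolevIncl ω₁ p)))
    (k : Option (Fin d)) :
    ∀ᵐ y ∂volume.restrict (U : Set (Euc d)), x.fst.1 k y + x.snd.1 k y = 0 := by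
  rw [LinearMap.mem_ker, addMap_apply] at hx
  have hx' : sobolevIncl ω₀ p x.fst = sobolevIncl ω₁ p (-x.snd) := by
    rw [map_neg]; exact eq_neg_of_add_eq_zero_left hx
  have hn : (-x.snd).1 k =ᵐ[volume.restrict (U : Set (Euc d))] -(x.snd.1 k) :=
    ω₁.absolutelyContinuous.ae_le (Lp.coeFn_neg (x.snd.1 k))
  filter_upwards [sobolev_component_ae_eq hx' k, hn] with y e1 e2
  rw [e1, e2, Pi.neg_apply, neg_add_cancel]

/-- Restriction of functions in `W^{1,p}(U, ω₀) + W^{1,p}(U, ω₁)`, or of their partial derivatives,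
to a compact subset of `U`. -/
theorem exists_restrict_sumSpace (h₀ : ω₀.CompactlyBounded) (h₁ : ω₁.CompactlyBounded)
    {K : Set (Euc d)} (hK : IsCompact K) (hKU : K ⊆ U) (k : Option (Fin d)) :
    ∃ T : SumSpace (sobolevIncl ω₀ p) (sobolevIncl ω₁ p) →L[ℂ] Lp ℂ p (volume.restrict K),
      ∀ x, T (Submodule.Quotient.mk x) =ᵐ[volume.restrict K]
        fun y => x.fst.1 k y + x.snd.1 k y := by
  obtain ⟨Q, hQ⟩ := exists_restrict_prod (p := p) h₀ h₁ hK hKU k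
  refine ⟨(LinearMap.ker (addMap _ _)).liftQL Q fun x hx => ?_, hQ⟩
  have hx0 : Q x = 0 := by
    refine Lp.ext ?_
    filter_upwards [ae_restrict_of_ae_restrict_of_subset hKU (ae_component_of_mem_ker hx k),
      hQ x, Lp.coeFn_zero ℂ p (volume.restrict K)] with y e1 e3 e4
    rw [e3, e1, e4, Pi.zero_apply]
  exact hx0

/-- A sum vanishes on `U` exactly when its restrictions to compact subsets do, so the kernel is an
intersection of kernels of continuous maps. -/
theorem isClosed_ker_addMap (h₀ : ω₀.CompactlyBounded) (h₁ : ω₁.CompactlyBounded) :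
    IsClosed (LinearMap.ker (addMap (sobolevIncl ω₀ p) (sobolevIncl ω₁ p)) :
      Set (WithLp 1 (sobolev ω₀ p × sobolev ω₁ p))) := by
  choose T hT using fun K : {K : Set (Euc d) // IsCompact K ∧ K ⊆ U} =>
    exists_restrict_sumSpace (p := p) h₀ h₁ K.2.1 K.2.2 none
  have : (LinearMap.ker (addMap (sobolevIncl ω₀ p) (sobolevIncl ω₁ p)) :
      Set (WithLp 1 (sobolev ω₀ p × sobolev ω₁ p))) =
      ⋂ K, {x | T K (Submodule.mkQL _ x) = 0} := by
    ext x
    simp only [SetLike.mem_coe, mem_iInter, mem_ofPred_eq]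
    refine ⟨fun hx K => ?_, fun hx => ?_⟩
    · have : Submodule.mkQL (LinearMap.ker (addMap (sobolevIncl ω₀ p) (sobolevIncl ω₁ p))) x = 0 :=
        (Submodule.Quotient.mk_eq_zero _).2 hx
      rw [this, map_zero]
    · rw [LinearMap.mem_ker, addMap_apply]
      refine AEEqFun.ext ?_
      have hae : ∀ᵐ y ∂volume.restrict (U : Set (Euc d)), x.fst.1 none y + x.snd.1 none y = 0 := by
        refine ae_restrict_of_forall_compact fun K hK hKU => ?_
        have h1 := hT ⟨K, hK, hKU⟩ x
        have h2 : T ⟨K, hK, hKU⟩ (Submodule.Quotient.mk x) = 0 := hx ⟨K, hK, hKU⟩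
        rw [h2] at h1
        filter_upwards [h1, Lp.coeFn_zero ℂ p (volume.restrict K)] with y e1 e2
        rw [← e1, e2, Pi.zero_apply]
      filter_upwards [AEEqFun.coeFn_add (sobolevIncl ω₀ p x.fst) (sobolevIncl ω₁ p x.snd),
        sobolevIncl_coeFn ω₀ x.fst, sobolevIncl_coeFn ω₁ x.snd, hae,
        AEEqFun.coeFn_zero (μ := volume.restrict (U : Set (Euc d))) (β := ℂ)] with y e1 e2 e3 e4 e5
      rw [e1, Pi.add_apply, e2, e3, e4, e5, Pi.zero_apply]
  rw [this]
  exact isClosed_iInter fun K =>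
    isClosed_eq ((T K).continuous.comp (Submodule.mkQL _).continuous) continuous_const

/-- The inclusion of `W₀^{1,p}(U, ω)` in `W^{1,p}(U, ω)`. -/
def sobolev₀Inclusion (ω : Weight U) (p : ℝ≥0∞) [Fact (1 ≤ p)] :
    sobolev₀ ω p →L[ℂ] sobolev ω p where
  toLinearMap := Submodule.inclusion (Submodule.map_subtype_le (sobolev ω p) _)
  cont := continuous_subtype_val.subtype_mk _

theorem isClosed_ker_addMap₀ (h₀ : ω₀.CompactlyBounded) (h₁ : ω₁.CompactlyBounded) :
    IsClosed (LinearMap.ker (addMap (sobolev₀Incl ω₀ p) (sobolev₀Incl ω₁ p)) :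
      Set (WithLp 1 (sobolev₀ ω₀ p × sobolev₀ ω₁ p))) := by
  let J : WithLp 1 (sobolev₀ ω₀ p × sobolev₀ ω₁ p) →L[ℂ] WithLp 1 (sobolev ω₀ p × sobolev ω₁ p) :=
    (WithLp.prodContinuousLinearEquiv 1 ℂ _ _).symm.toContinuousLinearMap ∘L
      (sobolev₀Inclusion ω₀ p).prodMap (sobolev₀Inclusion ω₁ p) ∘L
      (WithLp.prodContinuousLinearEquiv 1 ℂ _ _).toContinuousLinearMap
  exact (isClosed_ker_addMap (p := p) h₀ h₁).preimage J.continuous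

end Couple

end WeightedSobolev

/-! ### The embedding in the weighted Sobolev space with the interpolated weight -/

namespace WeightedSobolev

open ComplexInterpolation

variable {d : ℕ} {U : Opens (Euc d)} {p : ℝ≥0∞} [Fact (1 ≤ p)]

theorem one_le_toReal (hp : p ≠ ∞) : 1 ≤ p.toReal := by
  simpa using ENNReal.toReal_mono hp (Fact.out : 1 ≤ p)

theorem Weight.CompactlyBounded.exists_abs_log_le {ω : Weight U} (hω : ω.CompactlyBounded)
    {K : Set (Euc d)} (hK : IsCompact K) (hKU : K ⊆ U) :
    ∃ B : ℝ, 0 ≤ B ∧ ∀ x ∈ K, |Real.log (ω x)| ≤ B := by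
  obtain ⟨m, M, hm, h⟩ := hω K hK hKU
  refine ⟨max |Real.log m| |Real.log M|, le_max_of_le_left (abs_nonneg _), fun x hx => ?_⟩
  exact abs_le_max_abs_abs (Real.log_le_log hm (h x hx).1)
    (Real.log_le_log (hm.trans_le (h x hx).1) (h x hx).2)

theorem lintegral_enorm_rpow_mul_eq (ω : Weight U) {s : Set (Euc d)}
    (hsm : MeasurableSet s) (f : Euc d → ℂ) {P : ℝ} (hP : 0 ≤ P) :
    ∫⁻ x in s, ‖f x‖ₑ ^ P * ENNReal.ofReal (ω x) =
      ∫⁻ x in s, ENNReal.ofReal (‖f x‖ ^ P * ω x) := by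
  refine setLIntegral_congr_fun hsm fun x hx => ?_
  rw [ENNReal.ofReal_mul (by positivity), ← ENNReal.ofReal_rpow_of_nonneg (norm_nonneg _) hP,
    ofReal_norm]

theorem integrableOn_norm_rpow_mul_weight (hp : p ≠ ∞) {ω : Weight U} (f : Lp ℂ p ω.measure) :
    IntegrableOn (fun x => ‖f x‖ ^ p.toReal * ω x) U ∧
      ∫ x in U, ‖f x‖ ^ p.toReal * ω x = ‖f‖ ^ p.toReal := by
  have h0 := toReal_pos_of_fact hp
  have hm := (Lp.aestronglyMeasurable f).mono_ac ω.absolutelyContinuous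
  have e : ∫⁻ x in U, ENNReal.ofReal (‖f x‖ ^ p.toReal * ω x) =
      ENNReal.ofReal (‖f‖ ^ p.toReal) := by
    rw [← lintegral_enorm_rpow_mul_eq ω U.isOpen.measurableSet _ h0.le,
      ← eLpNorm_rpow_weight hp ω hm, ← Lp.enorm_def,
      ← ENNReal.ofReal_rpow_of_nonneg (norm_nonneg _) h0.le, ofReal_norm]
  have hnn : 0 ≤ᵐ[volume.restrict (U : Set (Euc d))] fun x => ‖f x‖ ^ p.toReal * ω x := by
    filter_upwards [ae_restrict_mem U.isOpen.measurableSet] with x hx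
    exact mul_nonneg (by positivity) (ω.pos x hx).le
  have hi : IntegrableOn (fun x => ‖f x‖ ^ p.toReal * ω x) U := by
    refine (lintegral_ofReal_ne_top_iff_integrable ?_ hnn).1 (e ▸ ENNReal.ofReal_ne_top)
    exact ((hm.norm.aemeasurable.pow_const _).mul ω.aemeasurable).aestronglyMeasurable
  refine ⟨hi, ?_⟩
  rw [integral_eq_lintegral_of_nonneg_ae hnn hi.1, e, ENNReal.toReal_ofReal (by positivity)]

theorem sum_integral_norm_rpow_mul_weight_le (hp : p ≠ ∞) {ω : Weight U} (w : sobolev ω p)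
    {A : Set (Euc d)} (hAU : A ⊆ U) :
    ∑ k, ∫ x in A, ‖w.1 k x‖ ^ p.toReal * ω x ≤ ‖w‖ ^ p.toReal := by
  have h0 := toReal_pos_of_fact hp
  have : ‖w‖ ^ p.toReal = ∑ k, ‖w.1 k‖ ^ p.toReal := by
    have h := enorm_rpow_piLp hp w.1
    have h' := congrArg ENNReal.toReal h
    rw [ENNReal.toReal_sum (by simp), ← ENNReal.toReal_rpow, toReal_enorm] at h'
    simpa [← ENNReal.toReal_rpow, toReal_enorm] using h'
  rw [this]
  refine Finset.sum_le_sum fun k _ => ?_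
  obtain ⟨hi, he⟩ := integrableOn_norm_rpow_mul_weight hp (w.1 k)
  rw [← he]
  refine setIntegral_mono_set hi ?_ hAU.eventuallyLE
  filter_upwards [ae_restrict_mem U.isOpen.measurableSet] with x hx
  exact mul_nonneg (by positivity) (ω.pos x hx).le

/-- Weighted arithmetic-geometric mean with weights `1/P` and `1 - 1/P`; in this form `P = 1` needs
no separate treatment. In the application `e^s` is a boundary weight and `e^t` is `ω_θ`. -/
theorem young_exp {P : ℝ} (hP : 1 ≤ P) {x y : ℝ} (hx : 0 ≤ x) (hy : 0 ≤ y) (s t : ℝ) :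
    x * Real.exp (s / P) * (y ^ (P - 1) * Real.exp ((1 - 1 / P) * t)) ≤
      1 / P * (x ^ P * Real.exp s) + (1 - 1 / P) * (y ^ P * Real.exp t) := by
  have hP0 : 0 < P := by linarith
  have h1 : 0 ≤ 1 - 1 / P := by
    rw [sub_nonneg, div_le_one hP0]; exact hP
  have h := Real.geom_mean_le_arith_mean2_weighted (w₁ := 1 / P) (w₂ := 1 - 1 / P)
    (p₁ := x ^ P * Real.exp s) (p₂ := y ^ P * Real.exp t) (by positivity) h1 (by positivity)
    (by positivity) (by ring)
  refine le_trans (le_of_eq ?_) h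
  rw [Real.mul_rpow (by positivity) (by positivity), Real.mul_rpow (by positivity) (by positivity),
    ← Real.rpow_mul hx, ← Real.rpow_mul hy, ← Real.exp_mul, ← Real.exp_mul,
    mul_one_div_cancel hP0.ne', Real.rpow_one]
  have : P * (1 - 1 / P) = P - 1 := by field_simp
  rw [this]
  ring_nf

variable {ω₀ ω₁ : Weight U}

theorem interp_eq_exp (ω₀ ω₁ : Weight U) (θ : ℝ) {x : Euc d} (hx : x ∈ U) :
    ω₀.interp ω₁ θ x = Real.exp ((1 - θ) * Real.log (ω₀ x) + θ * Real.log (ω₁ x)) := by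
  have h0 := ω₀.pos x hx
  have h1 := ω₁.pos x hx
  change ω₀ x ^ (1 - θ) * ω₁ x ^ θ = _
  rw [Real.rpow_def_of_pos h0, Real.rpow_def_of_pos h1, ← Real.exp_add]
  ring_nf

theorem restrict_inl {K : Set (Euc d)} (hKU : K ⊆ U) {k : Option (Fin d)}
    {T : SumSpace (sobolevIncl ω₀ p) (sobolevIncl ω₁ p) →L[ℂ] Lp ℂ p (volume.restrict K)}
    (hT : ∀ x, T (Submodule.Quotient.mk x) =ᵐ[volume.restrict K]
        fun y => x.fst.1 k y + x.snd.1 k y) (w : sobolev ω₀ p) :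
    T (SumSpace.inl _ _ w) =ᵐ[volume.restrict K] w.1 k := by
  have hz : (0 : Lp ℂ p ω₁.measure) =ᵐ[volume.restrict K] (0 : Euc d → ℂ) :=
    ae_restrict_of_ae_restrict_of_subset hKU (ω₁.absolutelyContinuous.ae_le (Lp.coeFn_zero _ _ _))
  filter_upwards [hT (WithLp.toLp 1 (w, 0)), hz] with y h1 h2
  refine Eq.trans h1 ?_
  change w.1 k y + (0 : Lp ℂ p ω₁.measure) y = _
  rw [h2, Pi.zero_apply, add_zero]

theorem restrict_inr {K : Set (Euc d)} (hKU : K ⊆ U) {k : Option (Fin d)}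
    {T : SumSpace (sobolevIncl ω₀ p) (sobolevIncl ω₁ p) →L[ℂ] Lp ℂ p (volume.restrict K)}
    (hT : ∀ x, T (Submodule.Quotient.mk x) =ᵐ[volume.restrict K]
        fun y => x.fst.1 k y + x.snd.1 k y) (w : sobolev ω₁ p) :
    T (SumSpace.inr _ _ w) =ᵐ[volume.restrict K] w.1 k := by
  have hz : (0 : Lp ℂ p ω₀.measure) =ᵐ[volume.restrict K] (0 : Euc d → ℂ) :=
    ae_restrict_of_ae_restrict_of_subset hKU (ω₀.absolutelyContinuous.ae_le (Lp.coeFn_zero _ _ _))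
  filter_upwards [hT (WithLp.toLp 1 (0, w)), hz] with y h1 h2
  refine Eq.trans h1 ?_
  change (0 : Lp ℂ p ω₀.measure) y + w.1 k y = _
  rw [h2, Pi.zero_apply, zero_add]

/-- Bound, on a boundary line of the strip, of the functional used to estimate the norm in
`L^p(U, ω_θ)`. -/
theorem sum_norm_integral_dual_le (hp : p ≠ ∞) {ω : Weight U} {K A : Set (Euc d)}
    (hA : MeasurableSet A) (hAK : A ⊆ K) (hAU : A ⊆ U) {c g : Option (Fin d) → Euc d → ℂ}
    {lθ : Euc d → ℝ} {w : Option (Fin d) → Euc d → ℂ} {z : ℂ} {a : Euc d → ℝ}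
    (u : sobolev ω p) (hg : ∀ k, g k =ᵐ[volume.restrict K] u.1 k)
    (hcA : ∀ k, ∀ x ∉ A, c k x = 0)
    (hc : ∀ k, ∀ x ∈ A, ‖c k x‖ * ‖Complex.exp (z * a x)‖ ≤
      Real.exp (Real.log (ω x) / p.toReal) *
        (‖w k x‖ ^ (p.toReal - 1) * Real.exp ((1 - 1 / p.toReal) * lθ x)))
    (hw : ∀ k, IntegrableOn (fun x => ‖w k x‖ ^ p.toReal * Real.exp (lθ x)) A) :
    ‖∑ k, ∫ x in K, c k x * (Complex.exp (z * a x) * g k x)‖ ≤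
      1 / p.toReal * ‖u‖ ^ p.toReal + (1 - 1 / p.toReal) *
        ∑ k, ∫ x in A, ‖w k x‖ ^ p.toReal * Real.exp (lθ x) := by
  have hP := one_le_toReal hp
  have h0 := toReal_pos_of_fact hp
  set P := p.toReal
  have hint : ∀ k, IntegrableOn (fun x => ‖u.1 k x‖ ^ P * ω x) A := fun k =>
    (integrableOn_norm_rpow_mul_weight hp (u.1 k)).1.mono_set hAU
  have key : ∀ k, ‖∫ x in K, c k x * (Complex.exp (z * a x) * g k x)‖ ≤
      1 / P * (∫ x in A, ‖u.1 k x‖ ^ P * ω x) +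
        (1 - 1 / P) * ∫ x in A, ‖w k x‖ ^ P * Real.exp (lθ x) := by
    intro k
    have e : ∫ x in K, c k x * (Complex.exp (z * a x) * g k x) =
        ∫ x in A, c k x * (Complex.exp (z * a x) * g k x) := by
      have h := setIntegral_indicator (μ := volume) (s := K) hA
        (f := fun x => c k x * (Complex.exp (z * a x) * g k x))
      rw [inter_eq_right.2 hAK] at h
      rw [← h]
      congr 1
      funext x
      by_cases hx : x ∈ A
      · rw [indicator_of_mem hx]
      · rw [indicator_of_notMem hx, hcA k x hx, zero_mul]
    rw [e, ← integral_const_mul, ← integral_const_mul,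
      ← integral_add ((hint k).const_mul _) ((hw k).const_mul _)]
    refine norm_integral_le_of_norm_le (((hint k).const_mul _).add ((hw k).const_mul _)) ?_
    filter_upwards [ae_restrict_mem hA, ae_restrict_of_ae_restrict_of_subset hAK (hg k)]
      with x hx hgx
    have hy := young_exp hP (norm_nonneg (u.1 k x)) (norm_nonneg (w k x)) (Real.log (ω x)) (lθ x)
    rw [Real.exp_log (ω.pos x (hAU hx))] at hy
    refine le_trans ?_ hy
    rw [hgx, norm_mul, norm_mul, ← mul_assoc]
    calc ‖c k x‖ * ‖Complex.exp (z * a x)‖ * ‖u.1 k x‖ ≤ _ * ‖u.1 k x‖ :=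
          mul_le_mul_of_nonneg_right (hc k x hx) (norm_nonneg _)
      _ = _ := by ring
  refine (norm_sum_le _ _).trans ((Finset.sum_le_sum fun k _ => key k).trans ?_)
  rw [Finset.sum_add_distrib, ← Finset.mul_sum, ← Finset.mul_sum]
  gcongr
  exact sum_integral_norm_rpow_mul_weight_le hp u hAU

-- The duality argument, applied to all components `(φ, ∇φ)` at once. The bound on `w` over `A`
-- makes `S` finite before any estimate, which is what permits absorbing `(1 - 1/P) S` at the end.
-- Young's inequality replaces Hölder's, so no normalization of the dual function is needed.
set_option maxHeartbeats 2000000 in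
theorem sum_lintegral_le_of_calderonFun (hp : p ≠ ∞) (h₀ : ω₀.CompactlyBounded)
    (h₁ : ω₁.CompactlyBounded) {θ : ℝ} (hθ0 : 0 < θ) (hθ1 : θ < 1)
    (f : CalderonFun (sobolevIncl ω₀ p) (sobolevIncl ω₁ p))
    {x₀ : WithLp 1 (sobolev ω₀ p × sobolev ω₁ p)}
    (hx₀ : Submodule.Quotient.mk x₀ = f.toFun θ)
    {w : Option (Fin d) → Euc d → ℂ} (hw : w = fun k y => x₀.fst.1 k y + x₀.snd.1 k y)
    {K A : Set (Euc d)} (hK : IsCompact K) (hKU : K ⊆ U) (hA : MeasurableSet A) (hAK : A ⊆ K)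
    {n : ℝ} (hn : ∀ k, ∀ x ∈ A, ‖w k x‖ ≤ n) :
    ∑ k, ∫⁻ x in A, ‖w k x‖ₑ ^ p.toReal * ENNReal.ofReal (ω₀.interp ω₁ θ x) ≤
      ENNReal.ofReal f.norm ^ p.toReal := by
  classical
  have hP := one_le_toReal hp
  have h0 := toReal_pos_of_fact hp
  set P := p.toReal with hPdef
  have hP1 : 0 ≤ 1 - 1 / P := by
    rw [sub_nonneg, div_le_one h0]; exact hP
  have hAU : A ⊆ U := hAK.trans hKU
  have hfin : IsFiniteMeasure (volume.restrict K) := ⟨by simpa using hK.measure_lt_top⟩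
  have hfinA : IsFiniteMeasure (volume.restrict A) :=
    ⟨by simpa using (measure_mono hAK).trans_lt hK.measure_lt_top⟩
  have hwm : ∀ k, Measurable (w k) := fun k => by
    rw [hw]
    exact (Lp.stronglyMeasurable (x₀.fst.1 k)).measurable.add
      (Lp.stronglyMeasurable (x₀.snd.1 k)).measurable
  obtain ⟨B₀, hB₀, hl₀⟩ := h₀.exists_abs_log_le hK hKU
  obtain ⟨B₁, hB₁, hl₁⟩ := h₁.exists_abs_log_le hK hKU
  let l₀ : Euc d → ℝ := fun x => Real.log (ω₀ x)
  let l₁ : Euc d → ℝ := fun x => Real.log (ω₁ x)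
  let lθ : Euc d → ℝ := fun x => (1 - θ) * l₀ x + θ * l₁ x
  have hl₀m : AEMeasurable l₀ (volume.restrict K) :=
    (ω₀.aemeasurable.mono_measure (Measure.restrict_mono hKU le_rfl)).log
  have hl₁m : AEMeasurable l₁ (volume.restrict K) :=
    (ω₁.aemeasurable.mono_measure (Measure.restrict_mono hKU le_rfl)).log
  have hlθm : AEMeasurable lθ (volume.restrict K) := (hl₀m.const_mul _).add (hl₁m.const_mul _)
  have hlθ : ∀ x ∈ K, |lθ x| ≤ B₀ + B₁ := fun x hx => by
    refine (abs_add_le _ _).trans (add_le_add ?_ ?_)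
    · rw [abs_mul, abs_of_pos (by linarith : 0 < 1 - θ)]
      nlinarith [hl₀ x hx, abs_nonneg (Real.log (ω₀ x))]
    · rw [abs_mul, abs_of_pos hθ0]
      nlinarith [hl₁ x hx, abs_nonneg (Real.log (ω₁ x))]
  -- `|exp (z a)|` is 1 on `re z = 0` and `(ω₁/ω₀)^(1/P)` on `re z = 1`. The indicator makes `a`
  -- bounded everywhere, as `expMul` demands.
  let a : Euc d → ℝ := K.indicator fun x => (l₁ x - l₀ x) / P
  have ham : AEStronglyMeasurable a (volume.restrict K) :=
    (((hl₁m.sub hl₀m).div_const P).indicator hK.measurableSet).aestronglyMeasurable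
  have haB : ∀ x, |a x| ≤ B₀ + B₁ := fun x => by
    by_cases hx : x ∈ K
    · change |K.indicator _ x| ≤ _
      rw [indicator_of_mem hx, abs_div, abs_of_pos h0]
      refine (div_le_self (abs_nonneg _) hP).trans ((abs_sub _ _).trans ?_)
      linarith [hl₀ x hx, hl₁ x hx]
    · change |K.indicator _ x| ≤ _
      rw [indicator_of_notMem hx, abs_zero]; positivity
  let e : Euc d → ℝ := fun x => (1 - 1 / P) * lθ x + l₀ x / P
  -- The dual function of `w`, weighted by `e^e = ω_θ^(1-1/P) ω₀^(1/P)`. The exponent `P - 2` may be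
  -- negative, but where `w` vanishes the factor `conj w` is zero.
  let c : Option (Fin d) → Euc d → ℂ := fun k => A.indicator fun x =>
    starRingEnd ℂ (w k x) * ((‖w k x‖ ^ (P - 2) * Real.exp (e x) : ℝ) : ℂ)
  have hc0 : ∀ k, ∀ x ∉ A, c k x = 0 := fun k x hx => indicator_of_notMem hx _
  have hcn : ∀ k, ∀ x ∈ A, ‖c k x‖ ≤ ‖w k x‖ ^ (P - 1) * Real.exp (e x) := fun k x hx => by
    change ‖A.indicator _ x‖ ≤ _
    rw [indicator_of_mem hx, norm_mul, Complex.norm_real, RCLike.norm_conj,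
      Real.norm_of_nonneg (by positivity), ← mul_assoc]
    refine mul_le_mul_of_nonneg_right ?_ (Real.exp_pos _).le
    rcases eq_or_ne (w k x) 0 with h | h
    · rw [h, norm_zero, zero_mul]
      exact Real.rpow_nonneg le_rfl _
    · have hpos : 0 < ‖w k x‖ := norm_pos_iff.2 h
      refine le_of_eq ?_
      rw [mul_comm, ← Real.rpow_add_one hpos.ne']
      congr 1; ring
  have hem : AEMeasurable e (volume.restrict K) := (hlθm.const_mul _).add (hl₀m.div_const _)
  have hcm : ∀ k, AEStronglyMeasurable (c k) (volume.restrict K) := fun k => by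
    refine AEMeasurable.aestronglyMeasurable (AEMeasurable.indicator ?_ hA)
    refine ((Complex.continuous_conj.measurable.comp (hwm k)).aemeasurable).mul ?_
    exact Complex.measurable_ofReal.comp_aemeasurable
      (((hwm k).norm.pow_const _).aemeasurable.mul (Real.measurable_exp.comp_aemeasurable hem))
  have heB : ∀ x ∈ K, e x ≤ (B₀ + B₁) + B₀ := fun x hx => by
    refine add_le_add ?_ ?_
    · refine (le_abs_self _).trans ?_
      rw [abs_mul, abs_of_nonneg hP1]
      have : 1 - 1 / P ≤ 1 := by
        have : 0 ≤ 1 / P := by positivity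
        linarith
      calc _ ≤ 1 * |lθ x| := mul_le_mul_of_nonneg_right this (abs_nonneg _)
        _ ≤ _ := by rw [one_mul]; exact hlθ x hx
    · refine (le_abs_self _).trans ?_
      rw [abs_div, abs_of_pos h0]
      exact (div_le_self (abs_nonneg _) hP).trans (hl₀ x hx)
  have hcB : ∀ k, ∀ᵐ x ∂volume.restrict K,
      ‖c k x‖ ≤ (max n 0) ^ (P - 1) * Real.exp ((B₀ + B₁) + B₀) := fun k => by
    filter_upwards [ae_restrict_mem hK.measurableSet] with x hx
    by_cases hxA : x ∈ A
    · refine (hcn k x hxA).trans ?_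
      have h1 : ‖w k x‖ ≤ max n 0 := (hn k x hxA).trans (le_max_left _ _)
      have h2 := heB x hx
      have h3 : 0 ≤ P - 1 := by linarith
      gcongr
    · rw [hc0 k x hxA, norm_zero]; positivity
  choose L hL using fun k => exists_pairing (p := p) (hcm k) (hcB k)
  choose T hT using fun k => exists_restrict_sumSpace (p := p) h₀ h₁ hK hKU k
  let H : ℂ → ℂ := fun z => ∑ k, L k (expMul p ham haB z (T k (f.toFun z)))
  have hH : ∀ z, H z = ∑ k, ∫ x in K, c k x * (Complex.exp (z * a x) * T k (f.toFun z) x) :=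
    fun z => Finset.sum_congr rfl fun k _ => by
      rw [hL]
      refine integral_congr_ae ?_
      filter_upwards [coeFn_expMul ham haB z (T k (f.toFun z))] with x hx
      rw [hx]
  set S : ℝ := ∑ k, ∫ x in A, ‖w k x‖ ^ P * Real.exp (lθ x) with hS
  have hwi : ∀ k, IntegrableOn (fun x => ‖w k x‖ ^ P * Real.exp (lθ x)) A := fun k => by
    refine Integrable.of_bound (C := (max n 0) ^ P * Real.exp (B₀ + B₁)) ?_ ?_
    · refine AEMeasurable.aestronglyMeasurable
        (((hwm k).norm.pow_const _).aemeasurable.mul ?_)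
      exact Real.measurable_exp.comp_aemeasurable
        (hlθm.mono_measure (Measure.restrict_mono hAK le_rfl))
    · filter_upwards [ae_restrict_mem hA] with x hx
      have h1 : ‖w k x‖ ≤ max n 0 := (hn k x hx).trans (le_max_left _ _)
      have h2 := (le_abs_self _).trans (hlθ x (hAK hx))
      rw [Real.norm_of_nonneg (by positivity)]
      gcongr
  -- At `z = θ` the exponents add up to `log ω_θ`, because `l₀ + θ (l₁ - l₀) = lθ`.
  have hHθ : H θ = (S : ℂ) := by
    rw [hH, hS, Complex.ofReal_sum]
    refine Finset.sum_congr rfl fun k _ => ?_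
    rw [← integral_complex_ofReal]
    have e1 : ∫ x in K, c k x * (Complex.exp (θ * a x) * T k (f.toFun θ) x) =
        ∫ x in K, A.indicator (fun x => ((‖w k x‖ ^ P * Real.exp (lθ x) : ℝ) : ℂ)) x := by
      refine integral_congr_ae ?_
      have hTx := hT k x₀
      rw [hx₀] at hTx
      filter_upwards [hTx, ae_restrict_mem hK.measurableSet] with x hx hxK
      by_cases hxA : x ∈ A
      · have ha : a x = (l₁ x - l₀ x) / P := indicator_of_mem hxK _
        have hcx : c k x = starRingEnd ℂ (w k x) *
            ((‖w k x‖ ^ (P - 2) * Real.exp (e x) : ℝ) : ℂ) := indicator_of_mem hxA _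
        have hTw : T k (f.toFun θ) x = w k x := by rw [hx, hw]
        rw [hTw, indicator_of_mem hxA, hcx, ha]
        have hee : Complex.exp ((θ : ℂ) * (((l₁ x - l₀ x) / P : ℝ) : ℂ)) =
            ((Real.exp (θ * ((l₁ x - l₀ x) / P)) : ℝ) : ℂ) := by push_cast; rfl
        have hexp : Real.exp (e x) * Real.exp (θ * ((l₁ x - l₀ x) / P)) = Real.exp (lθ x) := by
          rw [← Real.exp_add]
          congr 1
          simp only [e, lθ]
          field_simp
          ring
        rw [hee]
        have hsq : starRingEnd ℂ (w k x) * w k x = ((‖w k x‖ ^ 2 : ℝ) : ℂ) := by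
          rw [Complex.conj_mul']; push_cast; rfl
        have hpow : ‖w k x‖ ^ 2 * ‖w k x‖ ^ (P - 2) = ‖w k x‖ ^ P := by
          rcases eq_or_ne (w k x) 0 with h | h
          · rw [h, norm_zero, Real.zero_rpow h0.ne']; simp
          · have hpos : 0 < ‖w k x‖ := norm_pos_iff.2 h
            rw [← Real.rpow_natCast, ← Real.rpow_add hpos]
            congr 1; push_cast; ring
        calc _ = (starRingEnd ℂ (w k x) * w k x) * ((‖w k x‖ ^ (P - 2) : ℝ) : ℂ) *
              ((Real.exp (e x) * Real.exp (θ * ((l₁ x - l₀ x) / P)) : ℝ) : ℂ) := by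
              push_cast; ring
          _ = _ := by
              rw [hsq, hexp, ← Complex.ofReal_mul, hpow, ← Complex.ofReal_mul]
      · rw [hc0 k x hxA, indicator_of_notMem hxA, zero_mul]
    rw [e1, setIntegral_indicator hA, inter_eq_right.2 hAK]
  have hbd0 : ∀ t : ℝ, ‖H (t * Complex.I)‖ ≤ 1 / P * f.norm ^ P + (1 - 1 / P) * S := fun t => by
    rw [hH]
    refine (sum_norm_integral_dual_le hp (ω := ω₀) (lθ := lθ) (w := w) hA hAK hAU (f.left t)
      (fun k => ?_) hc0 (fun k x hx => ?_) hwi).trans ?_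
    · rw [f.toFun_left]
      exact restrict_inl hKU (hT k) _
    · have : ‖Complex.exp (t * Complex.I * a x)‖ = 1 := by
        rw [Complex.norm_exp]; simp
      rw [this, mul_one]
      refine (hcn k x hx).trans (le_of_eq ?_)
      simp only [e, l₀]
      rw [Real.exp_add]; ring
    · have h1 : ‖f.left t‖ ≤ f.norm := (f.left.norm_coe_le_norm t).trans (le_max_left _ _)
      gcongr
  have hbd1 : ∀ t : ℝ, ‖H (1 + t * Complex.I)‖ ≤ 1 / P * f.norm ^ P + (1 - 1 / P) * S :=
      fun t => by
    rw [hH]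
    refine (sum_norm_integral_dual_le hp (ω := ω₁) (lθ := lθ) (w := w) hA hAK hAU (f.right t)
      (fun k => ?_) hc0 (fun k x hx => ?_) hwi).trans ?_
    · rw [f.toFun_right]
      exact restrict_inr hKU (hT k) _
    · have ha : a x = (l₁ x - l₀ x) / P := indicator_of_mem (hAK hx) _
      have : ‖Complex.exp ((1 + t * Complex.I) * a x)‖ = Real.exp ((l₁ x - l₀ x) / P) := by
        rw [Complex.norm_exp, ← ha]; simp
      rw [this]
      refine (mul_le_mul_of_nonneg_right (hcn k x hx) (Real.exp_pos _).le).trans (le_of_eq ?_)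
      rw [mul_assoc, ← Real.exp_add, mul_left_comm, ← Real.exp_add]
      congr 2
      simp only [e, l₁]
      ring
    · have h1 : ‖f.right t‖ ≤ f.norm := (f.right.norm_coe_le_norm t).trans (le_max_right _ _)
      gcongr
  have hHc : ContinuousOn H {z : ℂ | 0 ≤ z.re ∧ z.re ≤ 1} := by
    refine continuousOn_finsetSum _ fun k _ => (L k).continuous.comp_continuousOn ?_
    exact (differentiable_expMul ham haB).continuous.continuousOn.clm_apply
      ((T k).continuous.comp_continuousOn f.continuousOn)
  have hHd : DifferentiableOn ℂ H {z : ℂ | 0 < z.re ∧ z.re < 1} := by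
    refine DifferentiableOn.fun_sum fun k _ => (L k).differentiable.comp_differentiableOn ?_
    exact (differentiable_expMul ham haB).differentiableOn.clm_apply
      (f.differentiableOn_comp (isClosed_ker_addMap h₀ h₁) (T k))
  have hHb : ∃ M : ℝ, ∀ z : ℂ, 0 ≤ z.re → z.re ≤ 1 → ‖H z‖ ≤ M := by
    choose M hM using fun k => f.exists_bound_comp (T k)
    refine ⟨∑ k, ‖L k‖ * (Real.exp (B₀ + B₁) * M k), fun z hz hz' => ?_⟩
    refine (norm_sum_le _ _).trans (Finset.sum_le_sum fun k _ => ?_)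
    refine ((L k).le_opNorm _).trans (mul_le_mul_of_nonneg_left ?_ (norm_nonneg _))
    refine (norm_expMul_apply_le ham haB z _).trans ?_
    refine mul_le_mul ?_ (hM k z hz hz') (norm_nonneg _) (Real.exp_pos _).le
    refine Real.exp_le_exp.2 ?_
    rw [abs_of_nonneg hz]
    exact mul_le_of_le_one_left (by positivity) hz'
  have hSle := norm_le_of_bounded_strip hHc hHd hHb hbd0 hbd1 (z := θ) (by simpa using hθ0.le)
    (by simpa using hθ1.le)
  rw [hHθ, Complex.norm_real] at hSle
  -- `S` is a real number, so `(1 - 1/P) S` can be subtracted from both sides.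
  have hSP : S ≤ f.norm ^ P := by
    have h1 : S ≤ 1 / P * f.norm ^ P + (1 - 1 / P) * S := (le_abs_self S).trans hSle
    have h2 : 1 / P * S ≤ 1 / P * f.norm ^ P := by linarith
    exact le_of_mul_le_mul_left h2 (by positivity)
  have hfn : 0 ≤ f.norm := (norm_nonneg f.left).trans (le_max_left _ _)
  rw [ENNReal.ofReal_rpow_of_nonneg hfn h0.le]
  refine le_trans (le_of_eq ?_) (ENNReal.ofReal_le_ofReal hSP)
  rw [hS, ENNReal.ofReal_sum_of_nonneg fun k _ => integral_nonneg fun x => by positivity]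
  refine Finset.sum_congr rfl fun k _ => ?_
  rw [lintegral_enorm_rpow_mul_eq _ hA _ h0.le,
    ofReal_integral_eq_lintegral_ofReal (hwi k) (Eventually.of_forall fun x => by positivity)]
  refine setLIntegral_congr_fun hA fun x hx => ?_
  rw [interp_eq_exp ω₀ ω₁ θ (hAU hx)]

/-- The embedding of `[W^{1,p}(U, ω₀), W^{1,p}(U, ω₁)]_θ` in `W^{1,p}(U, ω_θ)`. -/
theorem exists_sobolev_of_calderonFun (hp : p ≠ ∞) (h₀ : ω₀.CompactlyBounded)
    (h₁ : ω₁.CompactlyBounded) {θ : ℝ} (hθ0 : 0 < θ) (hθ1 : θ < 1)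
    (f : CalderonFun (sobolevIncl ω₀ p) (sobolevIncl ω₁ p)) :
    ∃ w : sobolev (ω₀.interp ω₁ θ) p,
      sobolevIncl _ p w = SumSpace.toAmbient _ _ (f.toFun θ) ∧
      ‖w‖ₑ ≤ ENNReal.ofReal f.norm := by
  have h0 := toReal_pos_of_fact hp
  have hp0 : p ≠ 0 := (zero_lt_one.trans_le (Fact.out : 1 ≤ p)).ne'
  obtain ⟨x₀, hx₀⟩ := Submodule.Quotient.mk_surjective _ (f.toFun (θ : ℂ))
  have hamb : SumSpace.toAmbient _ _ (f.toFun (θ : ℂ)) =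
      sobolevIncl ω₀ p x₀.fst + sobolevIncl ω₁ p x₀.snd :=
    (congrArg (SumSpace.toAmbient _ _) hx₀).symm.trans (toAmbient_mk _ _ x₀)
  obtain ⟨w, hw⟩ : ∃ w : Option (Fin d) → Euc d → ℂ,
    w = fun k y => x₀.fst.1 k y + x₀.snd.1 k y := ⟨_, rfl⟩
  have hwm : ∀ k, Measurable (w k) := fun k => by
    rw [hw]
    exact (Lp.stronglyMeasurable (x₀.fst.1 k)).measurable.add
      (Lp.stronglyMeasurable (x₀.snd.1 k)).measurable
  have hgrad : HasWeakGradient U (w none) fun i => w (some i) := by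
    rw [hw]
    exact (sobolev_hasWeakGradient x₀.fst).add (sobolev_hasWeakGradient x₀.snd)
  obtain ⟨K, hK, hKU, hmono, hU⟩ := exists_compact_exhaustion U
  -- Truncation in space and in height; since `w` is finite everywhere, these sets increase to `U`.
  let A : ℕ → Set (Euc d) := fun n => K n ∩ ⋂ k, {x | ‖w k x‖ ≤ n}
  have hA : ∀ n, MeasurableSet (A n) := fun n => (hK n).measurableSet.inter
    (MeasurableSet.iInter fun k => measurableSet_le (hwm k).norm measurable_const)
  have hAmono : Monotone A := fun m n hmn => inter_subset_inter (hmono hmn)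
    (iInter_mono fun k x hx => le_trans (show ‖w k x‖ ≤ m from hx) (by exact_mod_cast hmn))
  have hAU : (⋃ n, A n) = U := by
    refine Subset.antisymm (iUnion_subset fun n => inter_subset_left.trans (hKU n)) fun x hx => ?_
    rw [← hU] at hx
    obtain ⟨n, hn⟩ := mem_iUnion.1 hx
    obtain ⟨N, hN⟩ := exists_nat_ge (∑ k, ‖w k x‖)
    refine mem_iUnion.2 ⟨max n N, hmono (le_max_left _ _) hn, mem_iInter.2 fun k => ?_⟩
    have h1 : ‖w k x‖ ≤ ∑ k, ‖w k x‖ :=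
      Finset.single_le_sum (f := fun k => ‖w k x‖) (fun _ _ => norm_nonneg _) (Finset.mem_univ k)
    refine (h1.trans hN).trans ?_
    exact_mod_cast le_max_right n N
  have hbound : ∑ k, ∫⁻ x in U, ‖w k x‖ₑ ^ p.toReal * ENNReal.ofReal (ω₀.interp ω₁ θ x) ≤
      ENNReal.ofReal f.norm ^ p.toReal := by
    have ht : Tendsto (fun n => ∑ k, ∫⁻ x in A n,
        ‖w k x‖ₑ ^ p.toReal * ENNReal.ofReal (ω₀.interp ω₁ θ x)) atTop
        (𝓝 (∑ k, ∫⁻ x in U, ‖w k x‖ₑ ^ p.toReal * ENNReal.ofReal (ω₀.interp ω₁ θ x))) := by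
      refine tendsto_finsetSum _ fun k _ => ?_
      -- Monotone convergence, as continuity from below of the measure whose density is the
      -- integrand.
      have h := tendsto_measure_iUnion_atTop (μ := volume.withDensity fun x =>
        ‖w k x‖ₑ ^ p.toReal * ENNReal.ofReal (ω₀.interp ω₁ θ x)) hAmono
      rw [hAU, withDensity_apply _ U.isOpen.measurableSet] at h
      exact h.congr fun n => withDensity_apply _ (hA n)
    refine le_of_tendsto ht (Eventually.of_forall fun n => ?_)
    exact sum_lintegral_le_of_calderonFun hp h₀ h₁ hθ0 hθ1 f hx₀ hw (hK n) (hKU n) (hA n)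
      inter_subset_left fun k x hx => mem_iInter.1 hx.2 k
  have hmem : ∀ k, MemLp (w k) p (ω₀.interp ω₁ θ).measure := fun k => by
    refine ⟨(hwm k).aestronglyMeasurable, ?_⟩
    have h1 := eLpNorm_rpow_weight hp (ω₀.interp ω₁ θ) (hwm k).aestronglyMeasurable
    have h2 : eLpNorm (w k) p (ω₀.interp ω₁ θ).measure ^ p.toReal < ∞ := by
      rw [h1]
      refine ((Finset.single_le_sum (f := fun k => ∫⁻ x in U, ‖w k x‖ₑ ^ p.toReal *
        ENNReal.ofReal (ω₀.interp ω₁ θ x)) (fun _ _ => zero_le) (Finset.mem_univ k)).trans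
        hbound).trans_lt ?_
      exact ENNReal.rpow_lt_top_of_nonneg h0.le ENNReal.ofReal_ne_top
    exact (ENNReal.rpow_lt_top_iff_of_pos h0).1 h2
  obtain ⟨v, hv0, hvi⟩ := exists_sobolev hgrad (hmem none) fun i => hmem (some i)
  have hv : ∀ k, v.1 k =ᵐ[volume.restrict (U : Set (Euc d))] w k := fun k =>
    (ω₀.interp ω₁ θ).absolutelyContinuous.ae_le (by
      cases k with
      | none => exact hv0
      | some i => exact hvi i)
  refine ⟨v, ?_, ?_⟩
  · rw [hamb]
    refine AEEqFun.ext ?_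
    filter_upwards [sobolevIncl_coeFn _ v, hv none,
      AEEqFun.coeFn_add (sobolevIncl ω₀ p x₀.fst) (sobolevIncl ω₁ p x₀.snd),
      sobolevIncl_coeFn ω₀ x₀.fst, sobolevIncl_coeFn ω₁ x₀.snd] with y e1 e2 e3 e4 e5
    rw [e1, e2, e3, Pi.add_apply, e4, e5, hw]
  · refine (ENNReal.rpow_le_rpow_iff h0).1 ?_
    have : ‖v‖ₑ = ‖v.1‖ₑ := rfl
    rw [this, enorm_rpow_eq hp]
    refine le_trans (le_of_eq (Finset.sum_congr rfl fun k _ => lintegral_congr_ae ?_)) hbound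
    filter_upwards [hv k] with x hx
    rw [hx]

end WeightedSobolev

/-! ### Lipschitz functions with compact support -/

namespace WeightedSobolev

/-- Let the support lie in the ball of radius `R`. Compactness gives a constant on the ball of
radius `R + 1`; a point of the support and a point outside that ball are at distance at least 1, so
there the supremum of `‖f‖` is a Lipschitz constant. -/
theorem exists_lipschitzWith_of_hasCompactSupport {E F : Type*} [NormedAddCommGroup E]
    [NormedSpace ℝ E] [FiniteDimensional ℝ E] [NormedAddCommGroup F] {f : E → F}
    (hf : LocallyLipschitz f) (hc : HasCompactSupport f) : ∃ C : ℝ≥0, LipschitzWith C f := by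
  have : ProperSpace E := FiniteDimensional.proper ℝ E
  obtain ⟨R, hR⟩ := hc.isBounded.subset_closedBall 0
  obtain ⟨M, hM⟩ := hc.exists_bound_of_continuous hf.continuous
  have hM0 : 0 ≤ M := (norm_nonneg _).trans (hM 0)
  obtain ⟨C, hC⟩ :=
    (hf.locallyLipschitzOn (s := Metric.closedBall 0 (R + 1))).exists_lipschitzOnWith_of_compact
    (isCompact_closedBall 0 (R + 1))
  have key : ∀ x y, x ∈ tsupport f → dist (f x) (f y) ≤ (max C M.toNNReal : ℝ≥0) * dist x y := by
    intro x y hx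
    have hxR : x ∈ Metric.closedBall 0 (R + 1) := Metric.closedBall_subset_closedBall (by linarith)
      (hR hx)
    by_cases hy : y ∈ Metric.closedBall 0 (R + 1)
    · refine (hC.dist_le_mul x hxR y hy).trans ?_
      gcongr
      exact_mod_cast le_max_left _ _
    · have hfy : f y = 0 := image_eq_zero_of_notMem_tsupport fun h =>
        hy (Metric.closedBall_subset_closedBall (by linarith) (hR h))
      have h1 : 1 ≤ dist x y := by
        have hx' := hR hx
        rw [mem_closedBall_zero_iff] at hx' hy
        rw [dist_comm, dist_eq_norm]
        linarith [norm_sub_norm_le y x]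
      rw [hfy, dist_zero_right]
      calc ‖f x‖ ≤ M * 1 := by simpa using hM x
        _ ≤ (max C M.toNNReal : ℝ≥0) * dist x y := by
          gcongr
          exact (Real.le_coe_toNNReal M).trans (by exact_mod_cast le_max_right _ _)
  refine ⟨max C M.toNNReal, LipschitzWith.of_dist_le_mul fun x y => ?_⟩
  by_cases hx : x ∈ tsupport f
  · exact key x y hx
  by_cases hy : y ∈ tsupport f
  · rw [dist_comm, dist_comm x]; exact key y x hy
  · rw [image_eq_zero_of_notMem_tsupport hx, image_eq_zero_of_notMem_tsupport hy, dist_self]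
    positivity

/-- Functions in `Lip_c(U)` are only assumed Lipschitz on `U`; near a point outside `U` they vanish
identically. -/
theorem locallyLipschitz_of_lipschitzOnWith {E F : Type*} [PseudoEMetricSpace E]
    [NormedAddCommGroup F] {U : Set E} (hU : IsOpen U) {f : E → F} {L : ℝ≥0}
    (hf : LipschitzOnWith L f U) (hs : tsupport f ⊆ U) : LocallyLipschitz f := by
  intro x
  by_cases hx : x ∈ U
  · exact ⟨L, U, hU.mem_nhds hx, hf⟩
  · refine ⟨0, (tsupport f)ᶜ, (isClosed_tsupport f).isOpen_compl.mem_nhds fun h => hx (hs h), ?_⟩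
    intro y hy z hz
    rw [image_eq_zero_of_notMem_tsupport hy, image_eq_zero_of_notMem_tsupport hz]
    simp

variable {d : ℕ} {U : Opens (Euc d)} {p : ℝ≥0∞}

theorem measurable_fderiv_single {F : Type*} [NormedAddCommGroup F] [NormedSpace ℝ F]
    [CompleteSpace F] [MeasurableSpace F] [BorelSpace F] (g : Euc d → F) (i : Fin d) :
    Measurable fun x => fderiv ℝ g x (EuclideanSpace.single i 1) :=
  measurable_fderiv_apply_const ℝ g _

theorem norm_fderiv_single_le {F : Type*} [NormedAddCommGroup F] [NormedSpace ℝ F]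
    {g : Euc d → F} {C : ℝ≥0} (hg : LipschitzWith C g) (i : Fin d) (x : Euc d) :
    ‖fderiv ℝ g x (EuclideanSpace.single i 1)‖ ≤ C := by
  refine ((fderiv ℝ g x).le_opNorm _).trans ?_
  rw [PiLp.norm_single, norm_one, mul_one]
  exact norm_fderiv_le_of_lipschitz ℝ hg

/-- Integration by parts for line derivatives of Lipschitz functions, which by Rademacher's theorem
agree almost everywhere with the Fréchet derivative. -/
theorem integral_mul_fderiv_of_lipschitz {g ψ : Euc d → ℝ} {C : ℝ≥0} (hg : LipschitzWith C g)
    (hψ : ContDiff ℝ (⊤ : ℕ∞) ψ) (hc : HasCompactSupport ψ) (v : Euc d) :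
    ∫ x, fderiv ℝ ψ x v * g x = - ∫ x, ψ x * fderiv ℝ g x v := by
  obtain ⟨D, hD⟩ := ContDiff.lipschitzWith_of_hasCompactSupport hc hψ (by simp)
  have h := hg.integral_lineDeriv_mul_eq (μ := volume) hD hc v
  have e1 : ∫ x, lineDeriv ℝ g x v * ψ x = ∫ x, ψ x * fderiv ℝ g x v := by
    refine integral_congr_ae ?_
    filter_upwards [hg.ae_differentiableAt] with x hx
    rw [hx.lineDeriv_eq_fderiv, mul_comm]
  have e2 : ∫ x, lineDeriv ℝ ψ x (-v) * g x = - ∫ x, fderiv ℝ ψ x v * g x := by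
    rw [← integral_neg]
    refine integral_congr_ae (Eventually.of_forall fun x => ?_)
    change lineDeriv ℝ ψ x (-v) * g x = -(fderiv ℝ ψ x v * g x)
    rw [((hψ.differentiable (by simp)) x).lineDeriv_eq_fderiv, map_neg, neg_mul]
  rw [← e1, h, e2, neg_neg]

/-- The classical gradient of a Lipschitz function is its weak gradient. -/
theorem hasWeakGradient_of_lipschitz (U : Opens (Euc d)) {g : Euc d → ℂ} {C : ℝ≥0}
    (hg : LipschitzWith C g) :
    HasWeakGradient U g fun i x => fderiv ℝ g x (EuclideanSpace.single i 1) := by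
  have hgi : ∀ K : Set (Euc d), IsCompact K → IntegrableOn g K := fun K hK =>
    hg.continuous.continuousOn.integrableOn_compact hK
  have hGi : ∀ i, ∀ K : Set (Euc d), IsCompact K →
      IntegrableOn (fun x => fderiv ℝ g x (EuclideanSpace.single i 1)) K := fun i K hK => by
    refine Measure.integrableOn_of_bounded (M := C) hK.measure_lt_top.ne
      (measurable_fderiv_single g i).aestronglyMeasurable
      (Eventually.of_forall fun x => norm_fderiv_single_le hg i x)
  refine ⟨fun K hK _ => hgi K hK, fun i K hK _ => hGi i K hK, fun i ψ hψ hc hs => ?_⟩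
  have hdψ : ∀ x ∉ tsupport ψ, fderiv ℝ ψ x (EuclideanSpace.single i 1) = 0 := fun x hx => by
    simp [fderiv_of_notMem_tsupport (𝕜 := ℝ) hx]
  have hcd : Continuous fun x => fderiv ℝ ψ x (EuclideanSpace.single i 1) :=
    (hψ.continuous_fderiv (by simp)).clm_apply continuous_const
  have hψ0 : ∀ x ∉ tsupport ψ, ψ x = 0 := fun x hx => image_eq_zero_of_notMem_tsupport hx
  have i1 : Integrable fun x => fderiv ℝ ψ x (EuclideanSpace.single i 1) • g x := by
    simpa using integrableOn_smul_of_support (U := ⊤) (fun K hK _ => hgi K hK) hcd hc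
      (subset_univ _) hdψ
  have i2 : Integrable fun x => ψ x • fderiv ℝ g x (EuclideanSpace.single i 1) := by
    simpa using integrableOn_smul_of_support (U := ⊤) (fun K hK _ => hGi i K hK) hψ.continuous hc
      (subset_univ _) hψ0
  rw [setIntegral_eq_integral_of_forall_compl_eq_zero
      fun x hx => by rw [hdψ x fun h => hx (hs h), zero_smul],
    setIntegral_eq_integral_of_forall_compl_eq_zero
      fun x hx => by rw [hψ0 x fun h => hx (hs h), zero_smul]]
  -- Reduction to real-valued functions; `ℓ` will be the real and the imaginary part.
  have key : ∀ (ℓ : ℂ →L[ℝ] ℝ) {D : ℝ≥0}, LipschitzWith D ℓ →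
      ℓ (∫ x, fderiv ℝ ψ x (EuclideanSpace.single i 1) • g x) =
      ℓ (- ∫ x, ψ x • fderiv ℝ g x (EuclideanSpace.single i 1)) := fun ℓ D hℓ => by
    rw [map_neg, ← ℓ.integral_comp_comm i1, ← ℓ.integral_comp_comm i2]
    have h := integral_mul_fderiv_of_lipschitz (hℓ.comp hg) hψ hc (EuclideanSpace.single i 1)
    simp only [map_smul, smul_eq_mul]
    refine h.trans (congrArg Neg.neg (integral_congr_ae ?_))
    filter_upwards [hg.ae_differentiableAt] with x hx
    rw [(ℓ.hasFDerivAt.comp x hx.hasFDerivAt).fderiv]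
    rfl
  exact Complex.ext (key Complex.reCLM Complex.reCLM.lipschitz)
    (key Complex.imCLM Complex.imCLM.lipschitz)

theorem memLp_of_bounded_of_support {ω : Weight U} (hω : ω.CompactlyBounded)
    {K : Set (Euc d)} (hK : IsCompact K) (hKU : K ⊆ U) {g : Euc d → ℂ} (hg : Measurable g)
    {C : ℝ} (hC : ∀ x, ‖g x‖ ≤ C) (hgK : ∀ x ∉ K, g x = 0) : MemLp g p ω.measure := by
  have hfin : ω.measure K < ∞ := by
    obtain ⟨m, M, hm, h⟩ := hω K hK hKU
    rw [Weight.measure, withDensity_apply _ hK.measurableSet,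
      Measure.restrict_restrict hK.measurableSet, inter_eq_left.2 hKU]
    refine (setLIntegral_mono' hK.measurableSet
      fun x hx => ENNReal.ofReal_le_ofReal (h x hx).2).trans_lt ?_
    rw [setLIntegral_const]
    exact ENNReal.mul_lt_top ENNReal.ofReal_lt_top hK.measure_lt_top
  have : IsFiniteMeasure (ω.measure.restrict K) := ⟨by simpa using hfin⟩
  have e : g = K.indicator g := by
    funext x
    by_cases hx : x ∈ K
    · rw [indicator_of_mem hx]
    · rw [indicator_of_notMem hx, hgK x hx]
  rw [e, memLp_indicator_iff_restrict hK.measurableSet]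
  exact MemLp.of_bound hg.aestronglyMeasurable C (Eventually.of_forall hC)

/-- A bounded Lipschitz function on the whole space that agrees with `log r_ω` near a given
compact set. -/
theorem exists_lipschitz_log_ratio {ω₀ ω₁ : Weight U} (h₀ : ω₀.CompactlyBounded)
    (h₁ : ω₁.CompactlyBounded) (hr : LocLipschitz U (weightRatio ω₀ ω₁)) {K : Set (Euc d)}
    (hK : IsCompact K) (hKU : K ⊆ U) :
    ∃ (a : Euc d → ℝ) (C : ℝ≥0) (A : ℝ) (V : Set (Euc d)), LipschitzWith C a ∧ 0 ≤ A ∧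
      (∀ x, |a x| ≤ A) ∧ IsOpen V ∧ K ⊆ V ∧ V ⊆ U ∧
      ∀ x ∈ V, a x = Real.log (weightRatio ω₀ ω₁ x) := by
  -- Agreement on the open set `interior L ⊇ K`, not just on `K`, is what lets gradients be compared
  -- on `K`.
  obtain ⟨L, hL, hKL, hLU⟩ := exists_compact_between hK U.isOpen hKU
  obtain ⟨m₀, M₀, hm₀, hb₀⟩ := h₀ L hL hLU
  obtain ⟨m₁, M₁, hm₁, hb₁⟩ := h₁ L hL hLU
  obtain ⟨C, hC⟩ := hr L hL hLU
  obtain ⟨B₀, hB₀, hl₀⟩ := h₀.exists_abs_log_le hL hLU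
  obtain ⟨B₁, hB₁, hl₁⟩ := h₁.exists_abs_log_le hL hLU
  set r := weightRatio ω₀ ω₁ with hrdef
  -- A lower bound for `r` on `L`, keeping its logarithm Lipschitz. The maximum with 1 ensures
  -- positivity even if `L` is empty and `M₁` is arbitrary.
  set m := m₀ / max M₁ 1 with hm
  have hmpos : 0 < m := by positivity
  have hrm : ∀ x ∈ L, m ≤ r x := fun x hx => by
    have h1 := hb₁ x hx
    have h0 := hb₀ x hx
    exact div_le_div₀ (hm₀.le.trans h0.1) h0.1 (ω₁.pos x (hLU hx)) (h1.2.trans (le_max_left _ _))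
  have hlog : LipschitzOnWith ((Real.toNNReal m⁻¹) * C) (fun x => Real.log (r x)) L := by
    have h1 : LipschitzOnWith (Real.toNNReal m⁻¹) Real.log (Ici m) := by
      refine LipschitzOnWith.of_dist_le_mul fun x hx y hy => ?_
      have hle : ∀ x ∈ Ici m, ∀ y ∈ Ici m, Real.log x - Real.log y ≤ m⁻¹ * |x - y| := by
        intro x hx y hy
        have hx0 : 0 < x := hmpos.trans_le hx
        have hy0 : 0 < y := hmpos.trans_le hy
        rw [← Real.log_div hx0.ne' hy0.ne']
        refine (Real.log_le_sub_one_of_pos (div_pos hx0 hy0)).trans ?_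
        have : x / y - 1 = y⁻¹ * (x - y) := by field_simp
        rw [this]
        refine (mul_le_mul_of_nonneg_left (le_abs_self _) (inv_pos.2 hy0).le).trans ?_
        exact mul_le_mul_of_nonneg_right ((inv_le_inv₀ hy0 hmpos).2 hy) (abs_nonneg _)
      rw [Real.dist_eq, Real.dist_eq, Real.coe_toNNReal _ (inv_pos.2 hmpos).le]
      refine abs_sub_le_iff.2 ⟨hle x hx y hy, ?_⟩
      rw [abs_sub_comm]
      exact hle y hy x hx
    exact h1.comp hC fun x hx => hrm x hx
  -- Extend `log r` from `L` to a Lipschitz function on the whole space, then clamp to `[-(B₀ + B₁),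
  -- B₀ + B₁]`, which changes nothing on `L`.
  obtain ⟨b, hb, hbe⟩ := hlog.extend_real
  refine ⟨fun x => max (min (b x) (B₀ + B₁)) (-(B₀ + B₁)), _, B₀ + B₁, interior L,
    (hb.min_const _).max_const _, by positivity, fun x => ?_, isOpen_interior, hKL,
    interior_subset.trans hLU, fun x hx => ?_⟩
  · refine abs_le.2 ⟨le_max_right _ _, max_le (min_le_right _ _) (by linarith)⟩
  · have hxL := interior_subset hx
    have hbx : b x = Real.log (r x) := (hbe hxL).symm
    have hlr : |Real.log (r x)| ≤ B₀ + B₁ := by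
      have : Real.log (r x) = Real.log (ω₀ x) - Real.log (ω₁ x) :=
        Real.log_div (ω₀.pos x (hLU hxL)).ne' (ω₁.pos x (hLU hxL)).ne'
      rw [this]
      refine (abs_sub _ _).trans (add_le_add (hl₀ x hxL) (hl₁ x hxL))
    obtain ⟨hl, hu⟩ := abs_le.1 hlr
    change max (min (b x) (B₀ + B₁)) (-(B₀ + B₁)) = _
    rw [hbx, min_eq_left hu, max_eq_left hl]

/-! ### The analytic family `exp (ζ a) g` -/

/-- The pair `(g, ∇g)`. -/
def withGrad (g : Euc d → ℂ) (k : Option (Fin d)) : Euc d → ℂ :=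
  k.elim g fun i x => fderiv ℝ g x (EuclideanSpace.single i 1)

/-- The pair `(0, g ∇a)`. -/
def smulGrad (a : Euc d → ℝ) (g : Euc d → ℂ) (k : Option (Fin d)) : Euc d → ℂ :=
  k.elim 0 fun i x => g x * (fderiv ℝ a x (EuclideanSpace.single i 1) : ℝ)

section Family

variable {g : Euc d → ℂ} {Cg : ℝ≥0} {a : Euc d → ℝ} {Ca : ℝ≥0} {A : ℝ}

theorem withGrad_eq_zero {x : Euc d} (hx : x ∉ tsupport g) (k : Option (Fin d)) :
    withGrad g k x = 0 := by
  cases k with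
  | none => exact image_eq_zero_of_notMem_tsupport hx
  | some i =>
    change fderiv ℝ g x (EuclideanSpace.single i 1) = 0
    simp [fderiv_of_notMem_tsupport (𝕜 := ℝ) hx]

theorem smulGrad_eq_zero {x : Euc d} (hx : x ∉ tsupport g) (k : Option (Fin d)) :
    smulGrad a g k x = 0 := by
  cases k with
  | none => rfl
  | some i =>
    change g x * _ = 0
    rw [image_eq_zero_of_notMem_tsupport hx, zero_mul]

theorem measurable_withGrad (hg : LipschitzWith Cg g) (k : Option (Fin d)) :
    Measurable (withGrad g k) := by
  cases k with
  | none => exact hg.continuous.measurable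
  | some i => exact measurable_fderiv_single g i

theorem measurable_smulGrad (hg : LipschitzWith Cg g) (k : Option (Fin d)) :
    Measurable (smulGrad a g k) := by
  cases k with
  | none => exact measurable_const
  | some i =>
    have h := Complex.measurable_ofReal.comp (measurable_fderiv_single a i)
    exact hg.continuous.measurable.mul h

theorem memLp_withGrad {ω : Weight U} (hω : ω.CompactlyBounded) (hg : LipschitzWith Cg g)
    (hc : HasCompactSupport g) (hs : tsupport g ⊆ U) (k : Option (Fin d)) :
    MemLp (withGrad g k) p ω.measure := by
  obtain ⟨M, hM⟩ := hc.exists_bound_of_continuous hg.continuous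
  refine memLp_of_bounded_of_support hω hc hs (measurable_withGrad hg k) (C := max M Cg)
    (fun x => ?_) fun x hx => withGrad_eq_zero hx k
  cases k with
  | none => exact (hM x).trans (le_max_left _ _)
  | some i => exact (norm_fderiv_single_le hg i x).trans (le_max_right _ _)

theorem memLp_smulGrad {ω : Weight U} (hω : ω.CompactlyBounded) (hg : LipschitzWith Cg g)
    (hc : HasCompactSupport g) (hs : tsupport g ⊆ U) (ha : LipschitzWith Ca a)
    (k : Option (Fin d)) : MemLp (smulGrad a g k) p ω.measure := by
  obtain ⟨M, hM⟩ := hc.exists_bound_of_continuous hg.continuous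
  have hM0 : 0 ≤ M := (norm_nonneg _).trans (hM 0)
  refine memLp_of_bounded_of_support hω hc hs (measurable_smulGrad hg k) (C := M * Ca)
    (fun x => ?_) fun x hx => smulGrad_eq_zero hx k
  cases k with
  | none => change ‖(0 : ℂ)‖ ≤ _; rw [norm_zero]; positivity
  | some i =>
    change ‖g x * _‖ ≤ _
    rw [norm_mul, Complex.norm_real]
    exact mul_le_mul (hM x) (norm_fderiv_single_le ha i x) (norm_nonneg _) hM0

theorem hasCompactSupport_exp_mul (hc : HasCompactSupport g) (ζ : ℂ) :
    HasCompactSupport fun x => Complex.exp (ζ * a x) * g x :=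
  hc.mul_left (f := fun x => Complex.exp (ζ * a x))

theorem tsupport_exp_mul_subset (ζ : ℂ) :
    tsupport (fun x => Complex.exp (ζ * a x) * g x) ⊆ tsupport g :=
  closure_mono (Function.support_mul_subset_right _ _)

theorem exists_lipschitzWith_exp_mul (hg : LipschitzWith Cg g) (hc : HasCompactSupport g)
    (ha : LipschitzWith Ca a) (ζ : ℂ) :
    ∃ C : ℝ≥0, LipschitzWith C fun x => Complex.exp (ζ * a x) * g x := by
  refine exists_lipschitzWith_of_hasCompactSupport ?_ (hasCompactSupport_exp_mul hc ζ)
  have h : ContDiff ℝ 1 fun q : ℝ × ℂ => Complex.exp (ζ * q.1) * q.2 := by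
    refine ContDiff.mul ?_ contDiff_snd
    refine ContDiff.cexp (contDiff_const.mul ?_)
    exact Complex.ofRealCLM.contDiff.comp contDiff_fst
  have h' : LocallyLipschitz fun x => (a x, g x) := (ha.prodMk hg).locallyLipschitz
  have h'' := h.locallyLipschitz.comp h'
  exact h''

/-- Product and chain rule at the points where `g` and `a` are both differentiable, which are almost
all by Rademacher. The factor `ζ` is the source of the growth along vertical lines. -/
theorem ae_withGrad_exp_mul (hg : LipschitzWith Cg g) (ha : LipschitzWith Ca a) (ζ : ℂ)
    (k : Option (Fin d)) :
    ∀ᵐ x, withGrad (fun x => Complex.exp (ζ * a x) * g x) k x =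
      Complex.exp (ζ * a x) * (withGrad g k x + ζ * smulGrad a g k x) := by
  cases k with
  | none =>
    refine Eventually.of_forall fun x => ?_
    change _ = Complex.exp (ζ * a x) * (g x + ζ * 0)
    rw [mul_zero, add_zero]
    rfl
  | some i =>
    filter_upwards [hg.ae_differentiableAt, ha.ae_differentiableAt] with x h1 h2
    have h3 : HasFDerivAt (fun x => ((a x : ℝ) : ℂ)) (Complex.ofRealCLM ∘L fderiv ℝ a x) x :=
      Complex.ofRealCLM.hasFDerivAt.comp x h2.hasFDerivAt
    have h4 : HasFDerivAt (fun x => Complex.exp (ζ * a x) * g x) _ x :=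
      ((h3.const_mul ζ).cexp).mul h1.hasFDerivAt
    change fderiv ℝ _ x _ = Complex.exp (ζ * a x) *
      (fderiv ℝ g x _ + ζ * (g x * (fderiv ℝ a x _ : ℝ)))
    rw [h4.fderiv]
    simp
    ring

variable [Fact (1 ≤ p)]

/-- The analytic family `ζ ↦ exp (ζ a) g` in `W₀^{1,p}(U, ω)`. -/
theorem exists_family {ω : Weight U} (hω : ω.CompactlyBounded) (hg : LipschitzWith Cg g)
    (hc : HasCompactSupport g) (hs : tsupport g ⊆ U) (ha : LipschitzWith Ca a)
    (hA : ∀ x, |a x| ≤ A) :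
    ∃ S : ℂ → sobolev₀ ω p, Differentiable ℂ S ∧
      (∀ ζ, sobolev₀Incl ω p (S ζ) =ᵐ[volume.restrict (U : Set (Euc d))]
        fun x => Complex.exp (ζ * a x) * g x) ∧
      (∃ c : ℝ, ∀ ζ, ‖S ζ‖ ≤ Real.exp (|ζ.re| * A) * (c * (1 + ‖ζ‖))) ∧
      ∀ ζ, ∃ X Y : PiLp p fun _ : Option (Fin d) => Lp ℂ p ω.measure,
        ‖S ζ‖ₑ ≤ ‖X‖ₑ + ‖ζ‖ₑ * ‖Y‖ₑ ∧
        (∀ k, X k =ᵐ[ω.measure] fun x => Complex.exp (ζ * a x) * withGrad g k x) ∧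
        ∀ k, Y k =ᵐ[ω.measure] fun x => Complex.exp (ζ * a x) * smulGrad a g k x := by
  have hmP := memLp_withGrad (p := p) hω hg hc hs
  have hmQ := memLp_smulGrad (p := p) hω hg hc hs ha
  have ham : AEStronglyMeasurable a ω.measure := ha.continuous.aestronglyMeasurable
  let M : ℂ → Lp ℂ p ω.measure →L[ℂ] Lp ℂ p ω.measure := expMul p ham hA
  let X : ℂ → PiLp p fun _ : Option (Fin d) => Lp ℂ p ω.measure := fun ζ =>
    WithLp.toLp p fun k => M ζ ((hmP k).toLp _)
  let Y : ℂ → PiLp p fun _ : Option (Fin d) => Lp ℂ p ω.measure := fun ζ =>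
    WithLp.toLp p fun k => M ζ ((hmQ k).toLp _)
  have hX : ∀ ζ k, X ζ k =ᵐ[ω.measure] fun x => Complex.exp (ζ * a x) * withGrad g k x :=
    fun ζ k => (coeFn_expMul ham hA ζ _).trans (by
      filter_upwards [(hmP k).coeFn_toLp] with x hx; rw [hx])
  have hY : ∀ ζ k, Y ζ k =ᵐ[ω.measure] fun x => Complex.exp (ζ * a x) * smulGrad a g k x :=
    fun ζ k => (coeFn_expMul ham hA ζ _).trans (by
      filter_upwards [(hmQ k).coeFn_toLp] with x hx; rw [hx])
  have hac : ω.measure ≪ volume :=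
    (measure_absolutelyContinuous ω).trans Measure.absolutelyContinuous_restrict
  have hXY : ∀ ζ k, (X ζ + ζ • Y ζ) k =ᵐ[ω.measure]
      withGrad (fun x => Complex.exp (ζ * a x) * g x) k := fun ζ k => by
    have e : (X ζ + ζ • Y ζ) k = X ζ k + ζ • Y ζ k := rfl
    rw [e]
    filter_upwards [Lp.coeFn_add (X ζ k) (ζ • Y ζ k), Lp.coeFn_smul ζ (Y ζ k), hX ζ k, hY ζ k,
      hac.ae_le (ae_withGrad_exp_mul hg ha ζ k)] with x h1 h2 h3 h4 h5
    rw [h1, Pi.add_apply, h2, Pi.smul_apply, h3, h4, h5, smul_eq_mul]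
    ring
  -- `exp (ζ a) g` is itself Lipschitz with compact support, so no approximation is needed.
  have hmem : ∀ ζ, X ζ + ζ • Y ζ ∈ sobolev₀ ω p := fun ζ => by
    obtain ⟨C, hC⟩ := exists_lipschitzWith_exp_mul hg hc ha ζ
    have hs : X ζ + ζ • Y ζ ∈ sobolev ω p :=
      (hasWeakGradient_of_lipschitz U hC).congr
        (ω.absolutelyContinuous.ae_le (hXY ζ none).symm)
        fun i => ω.absolutelyContinuous.ae_le (hXY ζ (some i)).symm
    refine Submodule.mem_map.2 ⟨⟨_, hs⟩, Submodule.le_topologicalClosure _ ?_, rfl⟩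
    refine ⟨fun x => Complex.exp (ζ * a x) * g x, ⟨C, hC.lipschitzOnWith⟩,
      hasCompactSupport_exp_mul hc ζ, (tsupport_exp_mul_subset ζ).trans ‹_›, ?_⟩
    exact (sobolevIncl_coeFn ω _).trans (ω.absolutelyContinuous.ae_le (hXY ζ none))
  have hMd : Differentiable ℂ M := differentiable_expMul ham hA
  have hXd : Differentiable ℂ X := (differentiable_piLp p).2 fun k =>
    hMd.clm_apply (differentiable_const _)
  have hYd : Differentiable ℂ Y := (differentiable_piLp p).2 fun k =>
    hMd.clm_apply (differentiable_const _)
  refine ⟨fun ζ => ⟨X ζ + ζ • Y ζ, hmem ζ⟩, ?_, fun ζ => ?_, ?_, fun ζ =>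
    ⟨X ζ, Y ζ, ?_, hX ζ, hY ζ⟩⟩
  · exact differentiable_of_differentiable_coe (isClosed_sobolev₀ hω)
      (hXd.add (differentiable_id.smul hYd))
  · exact (AEEqFun.coeFn_mk _ _).trans (ω.absolutelyContinuous.ae_le (hXY ζ none))
  -- A crude bound, used only to see that the family is bounded on the strip; it does not enter the
  -- constant.
  · have hb : ∀ (h : ∀ _ : Option (Fin d), Lp ℂ p ω.measure) (ζ : ℂ),
        ‖(WithLp.toLp p fun k => M ζ (h k) : PiLp p fun _ : Option (Fin d) => Lp ℂ p ω.measure)‖ ≤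
          Real.exp (|ζ.re| * A) * ∑ k, ‖h k‖ := fun h ζ => by
      have e : (WithLp.toLp p fun k => M ζ (h k) :
          PiLp p fun _ : Option (Fin d) => Lp ℂ p ω.measure) =
          ∑ k, PiLp.single p k (M ζ (h k)) := by
        refine PiLp.ext fun k => ?_
        cases k <;> simp [Finset.sum_apply, WithLp.ofLp_sum, Pi.single_apply]
      rw [e, Finset.mul_sum]
      refine (norm_sum_le _ _).trans (Finset.sum_le_sum fun k _ => ?_)
      rw [PiLp.norm_single]
      exact norm_expMul_apply_le ham hA ζ _
    refine ⟨max (∑ k, ‖(hmP k).toLp _‖) (∑ k, ‖(hmQ k).toLp _‖), fun ζ => ?_⟩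
    change ‖X ζ + ζ • Y ζ‖ ≤ _
    refine (norm_add_le _ _).trans ?_
    rw [norm_smul]
    calc ‖X ζ‖ + ‖ζ‖ * ‖Y ζ‖ ≤ Real.exp (|ζ.re| * A) * (∑ k, ‖(hmP k).toLp _‖) +
          ‖ζ‖ * (Real.exp (|ζ.re| * A) * (∑ k, ‖(hmQ k).toLp _‖)) := by
          gcongr
          · exact hb _ ζ
          · exact hb _ ζ
      _ = Real.exp (|ζ.re| * A) * ((∑ k, ‖(hmP k).toLp _‖) + ‖ζ‖ * ∑ k, ‖(hmQ k).toLp _‖) := by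
          ring
      _ ≤ _ := by
          gcongr
          rw [mul_add, mul_one, mul_comm _ ‖ζ‖]
          gcongr
          · exact le_max_left _ _
          · exact le_max_right _ _
  · change ‖X ζ + ζ • Y ζ‖ₑ ≤ _
    refine (enorm_add_le _ _).trans ?_
    rw [enorm_smul]

end Family

end WeightedSobolev

/-! ### Interpolation of Lipschitz functions with compact support -/

namespace WeightedSobolev

open ComplexInterpolation

/-- With `y = |im z|` the Gaussian is at most `e · e^(-y²)` and the other factor at most `2 + y ≤ 3
(1 + y²)`. Now `(1 + y²) e^(-y²) ≤ 1` and `e ≤ 3` give 9. -/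
theorem norm_gauss_mul_le {θ P : ℝ} (hθ0 : 0 < θ) (hθ1 : θ < 1) (hP : 1 ≤ P) {z : ℂ}
    (hz : 0 ≤ z.re) (hz' : z.re ≤ 1) :
    ‖Complex.exp (z ^ 2 - (θ : ℂ) ^ 2)‖ * (1 + ‖(z - θ) / (P : ℂ)‖) ≤ 9 := by
  set y := |z.im| with hy
  have hy0 : 0 ≤ y := abs_nonneg _
  have h1 : ‖Complex.exp (z ^ 2 - (θ : ℂ) ^ 2)‖ ≤ Real.exp 1 * Real.exp (-y ^ 2) := by
    rw [Complex.norm_exp, ← Real.exp_add]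
    refine Real.exp_le_exp.2 ?_
    have : (z ^ 2 - (θ : ℂ) ^ 2).re = z.re ^ 2 - z.im ^ 2 - θ ^ 2 := by
      simp [pow_two]
    rw [this, hy, sq_abs]
    nlinarith [sq_nonneg θ]
  have h2 : ‖(z - θ) / (P : ℂ)‖ ≤ 1 + y := by
    rw [norm_div, Complex.norm_real, Real.norm_of_nonneg (by linarith)]
    refine (div_le_self (norm_nonneg _) hP).trans ?_
    refine (Complex.norm_le_abs_re_add_abs_im _).trans ?_
    have e1 : (z - θ).re = z.re - θ := by simp
    have e2 : (z - θ).im = z.im := by simp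
    rw [e1, e2]
    refine add_le_add (abs_le.2 ⟨by linarith, by linarith⟩) le_rfl
  have h3 : Real.exp (-y ^ 2) * (1 + y ^ 2) ≤ 1 := by
    have := Real.add_one_le_exp (y ^ 2)
    calc Real.exp (-y ^ 2) * (1 + y ^ 2) ≤ Real.exp (-y ^ 2) * Real.exp (y ^ 2) := by
          gcongr; linarith
      _ = 1 := by rw [← Real.exp_add]; simp
  have h4 : Real.exp 1 ≤ 3 := by linarith [Real.exp_one_lt_d9]
  have h5 : 1 + (1 + y) ≤ 3 * (1 + y ^ 2) := by nlinarith [sq_nonneg (y - 1 / 2)]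
  calc _ ≤ Real.exp 1 * Real.exp (-y ^ 2) * (1 + (1 + y)) := by gcongr
    _ ≤ Real.exp 1 * Real.exp (-y ^ 2) * (3 * (1 + y ^ 2)) := by gcongr
    _ = 3 * Real.exp 1 * (Real.exp (-y ^ 2) * (1 + y ^ 2)) := by ring
    _ ≤ 3 * 3 * 1 := by gcongr
    _ = 9 := by norm_num

variable {d : ℕ} {U : Opens (Euc d)} {p : ℝ≥0∞} [Fact (1 ≤ p)]

/-- The modulus of the multiplier is absorbed into the weight. The weights need to match only on
`K`, outside which the integrand vanishes. -/
theorem enorm_rpow_eq_of_exp_mul (hp : p ≠ ∞) {ω ω' : Weight U} {ζ : ℂ} {a : Euc d → ℝ}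
    {K : Set (Euc d)} {h : Option (Fin d) → Euc d → ℂ} (hK : ∀ k, ∀ x ∉ K, h k x = 0)
    (hω : ∀ x ∈ K, ‖Complex.exp (ζ * a x)‖ ^ p.toReal * ω x = ω' x)
    {X : PiLp p fun _ : Option (Fin d) => Lp ℂ p ω.measure}
    (hX : ∀ k, X k =ᵐ[ω.measure] fun x => Complex.exp (ζ * a x) * h k x) :
    ‖X‖ₑ ^ p.toReal = ∑ k, ∫⁻ x in U, ‖h k x‖ₑ ^ p.toReal * ENNReal.ofReal (ω' x) := by
  have h0 := toReal_pos_of_fact hp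
  rw [enorm_rpow_eq hp]
  refine Finset.sum_congr rfl fun k _ => lintegral_congr_ae ?_
  filter_upwards [ω.absolutelyContinuous.ae_le (hX k)] with x hx
  rw [hx]
  by_cases hxK : x ∈ K
  · rw [← hω x hxK, ENNReal.ofReal_mul (by positivity), enorm_mul,
      ENNReal.mul_rpow_of_nonneg _ _ h0.le, ← ENNReal.ofReal_rpow_of_nonneg (norm_nonneg _) h0.le,
      ofReal_norm]
    ring
  · rw [hK k x hxK, mul_zero, enorm_zero, ENNReal.zero_rpow_of_pos h0, zero_mul, zero_mul]

variable {ω₀ ω₁ : Weight U} {θ : ℝ}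

/-- Here `|r_ω ^ ζ|^P = r_ω ^ s`. It serves both boundary lines: `s = -θ` with `ω = ω₀`, and `s = 1
- θ` with `ω = ω₁`. -/
theorem exp_mul_weight_eq_interp {P : ℝ} (hP : 0 < P) {x : Euc d} (hx : x ∈ U) {ω : Weight U}
    {s b : ℝ} (hb : b = Real.log (weightRatio ω₀ ω₁ x)) {ζ : ℂ} (hζ : ζ.re = s / P)
    (hω : s * (Real.log (ω₀ x) - Real.log (ω₁ x)) + Real.log (ω x) =
      (1 - θ) * Real.log (ω₀ x) + θ * Real.log (ω₁ x)) :
    ‖Complex.exp (ζ * b)‖ ^ P * ω x = ω₀.interp ω₁ θ x := by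
  have hlog : b = Real.log (ω₀ x) - Real.log (ω₁ x) :=
    hb.trans (Real.log_div (ω₀.pos x hx).ne' (ω₁.pos x hx).ne')
  have hre : (ζ * (b : ℂ)).re = s / P * b := by simp [hζ]
  rw [interp_eq_exp ω₀ ω₁ θ hx, ← hω, Complex.norm_exp, hre, ← Real.exp_mul, Real.exp_add,
    Real.exp_log (ω.pos x hx), ← hlog]
  congr 2
  field_simp

/-- The Sobolev norm sums `p`-th powers of partial derivatives, so the `ℓ^p` length of `∇log r_ω` is
the one that appears without loss. -/
theorem lintegral_smulGrad_eq (hp : p ≠ ∞) {ω : Weight U} {g : Euc d → ℂ} {Cg : ℝ≥0}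
    (hg : LipschitzWith Cg g) {a : Euc d → ℝ} {V : Set (Euc d)} (hV : IsOpen V)
    (hgV : tsupport g ⊆ V) (haV : ∀ x ∈ V, a x = Real.log (weightRatio ω₀ ω₁ x)) :
    ∑ k, ∫⁻ x in U, ‖smulGrad a g k x‖ₑ ^ p.toReal * ENNReal.ofReal (ω x) =
      ∫⁻ x in U, ‖g x‖ₑ ^ p.toReal * ‖gradLogRatio ω₀ ω₁ p x‖ₑ ^ p.toReal *
        ENNReal.ofReal (ω x) := by
  have h0 := toReal_pos_of_fact hp
  have hm : ∀ k, AEMeasurable (fun x => ‖smulGrad a g k x‖ₑ ^ p.toReal * ENNReal.ofReal (ω x))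
      (volume.restrict (U : Set (Euc d))) := fun k =>
    ((measurable_smulGrad hg k).enorm.pow_const _).aemeasurable.mul ω.aemeasurable.ennreal_ofReal
  rw [← lintegral_finsetSum' _ fun k _ => hm k]
  refine lintegral_congr fun x => ?_
  rw [← Finset.sum_mul]
  congr 1
  by_cases hx : x ∈ tsupport g
  · have hxV := hgV hx
    have hfd : fderiv ℝ (fun y => Real.log (weightRatio ω₀ ω₁ y)) x = fderiv ℝ a x := by
      refine Filter.EventuallyEq.fderiv_eq ?_
      filter_upwards [hV.mem_nhds hxV] with y hy
      exact (haV y hy).symm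
    rw [enorm_rpow_piLp hp, Finset.mul_sum, Fintype.sum_option]
    change ‖(0 : ℂ)‖ₑ ^ p.toReal + _ = _
    rw [enorm_zero, ENNReal.zero_rpow_of_pos h0, zero_add]
    refine Finset.sum_congr rfl fun i _ => ?_
    change ‖g x * (fderiv ℝ a x (EuclideanSpace.single i 1) : ℝ)‖ₑ ^ p.toReal =
      ‖g x‖ₑ ^ p.toReal * ‖fderiv ℝ (fun y => Real.log (weightRatio ω₀ ω₁ y)) x
        (EuclideanSpace.single i 1)‖ₑ ^ p.toReal
    rw [hfd, enorm_mul, ENNReal.mul_rpow_of_nonneg _ _ h0.le]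
    congr 2
    rw [← ofReal_norm, Complex.norm_real, ofReal_norm]
  · rw [Finset.sum_eq_zero fun k _ => by
      rw [smulGrad_eq_zero hx, enorm_zero, ENNReal.zero_rpow_of_pos h0],
      image_eq_zero_of_notMem_tsupport hx, enorm_zero, ENNReal.zero_rpow_of_pos h0, zero_mul]

/-- The boundary estimate. After the change of weight, `‖X‖^p` and `‖Y‖^p` are exactly the two
summands of the `p`-th power of the norm of `𝓦^p`, so each of `‖X‖`, `‖Y‖` is at most that norm. -/
theorem norm_le_ratioNorm_mul (hp : p ≠ ∞) {v : sobolev (ω₀.interp ω₁ θ) p}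
    (hfin : ratioNorm ω₀ ω₁ θ p p v ≠ ∞) {g : Euc d → ℂ} {Cg : ℝ≥0} (hg : LipschitzWith Cg g)
    (hvg : sobolevIncl (ω₀.interp ω₁ θ) p v =ᵐ[volume.restrict (U : Set (Euc d))] g)
    {a : Euc d → ℝ} {V : Set (Euc d)} (hV : IsOpen V) (hgV : tsupport g ⊆ V)
    (haV : ∀ x ∈ V, a x = Real.log (weightRatio ω₀ ω₁ x)) {ω : Weight U} {s : sobolev₀ ω p} {ζ : ℂ}
    (hXY : ∃ X Y : PiLp p fun _ : Option (Fin d) => Lp ℂ p ω.measure,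
      ‖s‖ₑ ≤ ‖X‖ₑ + ‖ζ‖ₑ * ‖Y‖ₑ ∧
      (∀ k, X k =ᵐ[ω.measure] fun x => Complex.exp (ζ * a x) * withGrad g k x) ∧
      ∀ k, Y k =ᵐ[ω.measure] fun x => Complex.exp (ζ * a x) * smulGrad a g k x)
    (hω : ∀ x ∈ tsupport g, ‖Complex.exp (ζ * a x)‖ ^ p.toReal * ω x = ω₀.interp ω₁ θ x) :
    ‖s‖ ≤ (ratioNorm ω₀ ω₁ θ p p v).toReal * (1 + ‖ζ‖) := by
  have hP0 := toReal_pos_of_fact hp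
  set P := p.toReal with hPdef
  set R := ratioNorm ω₀ ω₁ θ p p v with hR
  have hvk : ∀ k, v.1 k =ᵐ[volume.restrict (U : Set (Euc d))] withGrad g k := fun k => by
    have hv0 : v.1 none =ᵐ[volume.restrict (U : Set (Euc d))] g :=
      (sobolevIncl_coeFn _ v).symm.trans hvg
    cases k with
    | none => exact hv0
    | some i => exact (sobolev_hasWeakGradient v).ae_eq (hasWeakGradient_of_lipschitz U hg) hv0 i
  have hvn : ∑ k, ∫⁻ x in U, ‖withGrad g k x‖ₑ ^ P * ENNReal.ofReal (ω₀.interp ω₁ θ x) =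
      ‖v‖ₑ ^ P := by
    have : ‖v‖ₑ = ‖v.1‖ₑ := rfl
    rw [this, enorm_rpow_eq hp]
    refine Finset.sum_congr rfl fun k _ => lintegral_congr_ae ?_
    filter_upwards [hvk k] with x hx
    rw [hx]
  set I := ∫⁻ x in U, ‖sobolevIncl (ω₀.interp ω₁ θ) p v x‖ₑ ^ P *
      ‖gradLogRatio ω₀ ω₁ p x‖ₑ ^ P * ENNReal.ofReal (ω₀.interp ω₁ θ x) with hI
  have hIg : ∑ k, ∫⁻ x in U, ‖smulGrad a g k x‖ₑ ^ P * ENNReal.ofReal (ω₀.interp ω₁ θ x) = I := by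
    rw [lintegral_smulGrad_eq hp hg hV hgV haV]
    refine lintegral_congr_ae ?_
    filter_upwards [hvg] with x hx
    rw [hx]
  have hRdef : R = (‖v‖ₑ ^ P + I) ^ (1 / P) := rfl
  have hRP : R ^ P = ‖v‖ₑ ^ P + I := by
    rw [hRdef, ← ENNReal.rpow_mul, one_div_mul_cancel hP0.ne', ENNReal.rpow_one]
  obtain ⟨X, Y, hXY, hX, hY⟩ := hXY
  have hXe := enorm_rpow_eq_of_exp_mul hp (fun k x hx => withGrad_eq_zero hx k) hω hX
  have hYe := enorm_rpow_eq_of_exp_mul hp (fun k x hx => smulGrad_eq_zero (a := a) hx k) hω hY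
  have hXR : ‖X‖ₑ ≤ R := by
    refine (ENNReal.rpow_le_rpow_iff hP0).1 ?_
    rw [hXe, hvn, hRP]
    exact le_self_add
  have hYR : ‖Y‖ₑ ≤ R := by
    refine (ENNReal.rpow_le_rpow_iff hP0).1 ?_
    rw [hYe, hIg, hRP]
    exact le_add_self
  have hSR : ‖s‖ₑ ≤ R * (1 + ‖ζ‖ₑ) := by
    refine hXY.trans ?_
    rw [mul_add, mul_one, mul_comm R]
    gcongr
  have h := ENNReal.toReal_mono (by finiteness) hSR
  rwa [toReal_enorm, ENNReal.toReal_mul, ENNReal.toReal_add (by simp) (by finiteness),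
    toReal_enorm, ENNReal.toReal_one] at h

-- The function is `z ↦ exp (z² - θ²) exp (ζ a) g` with `ζ = (z - θ) / p` and `a = log r_ω` near the
-- support of `g`; at `z = θ` it equals `g`.
set_option maxHeartbeats 1000000 in
theorem exists_calderonFun_of_mem_lipC (hp : p ≠ ∞) (h₀ : ω₀.CompactlyBounded)
    (h₁ : ω₁.CompactlyBounded) (hr : LocLipschitz U (weightRatio ω₀ ω₁)) (hθ0 : 0 < θ)
    (hθ1 : θ < 1) (v : sobolev (ω₀.interp ω₁ θ) p)
    (hv : sobolevIncl (ω₀.interp ω₁ θ) p v ∈ lipC U)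
    (hfin : ratioNorm ω₀ ω₁ θ p p v ≠ ∞) :
    ∃ f : CalderonFun (sobolev₀Incl ω₀ p) (sobolev₀Incl ω₁ p),
      SumSpace.toAmbient _ _ (f.toFun θ) =
        sobolevIncl (ω₀.interp ω₁ θ) p v ∧
      f.norm ≤ 9 * (ratioNorm ω₀ ω₁ θ p p v).toReal := by
  have hP := one_le_toReal hp
  have hP0 := toReal_pos_of_fact hp
  set P := p.toReal with hPdef
  obtain ⟨g, ⟨L, hL⟩, hc, hs, hvg⟩ := hv
  obtain ⟨Cg, hg⟩ := exists_lipschitzWith_of_hasCompactSupport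
    (locallyLipschitz_of_lipschitzOnWith U.isOpen hL hs) hc
  obtain ⟨a, Ca, A, V, ha, hA0, hA, hV, hgV, hVU, haV⟩ := exists_lipschitz_log_ratio h₀ h₁ hr hc hs
  obtain ⟨S₀, hS₀d, hS₀i, ⟨c₀, hc₀⟩, hS₀n⟩ := exists_family (p := p) h₀ hg hc hs ha hA
  obtain ⟨S₁, hS₁d, hS₁i, -, hS₁n⟩ := exists_family (p := p) h₁ hg hc hs ha hA
  set R := ratioNorm ω₀ ω₁ θ p p v with hR
  let E : ℂ → ℂ := fun z => Complex.exp (z ^ 2 - (θ : ℂ) ^ 2)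
  let Z : ℂ → ℂ := fun z => (z - θ) / (P : ℂ)
  have hZd : Differentiable ℂ Z := (differentiable_id.sub_const _).div_const _
  have hEd : Differentiable ℂ E := by fun_prop
  have hZre : ∀ z, (Z z).re = (z.re - θ) / P := fun z => by
    simp only [Z, Complex.div_ofReal_re]; simp
  have hRnn : 0 ≤ R.toReal := ENNReal.toReal_nonneg
  have hfinal : ∀ {s B : ℝ} (z : ℂ), 0 ≤ z.re → z.re ≤ 1 → 0 ≤ B → s ≤ B * (1 + ‖Z z‖) →
      ‖E z‖ * s ≤ 9 * B := fun {s B} z hz hz' hB h => by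
    calc ‖E z‖ * s ≤ ‖E z‖ * (B * (1 + ‖Z z‖)) := mul_le_mul_of_nonneg_left h (norm_nonneg _)
      _ = B * (‖E z‖ * (1 + ‖Z z‖)) := by ring
      _ ≤ B * 9 := mul_le_mul_of_nonneg_left (norm_gauss_mul_le hθ0 hθ1 hP hz hz') hB
      _ = 9 * B := mul_comm _ _
  obtain ⟨f, hf, hfn⟩ := exists_calderonFun (ι₀ := sobolev₀Incl ω₀ p) (ι₁ := sobolev₀Incl ω₁ p)
    (isClosed_ker_addMap₀ h₀ h₁) (F₀ := fun z => E z • S₀ (Z z)) (F₁ := fun z => E z • S₁ (Z z))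
    (hEd.smul (hS₀d.comp hZd)) (hEd.continuous.smul (hS₁d.comp hZd).continuous) (fun z => by
      rw [map_smul, map_smul]
      congr 1
      exact AEEqFun.ext ((hS₀i _).trans (hS₁i _).symm))
    (by
      refine ⟨9 * (Real.exp A * max c₀ 0), fun z hz hz' => ?_⟩
      rw [norm_smul]
      refine hfinal z hz hz' (by positivity) ((hc₀ (Z z)).trans ?_)
      rw [mul_assoc]
      have h1 : |(Z z).re| ≤ 1 := by
        rw [hZre, abs_div, abs_of_pos hP0]
        refine (div_le_self (abs_nonneg _) hP).trans (abs_le.2 ⟨by linarith, by linarith⟩)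
      have h2 : Real.exp (|(Z z).re| * A) ≤ Real.exp A :=
        Real.exp_le_exp.2 (mul_le_of_le_one_left hA0 h1)
      have h3 : c₀ * (1 + ‖Z z‖) ≤ max c₀ 0 * (1 + ‖Z z‖) := by
        gcongr; exact le_max_left _ _
      exact (mul_le_mul_of_nonneg_left h3 (Real.exp_pos _).le).trans
        (mul_le_mul_of_nonneg_right h2 (by positivity)))
    (C := 9 * R.toReal) (by positivity)
    (fun t => by
      rw [norm_smul]
      refine hfinal _ (by simp) (by simp) hRnn (norm_le_ratioNorm_mul hp hfin hg hvg hV hgV haV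
        (hS₀n _) fun x hx => ?_)
      refine exp_mul_weight_eq_interp (s := -θ) hP0 (hs hx) (haV x (hgV hx)) ?_ (by ring)
      rw [hZre]; simp)
    (fun t => by
      rw [norm_smul]
      refine hfinal _ (by simp) (by simp) hRnn (norm_le_ratioNorm_mul hp hfin hg hvg hV hgV haV
        (hS₁n _) fun x hx => ?_)
      refine exp_mul_weight_eq_interp (s := 1 - θ) hP0 (hs hx) (haV x (hgV hx)) ?_ (by ring)
      rw [hZre]; simp)
  refine ⟨f, ?_, hfn⟩
  rw [hf, toAmbient_inl]
  have hE : E θ = 1 := by simp [E]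
  have hZ : Z θ = 0 := by simp [Z]
  rw [hE, hZ, one_smul]
  refine AEEqFun.ext ((hS₀i 0).trans (EventuallyEq.trans ?_ hvg.symm))
  exact Eventually.of_forall fun x => by simp

end WeightedSobolev

/-! ### Factorization through sums of spaces, and series in `𝓕(X₀, X₁)` -/

namespace ComplexInterpolation

section

variable {V X₀ X₁ : Type*} [AddCommGroup V] [Module ℂ V]
  [NormedAddCommGroup X₀] [NormedSpace ℂ X₀] [NormedAddCommGroup X₁] [NormedSpace ℂ X₁]
  {ι₀ : X₀ →ₗ[ℂ] V} {ι₁ : X₁ →ₗ[ℂ] V}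

/-- Transfers the local restriction maps from the sum of the spaces `W^{1,p}` to the sum of the
`W₀^{1,p}`. -/
theorem exists_factor_sumMap {Y₀ Y₁ E : Type*} [NormedAddCommGroup Y₀] [NormedSpace ℂ Y₀]
    [NormedAddCommGroup Y₁] [NormedSpace ℂ Y₁] [NormedAddCommGroup E] [NormedSpace ℂ E]
    {κ₀ : Y₀ →ₗ[ℂ] V} {κ₁ : Y₁ →ₗ[ℂ] V} (i₀ : X₀ →L[ℂ] Y₀) (i₁ : X₁ →L[ℂ] Y₁)
    (h₀ : ∀ a, κ₀ (i₀ a) = ι₀ a) (h₁ : ∀ a, κ₁ (i₁ a) = ι₁ a) (T : SumSpace κ₀ κ₁ →L[ℂ] E) :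
    ∃ T' : SumSpace ι₀ ι₁ →L[ℂ] E, ∀ s, ∃ x : WithLp 1 (Y₀ × Y₁),
      SumSpace.toAmbient ι₀ ι₁ s = κ₀ x.fst + κ₁ x.snd ∧ T' s = T (Submodule.Quotient.mk x) := by
  refine ⟨T ∘L sumMap i₀ i₁ h₀ h₁, fun s => ?_⟩
  obtain ⟨x, hx⟩ := Submodule.Quotient.mk_surjective _ (sumMap i₀ i₁ h₀ h₁ s)
  refine ⟨x, ?_, ?_⟩
  · rw [← toAmbient_sumMap i₀ i₁ h₀ h₁, ← hx, toAmbient_mk]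
  · rw [hx, ContinuousLinearMap.comp_apply]

theorem CalderonFun.exists_of_hasSum [CompleteSpace X₀] [CompleteSpace X₁]
    (hk : IsClosed (LinearMap.ker (addMap ι₀ ι₁) : Set (WithLp 1 (X₀ × X₁))))
    (f : ℕ → CalderonFun ι₀ ι₁) {b : ℕ → ℝ} (hfb : ∀ n, (f n).norm ≤ b n) {S : ℝ}
    (hb : HasSum b S) :
    ∃ F : CalderonFun ι₀ ι₁, F.norm ≤ S ∧ ∀ z : ℂ, 0 ≤ z.re → z.re ≤ 1 →
      ∃ s : ℕ → SumSpace ι₀ ι₁, Tendsto s atTop (𝓝 (F.toFun z)) ∧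
        ∀ n, SumSpace.toAmbient ι₀ ι₁ (s n) =
          ∑ i ∈ Finset.range (n + 1), SumSpace.toAmbient ι₀ ι₁ ((f i).toFun z) := by
  have hfs : Summable fun n => (f n).norm :=
    Summable.of_nonneg_of_le (fun n => (norm_nonneg _).trans (le_max_left _ _)) hfb hb.summable
  obtain ⟨F, hFn, hFs⟩ := CalderonFun.exists_tsum hk f hfs
  refine ⟨F, hFn.trans (hasSum_le hfb hfs.hasSum hb), fun z hz hz' =>
    ⟨fun n => ∑ i ∈ Finset.range (n + 1), (f i).toFun z,
      (hFs z hz hz').tendsto_sum_nat.comp (tendsto_add_atTop_nat 1), fun n => map_sum _ _ _⟩⟩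

end

end ComplexInterpolation

/-! ### The norm of `𝓦^p` and the density argument -/

namespace WeightedSobolev

open ComplexInterpolation

/-- Each `|v i|` is at most the Euclidean length `N`, so `|v i|^P ≤ N^(P-2) |v i|²`. -/
theorem piLp_norm_le_of_two_le {ι : Type*} [Fintype ι] {P : ℝ} (hP : 2 ≤ P) (v : ι → ℝ) :
    (∑ i, |v i| ^ P) ^ (1 / P) ≤ (∑ i, |v i| ^ (2 : ℝ)) ^ (1 / (2 : ℝ)) := by
  set N := (∑ i, |v i| ^ (2 : ℝ)) ^ (1 / (2 : ℝ)) with hN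
  have hS : 0 ≤ ∑ i, |v i| ^ (2 : ℝ) := Finset.sum_nonneg fun i _ => by positivity
  have hN0 : 0 ≤ N := by positivity
  have hN2 : N ^ (2 : ℝ) = ∑ i, |v i| ^ (2 : ℝ) := by
    rw [hN, ← Real.rpow_mul hS, one_div_mul_cancel two_ne_zero, Real.rpow_one]
  have hle : ∀ i, |v i| ≤ N := fun i => by
    refine (Real.rpow_le_rpow_iff (abs_nonneg _) hN0 two_pos).1 ?_
    rw [hN2]
    exact Finset.single_le_sum (f := fun i => |v i| ^ (2 : ℝ)) (fun i _ => by positivity)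
      (Finset.mem_univ i)
  have hsum : ∑ i, |v i| ^ P ≤ N ^ P := by
    have hterm : ∀ i, |v i| ^ P ≤ N ^ (P - 2) * |v i| ^ (2 : ℝ) := fun i => by
      have e : |v i| ^ P = |v i| ^ (P - 2) * |v i| ^ (2 : ℝ) := by
        rw [← Real.rpow_add_of_nonneg (abs_nonneg _) (by linarith) two_pos.le]
        congr 1; ring
      rw [e]
      gcongr
      exact hle i
    refine (Finset.sum_le_sum fun i _ => hterm i).trans (le_of_eq ?_)
    rw [← Finset.mul_sum, ← hN2, ← Real.rpow_add_of_nonneg hN0 (by linarith) two_pos.le]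
    congr 1; ring
  calc (∑ i, |v i| ^ P) ^ (1 / P) ≤ (N ^ P) ^ (1 / P) := by
        gcongr
    _ = N := by
        rw [← Real.rpow_mul hN0, mul_one_div_cancel (by linarith), Real.rpow_one]

/-- The power mean inequality with exponent `2/P`, followed by a square root: `(2/P - 1)/2 = 1/P -
1/2`. -/
theorem piLp_norm_le_of_le_two {ι : Type*} [Fintype ι] {P : ℝ} (hP : 0 < P) (hP2 : P ≤ 2)
    (v : ι → ℝ) :
    (∑ i, |v i| ^ P) ^ (1 / P) ≤
      (Fintype.card ι : ℝ) ^ (1 / P - 1 / 2) * (∑ i, |v i| ^ (2 : ℝ)) ^ (1 / (2 : ℝ)) := by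
  have hs : 1 ≤ 2 / P := (one_le_div hP).2 hP2
  have h := Real.rpow_sum_le_const_mul_sum_rpow_of_nonneg (s := Finset.univ)
    (f := fun i => |v i| ^ P) hs fun i _ => by positivity
  have e : ∀ i, (|v i| ^ P) ^ (2 / P) = |v i| ^ (2 : ℝ) := fun i => by
    rw [← Real.rpow_mul (abs_nonneg _)]; congr 1; field_simp
  simp only [e, Finset.card_univ] at h
  have hS : 0 ≤ ∑ i, |v i| ^ P := Finset.sum_nonneg fun i _ => by positivity
  have h' := Real.rpow_le_rpow (by positivity) h (by norm_num : (0 : ℝ) ≤ 1 / 2)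
  rw [← Real.rpow_mul hS, Real.mul_rpow (by positivity)
    (Finset.sum_nonneg fun i _ => by positivity), ← Real.rpow_mul (by positivity)] at h'
  convert! h' using 2
  · field_simp
  · congr 1; field_simp

theorem enorm_toLp_le {p : ℝ≥0∞} [Fact (1 ≤ p)] (hp : p ≠ ∞) {d : ℕ} (hd : 0 < d)
    (v : Fin d → ℝ) :
    ‖(WithLp.toLp p v : PiLp p fun _ : Fin d => ℝ)‖ₑ ≤
      ENNReal.ofReal ((d : ℝ) ^ max 0 (1 / p.toReal - 1 / 2)) *
        ‖(WithLp.toLp 2 v : PiLp 2 fun _ : Fin d => ℝ)‖ₑ := by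
  have hP0 := toReal_pos_of_fact hp
  have hd1 : (1 : ℝ) ≤ d := by exact_mod_cast hd
  rw [← ofReal_norm, ← ofReal_norm, ← ENNReal.ofReal_mul (by positivity)]
  refine ENNReal.ofReal_le_ofReal ?_
  rw [PiLp.norm_eq_sum hP0, PiLp.norm_eq_sum (by norm_num)]
  simp only [Real.norm_eq_abs, ENNReal.toReal_ofNat]
  rcases le_total p.toReal 2 with h | h
  · refine (piLp_norm_le_of_le_two hP0 h v).trans ?_
    rw [Fintype.card_fin]
    gcongr
    exact le_max_right _ _
  · refine (piLp_norm_le_of_two_le h v).trans (le_mul_of_one_le_left (by positivity) ?_)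
    exact Real.one_le_rpow hd1 (le_max_left _ _)

/-! ### Comparison and triangle inequality for the norms of `𝓦^p` -/

variable {d : ℕ} {U : Opens (Euc d)} {p : ℝ≥0∞} [Fact (1 ≤ p)] {ω₀ ω₁ : Weight U} {θ : ℝ}

/-- The comparison factor is at least 1, so it may also multiply the Sobolev term, where it is not
needed. -/
theorem ratioNorm_le_mul (hp : p ≠ ∞) (hd : 0 < d) (v : sobolev (ω₀.interp ω₁ θ) p) :
    ratioNorm ω₀ ω₁ θ p p v ≤
      ENNReal.ofReal ((d : ℝ) ^ max 0 (1 / p.toReal - 1 / 2)) * ratioNorm ω₀ ω₁ θ p 2 v := by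
  have hP0 := toReal_pos_of_fact hp
  set D := ENNReal.ofReal ((d : ℝ) ^ max 0 (1 / p.toReal - 1 / 2)) with hD
  have hD1 : 1 ≤ D := by
    rw [hD, ← ENNReal.ofReal_one]
    exact ENNReal.ofReal_le_ofReal
      (Real.one_le_rpow (by exact_mod_cast hd) (le_max_left _ _))
  have e : D * ratioNorm ω₀ ω₁ θ p 2 v = (D ^ p.toReal * (‖v‖ₑ ^ p.toReal +
      ∫⁻ x in U, ‖sobolevIncl (ω₀.interp ω₁ θ) p v x‖ₑ ^ p.toReal *
      ‖gradLogRatio ω₀ ω₁ 2 x‖ₑ ^ p.toReal *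
        ENNReal.ofReal (ω₀.interp ω₁ θ x))) ^ (1 / p.toReal) := by
    rw [ENNReal.mul_rpow_of_nonneg _ _ (by positivity), ← ENNReal.rpow_mul,
      mul_one_div_cancel hP0.ne', ENNReal.rpow_one]
    rfl
  rw [e]
  refine ENNReal.rpow_le_rpow ?_ (by positivity)
  rw [mul_add, ← lintegral_const_mul' _ _ (by finiteness)]
  refine add_le_add ?_ (lintegral_mono fun x => ?_)
  · exact le_mul_of_one_le_left' (ENNReal.one_le_rpow hD1 hP0)
  · have h : ‖gradLogRatio ω₀ ω₁ p x‖ₑ ^ p.toReal ≤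
        D ^ p.toReal * ‖gradLogRatio ω₀ ω₁ 2 x‖ₑ ^ p.toReal := by
      rw [← ENNReal.mul_rpow_of_nonneg _ _ hP0.le]
      exact ENNReal.rpow_le_rpow (enorm_toLp_le hp hd _) hP0.le
    calc _ ≤ ‖sobolevIncl (ω₀.interp ω₁ θ) p v x‖ₑ ^ p.toReal *
          (D ^ p.toReal * ‖gradLogRatio ω₀ ω₁ 2 x‖ₑ ^ p.toReal) *
          ENNReal.ofReal (ω₀.interp ω₁ θ x) := by gcongr
      _ = _ := by ring

theorem enorm_le_ratioNorm (hp : p ≠ ∞) (q : ℝ≥0∞) [Fact (1 ≤ q)]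
    (v : sobolev (ω₀.interp ω₁ θ) p) : ‖v‖ₑ ≤ ratioNorm ω₀ ω₁ θ p q v := by
  have hP0 := toReal_pos_of_fact hp
  rw [← ENNReal.rpow_le_rpow_iff hP0, ratioNorm, ← ENNReal.rpow_mul,
    one_div_mul_cancel hP0.ne', ENNReal.rpow_one]
  exact le_self_add

theorem ratioNorm_neg (q : ℝ≥0∞) [Fact (1 ≤ q)] (v : sobolev (ω₀.interp ω₁ θ) p) :
    ratioNorm ω₀ ω₁ θ p q (-v) = ratioNorm ω₀ ω₁ θ p q v := by
  rw [ratioNorm, ratioNorm, enorm_neg]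
  congr 2
  refine lintegral_congr_ae ?_
  rw [map_neg]
  filter_upwards [AEEqFun.coeFn_neg (sobolevIncl (ω₀.interp ω₁ θ) p v)] with x hx
  rw [hx, Pi.neg_apply, enorm_neg]

theorem measurable_gradLogRatio (q : ℝ≥0∞) [Fact (1 ≤ q)] :
    Measurable (gradLogRatio ω₀ ω₁ q) := by
  refine (PiLp.continuous_toLp q _).measurable.comp (measurable_pi_lambda _ fun i => ?_)
  exact measurable_fderiv_single _ i

theorem rpow_add_rpow_add_le {P : ℝ} (hP : 1 ≤ P) {a a' b b' c c' : ℝ≥0∞} (ha : a ≤ b + c)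
    (ha' : a' ≤ b' + c') :
    (a ^ P + a' ^ P) ^ (1 / P) ≤ (b ^ P + b' ^ P) ^ (1 / P) + (c ^ P + c' ^ P) ^ (1 / P) := by
  have hP0 : 0 ≤ P := zero_le_one.trans hP
  have h := ENNReal.Lp_add_le Finset.univ ![b, b'] ![c, c'] hP
  simp only [Fin.sum_univ_two, Matrix.cons_val_zero, Matrix.cons_val_one] at h
  exact le_trans (ENNReal.rpow_le_rpow (add_le_add (ENNReal.rpow_le_rpow ha hP0)
    (ENNReal.rpow_le_rpow ha' hP0)) (by positivity)) h

/-- The norm is the `ℓ^p` norm of a pair: the Sobolev norm, and the `L^p(ω_θ)` norm of `|v| |∇log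
r_ω|`. Minkowski is used in `L^p` and then for pairs. -/
theorem ratioNorm_add_le (hp : p ≠ ∞) (q : ℝ≥0∞) [Fact (1 ≤ q)]
    (v w : sobolev (ω₀.interp ω₁ θ) p) :
    ratioNorm ω₀ ω₁ θ p q (v + w) ≤ ratioNorm ω₀ ω₁ θ p q v + ratioNorm ω₀ ω₁ θ p q w := by
  have hP := one_le_toReal hp
  have hP0 := toReal_pos_of_fact hp
  let F : sobolev (ω₀.interp ω₁ θ) p → Euc d → ℝ≥0∞ := fun v x =>
    ‖sobolevIncl (ω₀.interp ω₁ θ) p v x‖ₑ * ‖gradLogRatio ω₀ ω₁ q x‖ₑ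
  have hF : ∀ v, AEMeasurable (F v) (volume.restrict (U : Set (Euc d))) := fun v =>
    (sobolevIncl (ω₀.interp ω₁ θ) p v).aestronglyMeasurable.enorm.mul
      (measurable_gradLogRatio q).enorm.aemeasurable
  let J : sobolev (ω₀.interp ω₁ θ) p → ℝ≥0∞ := fun v =>
    (∫⁻ x, F v x ^ p.toReal ∂(ω₀.interp ω₁ θ).measure) ^ (1 / p.toReal)
  have hJ : ∀ v, ratioNorm ω₀ ω₁ θ p q v =
      (‖v‖ₑ ^ p.toReal + J v ^ p.toReal) ^ (1 / p.toReal) := fun v => by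
    simp only [J]
    rw [← ENNReal.rpow_mul, one_div_mul_cancel hP0.ne', ENNReal.rpow_one,
      lintegral_weight_measure (ω₀.interp ω₁ θ) ((hF v).pow_const _), ratioNorm]
    congr 3
    funext x
    simp only [F]
    rw [ENNReal.mul_rpow_of_nonneg _ _ hP0.le]
  have hJadd : J (v + w) ≤ J v + J w := by
    refine le_trans (ENNReal.rpow_le_rpow (lintegral_mono_ae ?_) (by positivity))
      (ENNReal.lintegral_Lp_add_le ((hF v).mono_ac (measure_absolutelyContinuous (ω₀.interp ω₁ θ)))
        ((hF w).mono_ac (measure_absolutelyContinuous (ω₀.interp ω₁ θ))) hP)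
    refine (measure_absolutelyContinuous (ω₀.interp ω₁ θ)).ae_le ?_
    filter_upwards [AEEqFun.coeFn_add (sobolevIncl (ω₀.interp ω₁ θ) p v)
      (sobolevIncl (ω₀.interp ω₁ θ) p w)] with x hx
    refine ENNReal.rpow_le_rpow ?_ hP0.le
    simp only [F, Pi.add_apply]
    rw [(sobolevIncl (ω₀.interp ω₁ θ) p).map_add v w, hx, Pi.add_apply, ← add_mul]
    gcongr
    exact enorm_add_le _ _
  rw [hJ, hJ, hJ]
  exact rpow_add_rpow_add_le hP (enorm_add_le _ _) hJadd

theorem Weight.CompactlyBounded.interp (h₀ : ω₀.CompactlyBounded) (h₁ : ω₁.CompactlyBounded)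
    (θ : ℝ) : (ω₀.interp ω₁ θ).CompactlyBounded := by
  intro K hK hKU
  obtain ⟨B₀, hB₀, hl₀⟩ := h₀.exists_abs_log_le hK hKU
  obtain ⟨B₁, hB₁, hl₁⟩ := h₁.exists_abs_log_le hK hKU
  set B := |1 - θ| * B₀ + |θ| * B₁
  refine ⟨Real.exp (-B), Real.exp B, Real.exp_pos _, fun x hx => ?_⟩
  have h : |(1 - θ) * Real.log (ω₀ x) + θ * Real.log (ω₁ x)| ≤ B := by
    refine (abs_add_le _ _).trans ?_
    rw [abs_mul, abs_mul]
    exact add_le_add (mul_le_mul_of_nonneg_left (hl₀ x hx) (abs_nonneg _))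
      (mul_le_mul_of_nonneg_left (hl₁ x hx) (abs_nonneg _))
  rw [interp_eq_exp ω₀ ω₁ θ (hKU hx)]
  exact ⟨Real.exp_le_exp.2 (abs_le.1 h).1, Real.exp_le_exp.2 (abs_le.1 h).2⟩

/-! ### Identification of limits and the density argument -/

theorem sobolevIncl_sobolev₀Inclusion (ω : Weight U) (w : sobolev₀ ω p) :
    sobolevIncl ω p (sobolev₀Inclusion ω p w) = sobolev₀Incl ω p w := rfl

set_option maxHeartbeats 1000000 in
/-- Restriction of functions in `W₀^{1,p}(U, ω₀) + W₀^{1,p}(U, ω₁)` to a compact subset of `U`. -/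
theorem exists_restrict_sumSpace₀ (h₀ : ω₀.CompactlyBounded) (h₁ : ω₁.CompactlyBounded)
    {K : Set (Euc d)} (hK : IsCompact K) (hKU : K ⊆ U) :
    ∃ T : SumSpace (sobolev₀Incl ω₀ p) (sobolev₀Incl ω₁ p) →L[ℂ] Lp ℂ p (volume.restrict K),
      ∀ s, T s =ᵐ[volume.restrict K]
        SumSpace.toAmbient (sobolev₀Incl ω₀ p) (sobolev₀Incl ω₁ p) s := by
  obtain ⟨T, hT⟩ := exists_restrict_sumSpace (p := p) h₀ h₁ hK hKU none
  obtain ⟨T', hT'⟩ := exists_factor_sumMap (sobolev₀Inclusion ω₀ p) (sobolev₀Inclusion ω₁ p)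
    (sobolevIncl_sobolev₀Inclusion ω₀) (sobolevIncl_sobolev₀Inclusion ω₁) T
  refine ⟨T', fun s => ?_⟩
  obtain ⟨x, hx, hTx⟩ := hT' s
  rw [hx, hTx]
  refine (hT x).trans (ae_restrict_of_ae_restrict_of_subset hKU ?_)
  filter_upwards [AEEqFun.coeFn_add (sobolevIncl ω₀ p x.fst) (sobolevIncl ω₁ p x.snd),
    sobolevIncl_coeFn ω₀ x.fst, sobolevIncl_coeFn ω₁ x.snd] with y e1 e2 e3
  rw [e1, Pi.add_apply, e2, e3]

/-- Limits in `W₀^{1,p}(U, ω₀) + W₀^{1,p}(U, ω₁)` and in `W^{1,p}(U, ω)` agree. -/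
theorem toAmbient_eq_of_tendsto (h₀ : ω₀.CompactlyBounded) (h₁ : ω₁.CompactlyBounded)
    {ω : Weight U} (hω : ω.CompactlyBounded)
    {s : ℕ → SumSpace (sobolev₀Incl ω₀ p) (sobolev₀Incl ω₁ p)}
    {s' : SumSpace (sobolev₀Incl ω₀ p) (sobolev₀Incl ω₁ p)} (hs : Tendsto s atTop (𝓝 s'))
    {v : ℕ → sobolev ω p} {φ : sobolev ω p} (hv : Tendsto v atTop (𝓝 φ))
    (h : ∀ n, SumSpace.toAmbient (sobolev₀Incl ω₀ p) (sobolev₀Incl ω₁ p) (s n) =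
      sobolevIncl ω p (v n)) :
    SumSpace.toAmbient (sobolev₀Incl ω₀ p) (sobolev₀Incl ω₁ p) s' = sobolevIncl ω p φ := by
  refine AEEqFun.ext (ae_restrict_of_forall_compact fun K hK hKU => ?_)
  obtain ⟨T, hT⟩ := exists_restrict_sumSpace₀ (p := p) h₀ h₁ hK hKU
  obtain ⟨R, hR⟩ := hω.exists_restrict_sobolev (p := p) hK hKU none
  have hincl : ∀ w : sobolev ω p, R w =ᵐ[volume.restrict K] sobolevIncl ω p w := fun w =>
    (hR w).trans (ae_restrict_of_ae_restrict_of_subset hKU (sobolevIncl_coeFn ω w).symm)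
  have hTR : ∀ n, T (s n) = R (v n) := fun n => Lp.ext (by
    refine (hT (s n)).trans ?_
    rw [h n]
    exact (hincl (v n)).symm)
  have h1 : Tendsto (fun n => T (s n)) atTop (𝓝 (T s')) := (T.continuous.tendsto _).comp hs
  have h2 : Tendsto (fun n => T (s n)) atTop (𝓝 (R φ)) := by
    simp only [hTR]
    exact (R.continuous.tendsto _).comp hv
  have h3 : T s' = R φ := tendsto_nhds_unique h1 h2
  have h4 := hT s'
  rw [h3] at h4
  exact h4.symm.trans (hincl φ)

theorem exists_calderonFun_sub (hp : p ≠ ∞) (h₀ : ω₀.CompactlyBounded)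
    (h₁ : ω₁.CompactlyBounded) (hr : LocLipschitz U (weightRatio ω₀ ω₁)) (hθ0 : 0 < θ)
    (hθ1 : θ < 1) {v : sobolev (ω₀.interp ω₁ θ) p}
    (hv : sobolevIncl (ω₀.interp ω₁ θ) p v ∈ lipC U) {R : ℝ} (hR0 : 0 ≤ R)
    (hR : ratioNorm ω₀ ω₁ θ p p v ≤ ENNReal.ofReal R) :
    ∃ f : CalderonFun (sobolev₀Incl ω₀ p) (sobolev₀Incl ω₁ p),
      SumSpace.toAmbient (sobolev₀Incl ω₀ p) (sobolev₀Incl ω₁ p) (f.toFun θ) =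
        sobolevIncl (ω₀.interp ω₁ θ) p v ∧
      f.norm ≤ 9 * R := by
  obtain ⟨f, hf, hfn⟩ := exists_calderonFun_of_mem_lipC hp h₀ h₁ hr hθ0 hθ1 v hv
    (hR.trans_lt ENNReal.ofReal_lt_top).ne
  refine ⟨f, hf, hfn.trans (mul_le_mul_of_nonneg_left ?_ (by norm_num))⟩
  exact ENNReal.toReal_le_of_le_ofReal hR0 hR

-- Completeness replaces linearity of the construction: Lipschitz approximants `v n` are telescoped,
-- each difference is lifted to `𝓕` separately, and the lifts are summed. The sum at `θ` is
-- identified with `φ` by comparing limits on compact sets.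
set_option maxHeartbeats 1000000 in
theorem exists_calderonFun_of_mem_ratioSpace₀ (hp : p ≠ ∞) (hd : 0 < d)
    (h₀ : ω₀.CompactlyBounded) (h₁ : ω₁.CompactlyBounded)
    (hr : LocLipschitz U (weightRatio ω₀ ω₁)) (hθ0 : 0 < θ) (hθ1 : θ < 1)
    {φ : sobolev (ω₀.interp ω₁ θ) p} (hφ : φ ∈ ratioSpace₀ ω₀ ω₁ θ p) {η : ℝ} (hη : 0 < η) :
    ∃ f : CalderonFun (sobolev₀Incl ω₀ p) (sobolev₀Incl ω₁ p),
      SumSpace.toAmbient (sobolev₀Incl ω₀ p) (sobolev₀Incl ω₁ p) (f.toFun θ) =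
        sobolevIncl (ω₀.interp ω₁ θ) p φ ∧
      f.norm ≤ 9 * ((ratioNorm ω₀ ω₁ θ p p φ).toReal + 5 * η) := by
  have hP0 := toReal_pos_of_fact hp
  obtain ⟨hφ2, happ⟩ := hφ
  set D : ℝ := (d : ℝ) ^ max 0 (1 / p.toReal - 1 / 2) with hD
  have hD1 : 1 ≤ D := Real.one_le_rpow (by exact_mod_cast hd) (le_max_left _ _)
  have hD0 : 0 < D := by linarith
  have hφp : ratioNorm ω₀ ω₁ θ p p φ ≠ ∞ :=
    ((ratioNorm_le_mul hp hd φ).trans_lt (ENNReal.mul_lt_top ENNReal.ofReal_lt_top hφ2)).ne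
  set R := (ratioNorm ω₀ ω₁ θ p p φ).toReal with hR
  have hR0 : 0 ≤ R := ENNReal.toReal_nonneg
  let δ : ℕ → ℝ := fun n => η * (1 / 2) ^ n
  have hδ : ∀ n, 0 < δ n := fun n => by positivity
  -- Approximation is given in the Euclidean version of the norm; dividing by `D` yields error `δ n`
  -- in the `ℓ^p` version.
  choose v hv hvl hvn using fun n => happ (ENNReal.ofReal (δ n / D))
    (ENNReal.ofReal_pos.2 (div_pos (hδ n) hD0))
  have hvp : ∀ n, ratioNorm ω₀ ω₁ θ p p (φ - v n) ≤ ENNReal.ofReal (δ n) := fun n => by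
    refine (ratioNorm_le_mul hp hd _).trans ((mul_le_mul_right (hvn n).le _).trans (le_of_eq ?_))
    rw [← hD, ← ENNReal.ofReal_mul hD0.le, mul_div_cancel₀ _ hD0.ne']
  let u : ℕ → sobolev (ω₀.interp ω₁ θ) p := fun n => n.casesOn (v 0) fun m => v (m + 1) - v m
  -- Bounds for the terms of the telescoping series, from `δ m + δ (m + 1) ≤ 2 δ m`.
  let B : ℕ → ℝ := fun n => n.casesOn (R + δ 0) fun m => 2 * δ m
  have hB0 : ∀ n, 0 ≤ B n := fun n => by
    cases n with
    | zero => exact add_nonneg hR0 (hδ 0).le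
    | succ m => exact mul_nonneg two_pos.le (hδ m).le
  have hul : ∀ n, sobolevIncl (ω₀.interp ω₁ θ) p (u n) ∈ lipC U := fun n => by
    cases n with
    | zero => exact hvl 0
    | succ m =>
      change sobolevIncl (ω₀.interp ω₁ θ) p (v (m + 1) - v m) ∈ _
      rw [map_sub]
      exact Submodule.sub_mem _ (hvl _) (hvl _)
  have huB : ∀ n, ratioNorm ω₀ ω₁ θ p p (u n) ≤ ENNReal.ofReal (B n) := fun n => by
    cases n with
    | zero =>
      have e : u 0 = φ + -(φ - v 0) := by change v 0 = _; abel
      rw [e]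
      refine (ratioNorm_add_le hp p _ _).trans ?_
      rw [ratioNorm_neg]
      change _ ≤ ENNReal.ofReal (R + δ 0)
      rw [ENNReal.ofReal_add hR0 (hδ 0).le, hR, ENNReal.ofReal_toReal hφp]
      gcongr
      exact hvp 0
    | succ m =>
      have e : u (m + 1) = (φ - v m) + -(φ - v (m + 1)) := by
        change v (m + 1) - v m = _; abel
      rw [e]
      refine (ratioNorm_add_le hp p _ _).trans ?_
      rw [ratioNorm_neg]
      change _ ≤ ENNReal.ofReal (2 * δ m)
      rw [two_mul, ENNReal.ofReal_add (hδ m).le (hδ m).le]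
      refine add_le_add (hvp m) ((hvp (m + 1)).trans (ENNReal.ofReal_le_ofReal ?_))
      simp only [δ, pow_succ]
      nlinarith [hδ m]
  choose f hf hfB using fun n =>
    exists_calderonFun_sub hp h₀ h₁ hr hθ0 hθ1 (hul n) (hB0 n) (huB n)
  -- The initial term contributes `R + η` and the differences `2 ∑ δ m = 4 η`.
  have hBs : HasSum B (R + 5 * η) := by
    have h1 : HasSum (fun m => B (m + 1)) (4 * η) := by
      have h := (hasSum_geometric_two.mul_left η).mul_left 2
      convert! h using 1
      ring
    have h2 := (hasSum_nat_add_iff (f := B) 1).1 h1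
    convert! h2 using 1
    rw [Finset.sum_range_one]
    change _ = 4 * η + (R + η * (1 / 2) ^ 0)
    ring
  have : CompleteSpace (sobolev₀ ω₀ p) := completeSpace_sobolev₀ h₀
  have : CompleteSpace (sobolev₀ ω₁ p) := completeSpace_sobolev₀ h₁
  obtain ⟨F, hFn, hF⟩ := CalderonFun.exists_of_hasSum (isClosed_ker_addMap₀ h₀ h₁) f
    (fun n => hfB n) (hBs.mul_left 9)
  obtain ⟨s, hs, hsf⟩ := hF θ (by simpa using hθ0.le) (by simpa using hθ1.le)
  have hpart : ∀ n, ∑ i ∈ Finset.range (n + 1), u i = v n := fun n => by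
    induction n with
    | zero => rw [Finset.sum_range_one]; rfl
    | succ m ih =>
      rw [Finset.sum_range_succ, ih]
      change v m + (v (m + 1) - v m) = _
      abel
  refine ⟨F, toAmbient_eq_of_tendsto h₀ h₁ (h₀.interp h₁ θ) hs (v := v) ?_ fun n => ?_, hFn⟩
  · rw [tendsto_iff_norm_sub_tendsto_zero]
    have hδ0 : Tendsto δ atTop (𝓝 0) := by
      have h := (tendsto_pow_atTop_nhds_zero_of_lt_one (r := (1 / 2 : ℝ)) (by norm_num)
        (by norm_num)).const_mul η
      rwa [mul_zero] at h
    refine squeeze_zero (fun n => norm_nonneg _) (fun n => ?_) hδ0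
    have h := (enorm_le_ratioNorm hp p (φ - v n)).trans (hvp n)
    rw [norm_sub_rev]
    have h' := ENNReal.toReal_le_of_le_ofReal (hδ n).le h
    rwa [toReal_enorm] at h'
  · rw [hsf n, ← hpart n, map_sum]
    exact Finset.sum_congr rfl fun i _ => hf i

end WeightedSobolev

/-! ### The main theorem -/

namespace WeightedSobolev

open ComplexInterpolation

variable {d : ℕ} {U : Opens (Euc d)} {p : ℝ≥0∞} [Fact (1 ≤ p)] {ω₀ ω₁ : Weight U} {θ : ℝ}

theorem interpSpace_subset_range (hp : p ≠ ∞) (h₀ : ω₀.CompactlyBounded)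
    (h₁ : ω₁.CompactlyBounded) (hθ0 : 0 < θ) (hθ1 : θ < 1) :
    interpSpace (sobolevIncl ω₀ p) (sobolevIncl ω₁ p) θ ⊆
      range (sobolevIncl (ω₀.interp ω₁ θ) p) := by
  rintro a ⟨f, rfl⟩
  obtain ⟨w, hw, -⟩ := exists_sobolev_of_calderonFun hp h₀ h₁ hθ0 hθ1 f
  exact ⟨w, hw⟩

theorem enorm_le_interpNorm (hp : p ≠ ∞) (h₀ : ω₀.CompactlyBounded)
    (h₁ : ω₁.CompactlyBounded) (hθ0 : 0 < θ) (hθ1 : θ < 1)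
    (φ : sobolev (ω₀.interp ω₁ θ) p) :
    ‖φ‖ₑ ≤ interpNorm (sobolevIncl ω₀ p) (sobolevIncl ω₁ p) θ
      (sobolevIncl (ω₀.interp ω₁ θ) p φ) := by
  refine le_iInf fun f => ?_
  obtain ⟨w, hw, hwn⟩ := exists_sobolev_of_calderonFun hp h₀ h₁ hθ0 hθ1 f.1
  -- The Sobolev element produced from `f` represents the same function as `φ`, hence is `φ`.
  rwa [sobolevIncl_injective _ (hw.trans f.2)] at hwn

theorem ratioNorm_ne_top (hp : p ≠ ∞) (hd : 0 < d) {φ : sobolev (ω₀.interp ω₁ θ) p}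
    (hφ : φ ∈ ratioSpace ω₀ ω₁ θ p) : ratioNorm ω₀ ω₁ θ p p φ ≠ ∞ :=
  ((ratioNorm_le_mul hp hd φ).trans_lt (ENNReal.mul_lt_top ENNReal.ofReal_lt_top hφ)).ne

set_option maxHeartbeats 1000000 in
theorem interpNorm_le_ratioNorm (hp : p ≠ ∞) (hd : 0 < d) (h₀ : ω₀.CompactlyBounded)
    (h₁ : ω₁.CompactlyBounded) (hr : LocLipschitz U (weightRatio ω₀ ω₁)) (hθ0 : 0 < θ)
    (hθ1 : θ < 1) {φ : sobolev (ω₀.interp ω₁ θ) p} (hφ : φ ∈ ratioSpace₀ ω₀ ω₁ θ p) :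
    interpNorm (sobolevIncl ω₀ p) (sobolevIncl ω₁ p) θ (sobolevIncl (ω₀.interp ω₁ θ) p φ) ≤
      ENNReal.ofReal 9 * ratioNorm ω₀ ω₁ θ p p φ := by
  refine ENNReal.le_of_forall_pos_le_add fun ε hε _ => ?_
  obtain ⟨f, hf, hfn⟩ := exists_calderonFun_of_mem_ratioSpace₀ hp hd h₀ h₁ hr hθ0 hθ1 hφ
    -- Chosen so that the excess `9 · 5 η` equals `ε`.
    (η := (ε : ℝ) / 45) (by positivity)
  refine (interpNorm_le_of_calderonFun (isClosed_ker_addMap₀ h₀ h₁) (isClosed_ker_addMap h₀ h₁)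
    (sobolev₀Inclusion ω₀ p) (sobolev₀Inclusion ω₁ p) (sobolevIncl_sobolev₀Inclusion ω₀)
    (sobolevIncl_sobolev₀Inclusion ω₁) (fun _ => le_rfl) (fun _ => le_rfl) f hf).trans ?_
  refine (ENNReal.ofReal_le_ofReal hfn).trans (le_of_eq ?_)
  rw [show (9 : ℝ) * ((ratioNorm ω₀ ω₁ θ p p φ).toReal + 5 * ((ε : ℝ) / 45)) =
      9 * (ratioNorm ω₀ ω₁ θ p p φ).toReal + ε by ring,
    ENNReal.ofReal_add (by positivity) ε.coe_nonneg, ENNReal.ofReal_mul (by norm_num),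
    ENNReal.ofReal_toReal (ratioNorm_ne_top hp hd hφ.1), ENNReal.ofReal_coe_nnreal]

end WeightedSobolev

end

theorem theorem1p1 (p : ℝ≥0∞) [Fact (1 ≤ p)] (hp : p ≠ ∞) :
    ∃ C : ℝ, 0 < C ∧
      ∀ (d : ℕ) (_ : 0 < d) (U : Opens (EuclideanSpace ℝ (Fin d)))
        (ω₀ ω₁ : WeightedSobolev.Weight U) (θ : ℝ),
        ω₀.CompactlyBounded → ω₁.CompactlyBounded →
        WeightedSobolev.LocLipschitz U (WeightedSobolev.weightRatio ω₀ ω₁) →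
        0 < θ → θ < 1 →
        -- `[W^{1,p}(U,ω₀), W^{1,p}(U,ω₁)]_θ ⊆ W^{1,p}(U,ω_θ)`
        (ComplexInterpolation.interpSpace (WeightedSobolev.sobolevIncl ω₀ p)
            (WeightedSobolev.sobolevIncl ω₁ p) θ ⊆
          Set.range (WeightedSobolev.sobolevIncl (ω₀.interp ω₁ θ) p)) ∧
        -- `𝓦₀^p(U,θ,r_ω) ⊆ [W₀^{1,p}(U,ω₀), W₀^{1,p}(U,ω₁)]_θ`
        (WeightedSobolev.sobolevIncl (ω₀.interp ω₁ θ) p ''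
            WeightedSobolev.ratioSpace₀ ω₀ ω₁ θ p ⊆
          ComplexInterpolation.interpSpace (WeightedSobolev.sobolev₀Incl ω₀ p)
            (WeightedSobolev.sobolev₀Incl ω₁ p) θ) ∧
        -- the norm inequalities
        (∀ φ ∈ WeightedSobolev.ratioSpace₀ ω₀ ω₁ θ p,
          ‖φ‖ₑ ≤ ComplexInterpolation.interpNorm (WeightedSobolev.sobolevIncl ω₀ p)
              (WeightedSobolev.sobolevIncl ω₁ p) θ
              (WeightedSobolev.sobolevIncl (ω₀.interp ω₁ θ) p φ) ∧
          -- `|∇ log r_ω|` measured by its `ℓ^p` norm: the constant depends on `p` only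
          ComplexInterpolation.interpNorm (WeightedSobolev.sobolevIncl ω₀ p)
              (WeightedSobolev.sobolevIncl ω₁ p) θ
              (WeightedSobolev.sobolevIncl (ω₀.interp ω₁ θ) p φ) ≤
            ENNReal.ofReal C * WeightedSobolev.ratioNorm ω₀ ω₁ θ p p φ ∧
          -- `|∇ log r_ω|` measured by its Euclidean norm: for `p < 2` the dimension enters
          ComplexInterpolation.interpNorm (WeightedSobolev.sobolevIncl ω₀ p)
              (WeightedSobolev.sobolevIncl ω₁ p) θ
              (WeightedSobolev.sobolevIncl (ω₀.interp ω₁ θ) p φ) ≤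
            ENNReal.ofReal (C * (d : ℝ) ^ max 0 (1 / p.toReal - 1 / 2)) *
              WeightedSobolev.ratioNorm ω₀ ω₁ θ p 2 φ) := by
  -- The constant of `norm_gauss_mul_le`; the same number works for every `p`.
  refine ⟨9, by norm_num, fun d hd U ω₀ ω₁ θ h₀ h₁ hr hθ0 hθ1 =>
    ⟨WeightedSobolev.interpSpace_subset_range hp h₀ h₁ hθ0 hθ1, ?_, fun φ hφ =>
      ⟨WeightedSobolev.enorm_le_interpNorm hp h₀ h₁ hθ0 hθ1 φ,
        WeightedSobolev.interpNorm_le_ratioNorm hp hd h₀ h₁ hr hθ0 hθ1 hφ, ?_⟩⟩⟩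
  · rintro _ ⟨φ, hφ, rfl⟩
    -- For membership alone the size of `f` is irrelevant, so `η = 1` will do.
    obtain ⟨f, hf, -⟩ := WeightedSobolev.exists_calderonFun_of_mem_ratioSpace₀ hp hd h₀ h₁ hr
      hθ0 hθ1 hφ one_pos
    exact ⟨f, hf⟩
  · refine (WeightedSobolev.interpNorm_le_ratioNorm hp hd h₀ h₁ hr hθ0 hθ1 hφ).trans ?_
    rw [ENNReal.ofReal_mul (by norm_num), mul_assoc]
    exact mul_le_mul_right (WeightedSobolev.ratioNorm_le_mul hp hd φ) _
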